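/- Let $R_0$ be a reduced (crystallographic) root system spanning a finite-dimensional real vector space $E$, with basis $F_0$, Weyl group $W_0$, and affine Weyl group $W^{\mathrm{aff}}=\mathbb Z R_0\rtimes W_0$ acting on $E$. The hyperplanes $\{x\in E:\langle x,\alpha^\vee\rangle+k=0\}$ ($\alpha\in R_0$, $k\in\mathbb Z$) give $E$ the structure of a polysimplicial complex $\Sigma$, whose (closed) polysimplices are the closures of the facets. Let $A_\emptyset=\{x\in E:\langle x,\alpha^\vee\rangle>0 \text{ for all } \alpha\in F_0,\ \langle x,\alpha^\vee\rangle<1 \text{ for all maximal coroots } \alpha^\vee\}$ be the fundamental alcove (maximal for the dominance ordering). Let $r'$ be the number of irreducible components of $R_0$, which are numbered $1,\dots,r'$. A polysimplex is a product $\sigma=\sigma^{(1)}\times\cdots\times\sigma^{(r')}$ of simplices, one for each irreducible component; let $d_j=\dim\sigma^{(j)}$. Fix orientations of the faces of $\overline{A_\emptyset}$ (vertices being oriented positively) and transport them by $W^{\mathrm{aff}}$ to orientations of all polysimplices of $\Sigma$. Let $C_n(\Sigma)$ be the complex vector space with basis the $n$-dimensional polysimplices ($n\ge 0$), $C_{-1}(\Sigma)=\mathbb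 C$, and for $n>0$ let $$\partial_n\sigma=\sum_{j=1}^{r'}(-1)^{d_1+\cdots+d_{j-1}}\,\sigma^{(1)}\times\cdots\times\partial\sigma^{(j)}\times\cdots\times\sigma^{(r')},\qquad \partial[x_0,\dots,x_d]=\sum_{i=0}^d(-1)^i[x_0,\dots,\widehat{x_i},\dots,x_d],\quad \partial[x_0]=0,$$ and $\partial_0[x]=1$ for every vertex $x$. The group $W_0$ acts on $C_n(\Sigma)$ for $n\ge0$ by $\sigma\mapsto w\sigma$, and trivially on $C_{-1}(\Sigma)$. The support of a chain $\sum_\sigma c_\sigma\sigma$ is $\bigcup_{c_\sigma\ne0}\sigma\subset E$. For $K\subset E$ let $$A(K)=\bigcap_{\alpha\in R_0}\{x\in E: m(K,\alpha)\le\langle x,\alpha^\vee\rangle\le M(K,\alpha)\},$$ where $m(K,\alpha)=\inf\{\lfloor\langle x,\alpha^\vee\rangle\rfloor:x\in K\cup A_\emptyset\}$ and $M(K,\alpha)=\sup\{\lceil\langle x,\alpha^\vee\rangle\rceil:x\in K\cup A_\emptyset\}$. Then there exist linear maps $\gamma_n:C_n(\Sigma)\to C_{n+1}(\Sigma)$,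 $n\ge-1$, such that: 1. $\gamma\partial+\partial\gamma=\mathrm{id}$ in every degree $n\ge-1$, i.e. $\partial_0\gamma_{-1}=\mathrm{id}$ and $\gamma_{n-1}\partial_n+\partial_{n+1}\gamma_n=\mathrm{id}$ for $n\ge0$; 2. $\gamma$ is $W_0$-equivariant; 3. $\operatorname{supp}\gamma(\sigma)\subset A(\sigma)$ for every polysimplex $\sigma\in\Sigma$; 4. there is a constant $M_\gamma$, depending only on $\gamma$, such that all coefficients in $\gamma(\sigma)=\sum_{\tau\in\Sigma}\gamma_{\sigma\tau}\tau$ ($\sigma\in\Sigma$) satisfy $|\gamma_{\sigma\tau}|<M_\gamma$. -/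

import Mathlib

noncomputable section

namespace AlcoveComplex

variable {ι E N : Type*} [AddCommGroup E] [Module ℝ E] [AddCommGroup N] [Module ℝ N]

/-- The affine root `a = (α_i^∨, k)`, as the affine function `x ↦ ⟨x, α_i^∨⟩ + k` on `E`.
The hyperplane `H_a` is its zero set. -/
def affineRoot (P : RootPairing ι ℝ E N) (a : ι × ℤ) (x : E) : ℝ :=
  P.coroot' a.1 x + (a.2 : ℝ)

/-- The closure of the facet of the arrangement `{H_a}` that contains `x`. The facet itself is
the set of points at which every affine root has the same sign (`< 0`, `= 0` or `> 0`) as at `x`;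
its closure is obtained by making all the inequalities weak. (Since `-a` is an affine root
whenever `a` is, only the conditions `0 ≤ a` have to be listed.) -/
def closedFacet (P : RootPairing ι ℝ E N) (x : E) : Set E :=
  {y | ∀ a : ι × ℤ, 0 ≤ affineRoot P a x → 0 ≤ affineRoot P a y}

/-- The polysimplicial complex `Σ`, as the set of its (closed) polysimplices. -/
def polysimplices (P : RootPairing ι ℝ E N) : Set (Set E) :=
  Set.range (closedFacet P)

/-- The dimension of a subset of `E`, i.e. that of its affine span. -/
def setDim (σ : Set E) : ℕ := Module.finrank ℝ (vectorSpan ℝ σ)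

/-- The `n`-dimensional polysimplices of `Σ`. -/
def Cell (P : RootPairing ι ℝ E N) (n : ℕ) : Type _ :=
  {σ : Set E // σ ∈ polysimplices P ∧ setDim σ = n}

/-- `C_n(Σ)`: the complex vector space with basis the `n`-dimensional polysimplices. -/
abbrev Chain (P : RootPairing ι ℝ E N) (n : ℕ) : Type _ := Cell P n →₀ ℂ

/-- The support of a chain, as a subset of `E`. -/
def chainSupport {P : RootPairing ι ℝ E N} {n : ℕ} (c : Chain P n) : Set E :=
  ⋃ σ ∈ c.support, σ.1

/-! ### The action of the finite Weyl group -/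

lemma exists_affineRoot_smul (P : RootPairing ι ℝ E N) (w : P.Aut) (hw : w ∈ P.weylGroup)
    (i : ι) : ∃ j, ∀ x : E, P.coroot' i (w • x) = P.coroot' j x := by
  revert i
  induction hw using RootPairing.weylGroup.induction with
  | mem k =>
    intro i
    refine ⟨P.reflectionPerm k i, fun x => ?_⟩
    rw [← RootPairing.coroot'_reflection]
    rfl
  | one => exact fun i => ⟨i, fun x => by rw [one_smul]⟩
  | mul u v hu hv ihu ihv =>
    intro i
    obtain ⟨j, hj⟩ := ihu i
    obtain ⟨k, hk⟩ := ihv j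
    exact ⟨k, fun x => by rw [mul_smul, hj, hk]⟩

lemma closedFacet_smul_subset (P : RootPairing ι ℝ E N) (w : P.weylGroup) {x y : E}
    (hy : y ∈ closedFacet P x) : w • y ∈ closedFacet P (w • x) := by
  rintro ⟨i, k⟩ h
  obtain ⟨j, hj⟩ := exists_affineRoot_smul P w.1 w.2 i
  have h' : ∀ z : E, affineRoot P (i, k) (w • z) = affineRoot P (j, k) z := fun z => by
    unfold affineRoot
    rw [← hj z]
    rfl
  rw [h'] at h ⊢
  exact hy _ h

lemma image_closedFacet (P : RootPairing ι ℝ E N) (w : P.weylGroup) (x : E) :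
    (fun y : E => w • y) '' closedFacet P x = closedFacet P (w • x) := by
  ext z
  constructor
  · rintro ⟨y, hy, rfl⟩
    exact closedFacet_smul_subset P w hy
  · intro hz
    refine ⟨w⁻¹ • z, ?_, smul_inv_smul w z⟩
    have := closedFacet_smul_subset P w⁻¹ hz
    rwa [inv_smul_smul] at this

lemma setDim_image (P : RootPairing ι ℝ E N) (w : P.weylGroup) (σ : Set E) :
    setDim ((fun y : E => w • y) '' σ) = setDim σ := by
  let e : E ≃ₗ[ℝ] E := RootPairing.Equiv.weightHom P w.1
  have h : (fun y : E => w • y) '' σ = e.toLinearMap.toAffineMap '' σ := rfl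
  unfold setDim
  rw [h, ← AffineMap.map_vectorSpan]
  exact LinearEquiv.finrank_map_eq e _

/-- The action `σ ↦ w σ` of the finite Weyl group `W_0` on the `n`-dimensional polysimplices. -/
def cellMap (P : RootPairing ι ℝ E N) (w : P.weylGroup) (n : ℕ) (σ : Cell P n) : Cell P n :=
  ⟨(fun y : E => w • y) '' σ.1, by
    obtain ⟨⟨x, hx⟩, hd⟩ := σ.2
    refine ⟨⟨w • x, ?_⟩, ?_⟩
    · rw [← hx, image_closedFacet]
    · rw [setDim_image, hd]⟩

/-- The action of the finite Weyl group `W_0` on `C_n(Σ)`. -/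
def chainMap (P : RootPairing ι ℝ E N) (w : P.weylGroup) (n : ℕ) : Chain P n →ₗ[ℂ] Chain P n :=
  Finsupp.lmapDomain ℂ ℂ (cellMap P w n)

/-! ### The fundamental alcove -/

/-- The coroot `α_i^∨` is maximal for the dominance ordering, in which `α^∨ ≤ β^∨` means that
`β^∨ - α^∨` is a sum of simple coroots. -/
def IsMaximalCoroot {P : RootPairing ι ℝ E N} (b : P.Base) (i : ι) : Prop :=
  ∀ j, P.coroot j - P.coroot i ∈ AddSubmonoid.closure (P.coroot '' b.support) → j = i

/-- The fundamental alcove `A_∅`: the points where all the simple affine roots, i.e. the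
`(α^∨, 0)` with `α^∨` simple and the `(-α^∨, 1)` with `α^∨` maximal, are positive. -/
def alcove {P : RootPairing ι ℝ E N} (b : P.Base) : Set E :=
  {x | (∀ i ∈ b.support, 0 < P.coroot' i x) ∧
    ∀ i, IsMaximalCoroot b i → 0 < -P.coroot' i x + 1}

/-- The closure of the fundamental alcove. -/
def closedAlcove {P : RootPairing ι ℝ E N} (b : P.Base) : Set E :=
  {x | (∀ i ∈ b.support, 0 ≤ P.coroot' i x) ∧
    ∀ i, IsMaximalCoroot b i → 0 ≤ -P.coroot' i x + 1}

/-- `x` and `y` are conjugate under the affine Weyl group `W^aff = ℤR_0 ⋊ W_0`. -/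
def AffineConj (P : RootPairing ι ℝ E N) (x y : E) : Prop :=
  ∃ (w : P.weylGroup) (v : E), v ∈ P.rootSpan ℤ ∧ y = w • x + v

/-- The retraction of `E` onto the closure of `A_∅` (a fundamental domain for `W^aff`): it sends
`x` to the unique point of the closed alcove that is conjugate to `x`. -/
def fold {P : RootPairing ι ℝ E N} (b : P.Base) (x : E) : E :=
  Classical.epsilon fun y => y ∈ closedAlcove b ∧ AffineConj P y x

/-- The `Σ`-approximation `A(K)` of the convex closure of `K ∪ A_∅`. -/
def hull {P : RootPairing ι ℝ E N} (b : P.Base) (K : Set E) : Set E :=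
  {x | ∀ i : ι,
    ((sInf ((fun y => ⌊P.coroot' i y⌋) '' (K ∪ alcove b)) : ℤ) : ℝ) ≤ P.coroot' i x ∧
    P.coroot' i x ≤ ((sSup ((fun y => ⌈P.coroot' i y⌉) '' (K ∪ alcove b)) : ℤ) : ℝ)}

/-! ### The factors of a polysimplex, one for every irreducible component -/

/-- The graph on the roots in which two different roots are joined if they are not orthogonal. -/
def rootGraph (P : RootPairing ι ℝ E N) : SimpleGraph ι :=
  SimpleGraph.fromRel fun i j => P.pairing i j ≠ 0

/-- The irreducible components of the root system. -/
abbrev Component (P : RootPairing ι ℝ E N) : Type _ := (rootGraph P).ConnectedComponent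

/-- The projection of `σ ⊆ E` to the factor `E_c` of `E = ⨁ E_c`, where `E_c` is the span of the
roots in the component `c`. A point `x` of `E_c` is the projection of `y` if and only if
`⟨x, α^∨⟩ = ⟨y, α^∨⟩` for all `α` in `c`. -/
def factor (P : RootPairing ι ℝ E N) (c : Component P) (σ : Set E) : Set E :=
  {x | x ∈ Submodule.span ℝ (P.root '' c.supp) ∧
    ∃ y ∈ σ, ∀ i ∈ c.supp, P.coroot' i x = P.coroot' i y}

/-- The vertices of the factor of `σ` that corresponds to the component `c`. -/
def factorVertices (P : RootPairing ι ℝ E N) (c : Component P) (σ : Set E) : Set E :=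
  (factor P c σ).extremePoints ℝ

/-- The polysimplex obtained from `σ` by replacing its factor for the component `c` by the face
(of that factor) opposite to the vertex `x`. -/
def oppositeFace (P : RootPairing ι ℝ E N) (c : Component P) (σ : Set E) (x : E) : Set E :=
  {y ∈ σ | ∃ z ∈ convexHull ℝ (factorVertices P c σ \ {x}),
    ∀ i ∈ c.supp, P.coroot' i z = P.coroot' i y}

/-- A choice of orientations of the faces of the fundamental alcove: a numbering of the
irreducible components, and, for each of them, of the vertices of the corresponding factor of the
closed alcove. It gives each face `f` a reference orientation, by listing the vertices of its
factors in increasing order; the chosen orientation of `f` is `sign f` times the reference one.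
A vertex of `Σ` is always oriented positively. -/
structure AlcoveOrientation {P : RootPairing ι ℝ E N} (b : P.Base) where
  numComponents : ℕ
  component : Fin numComponents ≃ Component P
  vertexNumber : E → ℕ
  injOn : ∀ j, Set.InjOn vertexNumber (factorVertices P (component j) (closedAlcove b))
  sign : Set E → ℤˣ
  sign_vertex : ∀ x, sign {x} = 1

/-! ### The boundary maps -/

section Boundary

variable {P : RootPairing ι ℝ E N} {b : P.Base} (o : AlcoveOrientation b)

/-- The dimension `d_j` of the `j`-th factor of a polysimplex. -/
def factorDim (σ : Set E) (j : Fin o.numComponents) : ℕ :=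
  (factorVertices P (o.component j) σ).ncard - 1

/-- The position (counted from `0`) of the vertex `x` of the `j`-th factor of `σ`, if the vertices
are ordered by transport of structure from the fundamental alcove. -/
def vertexPosition (σ : Set E) (j : Fin o.numComponents) (x : E) : ℕ :=
  {y ∈ factorVertices P (o.component j) σ |
    o.vertexNumber (fold b y) < o.vertexNumber (fold b x)}.ncard

/-- The chosen orientation of a polysimplex, relative to the reference orientation;
transported from the fundamental alcove by `W^aff`. -/
def cellSign (σ : Set E) : ℤˣ := o.sign (fold b '' σ)

/-- The coefficient in `∂ σ` of the face opposite to the vertex `x` of the `j`-th factor. -/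
def incidence (σ : Set E) (j : Fin o.numComponents) (x : E) : ℤˣ :=
  cellSign o σ * cellSign o (oppositeFace P (o.component j) σ x) *
    (-1) ^ (∑ i ∈ Finset.univ.filter (· < j), factorDim o σ i) * (-1) ^ vertexPosition o σ j x

open Classical in
/-- The boundary of a polysimplex,
`∂ σ = ∑_j (-1)^{d_1 + ⋯ + d_{j-1}} σ^{(1)} × ⋯ × ∂ σ^{(j)} × ⋯ × σ^{(r')}`.
If the `j`-th factor is a point then its opposite face is empty, and it does not contribute. -/
def cellBoundary (n : ℕ) (σ : Cell P (n + 1)) : Chain P n :=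
  ∑ j : Fin o.numComponents, ∑ᶠ x ∈ factorVertices P (o.component j) σ.1,
    if h : oppositeFace P (o.component j) σ.1 x ∈ polysimplices P ∧
        setDim (oppositeFace P (o.component j) σ.1 x) = n
    then Finsupp.single (⟨oppositeFace P (o.component j) σ.1 x, h⟩ : Cell P n)
      (((incidence o σ.1 j x : ℤˣ) : ℤ) : ℂ)
    else 0

/-- The boundary map `∂_{n+1} : C_{n+1}(Σ) → C_n(Σ)`. -/
def boundary (n : ℕ) : Chain P (n + 1) →ₗ[ℂ] Chain P n :=
  Finsupp.linearCombination ℂ (cellBoundary o n)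

/-- The augmentation `∂_0 : C_0(Σ) → C_{-1}(Σ) = ℂ`, which sends every vertex to `1`. -/
def augmentation (P : RootPairing ι ℝ E N) : Chain P 0 →ₗ[ℂ] ℂ :=
  Finsupp.linearCombination ℂ fun _ => (1 : ℂ)

/-- The maps `γ₀ = γ_{-1} : C_{-1}(Σ) → C_0(Σ)` and `γ n : C_n(Σ) → C_{n+1}(Σ)` form a contraction
of the augmented complex: `γ ∂ + ∂ γ = id` in all degrees `≥ -1`. -/
structure IsContraction (γ₀ : ℂ →ₗ[ℂ] Chain P 0)
    (γ : ∀ n : ℕ, Chain P n →ₗ[ℂ] Chain P (n + 1)) : Prop where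
  degree_neg_one : augmentation P ∘ₗ γ₀ = LinearMap.id
  degree_zero : γ₀ ∘ₗ augmentation P + boundary o 0 ∘ₗ γ 0 = LinearMap.id
  degree_succ : ∀ n, γ n ∘ₗ boundary o n + boundary o (n + 1) ∘ₗ γ (n + 1) = LinearMap.id

end Boundary

end AlcoveComplex

end

noncomputable section

namespace AlcoveComplex

open RootPairing

variable {ι E N : Type*} [AddCommGroup E] [Module ℝ E] [AddCommGroup N] [Module ℝ N]

set_option linter.unusedSectionVars false

/-! ### Coroots as functionals and the irreducible components -/

/-! The space `E` is contracted to the origin along rays, in steps of bounded length. Points are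
measured by the sup norm of their coroot values (`corootMap`), and `shrink P k` moves every point by
the distance `k` towards `0`, stopping there. For each `k` there is an augmentation preserving chain
map `g k` carried by the integral hulls of the sets `shrink P k '' σ`, with `g 0 = id`, and a chain
homotopy `h k` from `g k` to `g (k + 1)`. On a given cell all `h k` with `k` large vanish, and `g k`
ends on the origin. So `γ = ∑ₖ h k` makes sense, and `γ∂ + ∂γ = id` follows by telescoping
(`exists_contraction`).

The coefficients are bounded for two reasons. The carriers have bounded size, so each filling solves
one of finitely many linear systems with integer coefficients (`exists_uniform_filling`). Moreover
`h k σ` lies near the sphere of radius `‖x‖ - k`, `x ∈ σ`, so a given cell occurs in at most 21 of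
the summands. Rays to `0` stay in the hull of `σ ∪ {0}`, which lies in `A(σ)` since `0` is in the
closed alcove. Averaging over `W_0`, which fixes `0`, makes `γ` equivariant without spoiling the
rest.

Acyclic carriers require polyhedra bounded by hyperplanes of the arrangement to be acyclic
(`isAcyclic_polyhedron`): cutting along hyperplanes and Mayer–Vietoris reduce this to a single
polysimplex. There, barycentric coordinates (`Chart`) identify faces with sets of vertices meeting
every factor, and `IsStandard.boundary_faceChain` identifies `∂` with the boundary of a simplex
modulo the sets that miss a factor. Orientations match because the closed alcove is a strict
fundamental domain of `W^aff` (`eq_of_affineConj`), so that `fold` labels vertices consistently. -/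

lemma ext_of_coroot' (P : RootPairing ι ℝ E N) [P.IsRootSystem] {x y : E}
    (h : ∀ i, P.coroot' i x = P.coroot' i y) : x = y := by
  rw [← sub_eq_zero, eq_zero_iff_forall_coroot'_eq_zero P]
  intro i
  rw [map_sub, h, sub_self]

lemma coroot_ext (P : RootPairing ι ℝ E N) [P.IsRootSystem] {x y : N}
    (h : ∀ i, P.root' i x = P.root' i y) : x = y :=
  ext_of_coroot' P.flip h

/-- The index of the root opposite to the root with index `i`. -/
def opp (P : RootPairing ι ℝ E N) (i : ι) : ι := P.reflectionPerm i i

lemma root_opp (P : RootPairing ι ℝ E N) (i : ι) : P.root (opp P i) = -P.root i := by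
  simp [opp, root_reflectionPerm]

lemma coroot_opp (P : RootPairing ι ℝ E N) (i : ι) : P.coroot (opp P i) = -P.coroot i := by
  simp [opp, coroot_reflectionPerm]

lemma coroot'_opp (P : RootPairing ι ℝ E N) (i : ι) (x : E) :
    P.coroot' (opp P i) x = -P.coroot' i x := by
  simp [coroot', coroot_opp]

lemma opp_ne (P : RootPairing ι ℝ E N) (i : ι) : opp P i ≠ i := by
  intro h
  have h1 := root_opp P i
  rw [h] at h1
  have h2 := P.pairing_same i
  have h3 := congrArg (P.coroot' i) h1
  rw [map_neg, root_coroot'_eq_pairing, h2] at h3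
  norm_num at h3

/-- The irreducible component of a root. -/
abbrev comp (P : RootPairing ι ℝ E N) (i : ι) : Component P := (rootGraph P).connectedComponentMk i

lemma mem_supp_iff {P : RootPairing ι ℝ E N} {c : Component P} {i : ι} :
    i ∈ c.supp ↔ comp P i = c := Iff.rfl

lemma pairing_ne_zero_symm (P : RootPairing ι ℝ E N) {i j : ι} (h : P.pairing i j ≠ 0) :
    P.pairing j i ≠ 0 := by
  have : Module.IsReflexive ℝ E := .of_isPerfPair P.toLinearMap
  rwa [Ne, pairing_eq_zero_iff] at h

lemma comp_eq_of_pairing_ne_zero (P : RootPairing ι ℝ E N) {i j : ι} (h : P.pairing i j ≠ 0) :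
    comp P i = comp P j := by
  by_cases hij : i = j
  · rw [hij]
  · apply SimpleGraph.ConnectedComponent.sound
    apply SimpleGraph.Adj.reachable
    rw [rootGraph, SimpleGraph.fromRel_adj]
    exact ⟨hij, Or.inl h⟩

lemma pairing_eq_zero_of_comp_ne (P : RootPairing ι ℝ E N) {i j : ι} (h : comp P i ≠ comp P j) :
    P.pairing i j = 0 := by
  by_contra h'
  exact h (comp_eq_of_pairing_ne_zero P h')

/-- Unless `i` is orthogonal to `k`, and hence fixed, both `i` and its reflection pair nontrivially
with `k`. -/
lemma comp_reflectionPerm (P : RootPairing ι ℝ E N) (k i : ι) :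
    comp P (P.reflectionPerm k i) = comp P i := by
  by_cases h : P.pairing i k = 0
  · rw [P.reflectionPerm_eq_of_pairing_eq_zero h]
  · have h1 : P.pairing (P.reflectionPerm k i) k ≠ 0 := by
      rw [← root_coroot'_eq_pairing, root_reflectionPerm, coroot'_reflection,
        root_coroot'_eq_pairing, pairing_reflectionPerm_self_right]
      simpa using h
    rw [comp_eq_of_pairing_ne_zero P h, comp_eq_of_pairing_ne_zero P h1]

lemma comp_opp (P : RootPairing ι ℝ E N) (i : ι) : comp P (opp P i) = comp P i :=
  comp_reflectionPerm P i i

/-- Keeping track of the component allows coordinates to be transported factor by factor. -/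
lemma exists_index_smul (P : RootPairing ι ℝ E N) (w : P.weylGroup) (i : ι) :
    ∃ j, comp P j = comp P i ∧ ∀ x : E, P.coroot' i (w • x) = P.coroot' j x := by
  obtain ⟨w, hw⟩ := w
  revert i
  induction hw using RootPairing.weylGroup.induction with
  | mem k =>
    intro i
    refine ⟨P.reflectionPerm k i, comp_reflectionPerm P k i, fun x => ?_⟩
    rw [← RootPairing.coroot'_reflection]
    rfl
  | one => exact fun i => ⟨i, rfl, fun x => by
      change P.coroot' i ((1 : P.Aut) • x) = _
      rw [one_smul]⟩
  | mul u v hu hv ihu ihv =>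
    intro i
    obtain ⟨j, hc, hj⟩ := ihu i
    obtain ⟨k, hc', hk⟩ := ihv j
    exact ⟨k, hc'.trans hc, fun x => by
      change P.coroot' i ((u * v) • x) = _
      rw [mul_smul]
      exact (hj _).trans (hk _)⟩

lemma pairing_neg_iff [Finite ι] (P : RootPairing ι ℝ E N) [P.IsCrystallographic] (i j : ι) :
    P.pairing i j < 0 ↔ P.pairing j i < 0 := by
  rw [← P.algebraMap_pairingIn ℤ i j, ← P.algebraMap_pairingIn ℤ j i]
  simpa using P.pairingIn_lt_zero_iff ℤ

/-! ### Coefficients of coroots with respect to the simple coroots -/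

section Coef

variable {P : RootPairing ι ℝ E N} (b : P.Base)

/-- The coefficients of a coroot as a combination of simple coroots. -/
def coef (i : ι) : ι → ℤ := (b.flip.exists_root_eq_sum_int i).choose

lemma coef_eq_zero {i j : ι} (hj : j ∉ b.support) : coef b i j = 0 := by
  by_contra h
  exact hj ((b.flip.exists_root_eq_sum_int i).choose_spec.1 h)

lemma coroot_eq_sum (i : ι) : P.coroot i = ∑ j ∈ b.support, coef b i j • P.coroot j :=
  (b.flip.exists_root_eq_sum_int i).choose_spec.2.2

lemma coef_pos_or_neg (i : ι) : 0 < coef b i ∨ coef b i < 0 :=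
  (b.flip.exists_root_eq_sum_int i).choose_spec.2.1

lemma eq_of_sum_coroot_eq {f g : ι → ℤ}
    (h : ∑ j ∈ b.support, f j • P.coroot j = ∑ j ∈ b.support, g j • P.coroot j)
    {j : ι} (hj : j ∈ b.support) : f j = g j := by
  have h1 : ∑ j ∈ b.support, ((f j : ℝ) - g j) • P.coroot j = 0 := by
    simp only [sub_smul, Finset.sum_sub_distrib, Int.cast_smul_eq_zsmul]
    rw [h, sub_self]
  have := linearIndepOn_finset_iff.1 b.linearIndepOn_coroot _ h1 j hj
  exact_mod_cast sub_eq_zero.1 this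

lemma coef_eq_of_coroot_eq {i : ι} {f : ι → ℤ}
    (h : P.coroot i = ∑ j ∈ b.support, f j • P.coroot j) {j : ι} (hj : j ∈ b.support) :
    coef b i j = f j :=
  eq_of_sum_coroot_eq b (by rw [← coroot_eq_sum, h]) hj

lemma coef_add {i j k : ι} (h : P.coroot k = P.coroot i + P.coroot j) (l : ι) :
    coef b k l = coef b i l + coef b j l := by
  by_cases hl : l ∈ b.support
  · refine coef_eq_of_coroot_eq b (f := fun l => coef b i l + coef b j l) ?_ hl
    simp only [add_smul, Finset.sum_add_distrib]
    rw [← coroot_eq_sum, ← coroot_eq_sum, h]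
  · simp [coef_eq_zero b hl]

lemma coef_opp (i l : ι) : coef b (opp P i) l = -coef b i l := by
  by_cases hl : l ∈ b.support
  · refine coef_eq_of_coroot_eq b (f := fun l => -coef b i l) ?_ hl
    simp only [neg_smul, Finset.sum_neg_distrib]
    rw [← coroot_eq_sum, coroot_opp]
  · simp [coef_eq_zero b hl]

open Classical in
lemma coef_simple {i : ι} (hi : i ∈ b.support) (l : ι) : coef b i l = if l = i then 1 else 0 := by
  by_cases hl : l ∈ b.support
  · refine coef_eq_of_coroot_eq b (f := fun l => if l = i then 1 else 0) ?_ hl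
    simp [hi]
  · rw [coef_eq_zero b hl, if_neg]
    rintro rfl
    exact hl hi

/-- A coroot is positive if its coefficients are nonnegative. -/
def IsPositive (i : ι) : Prop := ∀ j, 0 ≤ coef b i j

lemma isPositive_or_opp (i : ι) : IsPositive b i ∨ IsPositive b (opp P i) := by
  rcases coef_pos_or_neg b i with h | h
  · exact Or.inl fun j => h.le j
  · exact Or.inr fun j => by
      rw [coef_opp]
      exact neg_nonneg.2 (h.le j)

lemma exists_coef_ne_zero (i : ι) : ∃ j ∈ b.support, coef b i j ≠ 0 := by
  by_contra! h
  have := coroot_eq_sum b i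
  rw [Finset.sum_eq_zero fun j hj => by rw [h j hj, zero_smul]] at this
  exact P.ne_zero' i this

lemma not_isPositive_opp {i : ι} (h : IsPositive b i) : ¬IsPositive b (opp P i) := by
  intro h'
  obtain ⟨j, -, hj⟩ := exists_coef_ne_zero b i
  have h1 := h j
  have h2 := h' j
  rw [coef_opp] at h2
  omega

lemma isPositive_simple {i : ι} (hi : i ∈ b.support) : IsPositive b i := by
  intro j
  rw [coef_simple b hi]
  split_ifs <;> norm_num

/-- The height is the sum of the coefficients, which all have the same sign, and it is never zero.
-/
lemma isPositive_iff (i : ι) : IsPositive b i ↔ b.flip.IsPos i := by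
  have hh : b.flip.height i = ∑ j ∈ b.support, coef b i j :=
    Base.height_eq_sum (b := b.flip) (coroot_eq_sum b i)
  rw [Base.isPos_iff', hh]
  constructor
  · exact fun h => Finset.sum_nonneg fun j _ => h j
  · intro h
    rcases isPositive_or_opp b i with h1 | h1
    · exact h1
    · have h2 := Base.height_ne_zero b.flip i
      rw [hh] at h2
      have h3 : ∑ j ∈ b.support, coef b i j ≤ 0 := Finset.sum_nonpos fun j _ => by
        have := h1 j
        rw [coef_opp] at this
        omega
      omega

lemma coroot'_eq_sum (i : ι) (x : E) :
    P.coroot' i x = ∑ j ∈ b.support, (coef b i j : ℝ) * P.coroot' j x := by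
  have h := congrArg (fun n => P.toLinearMap x n) (coroot_eq_sum b i)
  simp only [map_sum, map_zsmul, zsmul_eq_mul] at h
  exact h

lemma pairing_eq_sum (k i : ι) :
    P.pairing k i = ∑ j ∈ b.support, (coef b i j : ℝ) * P.pairing k j := by
  simpa using coroot'_eq_sum b i (P.root k)

/-- Dropping from the expansion of a coroot the simple coroots of other components does not change
its pairing with any root, hence not the coroot. Linear independence then kills the dropped
coefficients. -/
lemma comp_eq_of_coef_ne_zero [P.IsRootSystem] {i j : ι} (h : coef b i j ≠ 0) :
    comp P j = comp P i := by
  classical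
  by_contra hne
  have hj : j ∈ b.support := by
    by_contra hj
    exact h (coef_eq_zero b hj)
  have key : P.coroot i = ∑ j ∈ b.support,
      (if comp P j = comp P i then coef b i j else 0) • P.coroot j := by
    apply coroot_ext P
    intro k
    have e : ∀ f : ι → ℤ, P.root' k (∑ j ∈ b.support, f j • P.coroot j) =
        ∑ j ∈ b.support, (f j : ℝ) * P.pairing k j := by
      intro f
      simp only [map_sum, map_zsmul, zsmul_eq_mul, root'_coroot_eq_pairing]
    rw [e, root'_coroot_eq_pairing]
    by_cases hk : comp P k = comp P i
    · rw [pairing_eq_sum b k i]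
      refine Finset.sum_congr rfl fun l _ => ?_
      split_ifs with hl
      · rfl
      · rw [pairing_eq_zero_of_comp_ne P (i := k) (j := l) (by rw [hk]; exact Ne.symm hl)]
        simp
    · rw [pairing_eq_zero_of_comp_ne P hk]
      symm
      refine Finset.sum_eq_zero fun l _ => ?_
      split_ifs with hl
      · rw [pairing_eq_zero_of_comp_ne P (i := k) (j := l) (by rw [hl]; exact hk), mul_zero]
      · simp
  have := coef_eq_of_coroot_eq b key hj
  rw [if_neg hne] at this
  exact h this

lemma mem_closure_coroot_iff (z : N) : z ∈ AddSubmonoid.closure (P.coroot '' b.support) ↔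
    ∃ f : ι → ℕ, z = ∑ j ∈ b.support, f j • P.coroot j := by
  classical
  constructor
  · intro hz
    refine AddSubmonoid.closure_induction ?_ ⟨0, by simp⟩ ?_ hz
    · rintro - ⟨j, hj, rfl⟩
      exact ⟨Pi.single j 1, by simp [Pi.single_apply, Finset.mem_coe.1 hj]⟩
    · intro _ _ _ _ ⟨f, hf⟩ ⟨g, hg⟩
      exact ⟨f + g, by simp [hf, hg, add_smul, Finset.sum_add_distrib]⟩
  · rintro ⟨f, rfl⟩
    exact sum_mem fun j hj => nsmul_mem (AddSubmonoid.subset_closure (Set.mem_image_of_mem _ hj)) _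

/-- Turns the dominance ordering into a pointwise comparison of coefficients. -/
lemma sub_mem_closure_iff (i j : ι) :
    P.coroot j - P.coroot i ∈ AddSubmonoid.closure (P.coroot '' b.support) ↔
      coef b i ≤ coef b j := by
  rw [mem_closure_coroot_iff]
  constructor
  · rintro ⟨f, hf⟩
    refine Pi.le_def.2 fun l => ?_
    by_cases hl : l ∈ b.support
    · have : coef b j l = coef b i l + f l := by
        refine coef_eq_of_coroot_eq b (f := fun l => coef b i l + f l) ?_ hl
        simp only [add_smul, Finset.sum_add_distrib, natCast_zsmul]
        rw [← coroot_eq_sum, ← hf]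
        abel
      omega
    · simp [coef_eq_zero b hl]
  · intro h
    refine ⟨fun l => (coef b j l - coef b i l).toNat, ?_⟩
    conv_lhs => rw [coroot_eq_sum b i, coroot_eq_sum b j]
    rw [← Finset.sum_sub_distrib]
    refine Finset.sum_congr rfl fun l _ => ?_
    rw [← sub_smul, ← natCast_zsmul, Int.toNat_of_nonneg (sub_nonneg.2 (h l))]

lemma isMaximalCoroot_iff (i : ι) :
    IsMaximalCoroot b i ↔ ∀ j, coef b i ≤ coef b j → j = i := by
  simp only [IsMaximalCoroot, sub_mem_closure_iff]

lemma eq_of_coef_eq {i j : ι} (h : coef b i = coef b j) : i = j := by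
  apply P.coroot.injective
  rw [coroot_eq_sum b i, coroot_eq_sum b j, h]

lemma exists_maximal_ge [Finite ι] (i : ι) : ∃ j, IsMaximalCoroot b j ∧ coef b i ≤ coef b j := by
  obtain ⟨j, hj, hmax⟩ := Set.exists_max_image {j | coef b i ≤ coef b j}
    (fun j => ∑ l ∈ b.support, coef b j l) (Set.toFinite {j | coef b i ≤ coef b j})
    (Set.nonempty_of_mem (x := i) (le_refl (coef b i)))
  refine ⟨j, (isMaximalCoroot_iff b j).2 ?_, hj⟩
  intro k hk
  have h1 := hmax k (le_trans hj hk)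
  have h2 : ∀ l ∈ b.support, coef b j l = coef b k l :=
    (Finset.sum_eq_sum_iff_of_le fun l _ => hk l).1
      (le_antisymm (Finset.sum_le_sum fun l _ => hk l) h1)
  apply (eq_of_coef_eq b _).symm
  funext l
  by_cases hl : l ∈ b.support
  · exact h2 l hl
  · simp [coef_eq_zero b hl]

variable [Finite ι] [P.IsCrystallographic]

lemma IsMaximalCoroot.isPositive {b : P.Base} {i : ι} (h : IsMaximalCoroot b i) :
    IsPositive b i := by
  rcases isPositive_or_opp b i with h1 | h1
  · exact h1
  · refine absurd ((isMaximalCoroot_iff b i).1 h (opp P i) (Pi.le_def.2 fun l => ?_)) (opp_ne P i)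
    have := h1 l
    rw [coef_opp] at this ⊢
    omega

lemma exists_coroot_add {i j : ι} (h : P.pairing j i < 0) (h' : i ≠ opp P j) :
    ∃ k, P.coroot k = P.coroot i + P.coroot j := by
  apply P.flip.root_add_root_mem_of_pairingIn_neg
  · have : (P.flip.pairingIn ℤ i j : ℝ) < 0 := by
      have e := P.flip.algebraMap_pairingIn ℤ i j
      rw [pairing_flip] at e
      simp only [algebraMap_int_eq, eq_intCast] at e
      rwa [e]
    exact_mod_cast this
  · intro e
    apply h'
    apply P.coroot.injective
    rw [coroot_opp]
    exact e

/-- If the pairing were negative, the sum of the maximal coroot and the simple one would be a larger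
coroot. -/
lemma IsMaximalCoroot.pairing_nonneg {b : P.Base} {i : ι} (h : IsMaximalCoroot b i) {j : ι}
    (hj : j ∈ b.support) : 0 ≤ P.pairing j i := by
  by_contra! hneg
  have hne : i ≠ opp P j := by
    rintro rfl
    exact not_isPositive_opp b (isPositive_simple b hj) h.isPositive
  obtain ⟨k, hk⟩ := exists_coroot_add hneg hne
  have h1 := coef_add b hk
  have h2 := (isMaximalCoroot_iff b i).1 h k (Pi.le_def.2 fun l => by
    rw [h1 l]
    have := isPositive_simple b hj l
    omega)
  subst h2
  have := h1 j
  rw [coef_simple b hj j, if_pos rfl] at this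
  omega

end Coef

/-! ### The highest coroot of a component -/

section Highest

variable {P : RootPairing ι ℝ E N} {b : P.Base} [Finite ι] [P.IsCrystallographic]
  [P.IsRootSystem] [P.IsReduced]

lemma pairing_simple_nonpos {i j : ι} (hi : i ∈ b.support) (hj : j ∈ b.support) (hij : i ≠ j) :
    P.pairing i j ≤ 0 := by
  have := b.pairingIn_le_zero_of_ne (i := i) (j := j) hij hi hj
  rw [← P.algebraMap_pairingIn ℤ, algebraMap_int_eq, eq_intCast]
  exact_mod_cast this

/-- For `j` outside the support of the maximal coroot, the pairing with it is a sum of nonpositive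
terms. As it is also nonnegative, every term vanishes: the support is orthogonal to the remaining
simple roots. -/
lemma IsMaximalCoroot.pairing_eq_zero {i : ι} (h : IsMaximalCoroot b i) {j l : ι}
    (hj : j ∈ b.support) (hl : l ∈ b.support) (hji : coef b i j = 0) (hli : coef b i l ≠ 0) :
    P.pairing j l = 0 := by
  have h1 := h.pairing_nonneg hj
  rw [pairing_eq_sum b] at h1
  have h2 : ∀ m ∈ b.support, (coef b i m : ℝ) * P.pairing j m ≤ 0 := by
    intro m hm
    by_cases hmj : j = m
    · subst hmj
      simp [hji]
    · exact mul_nonpos_of_nonneg_of_nonpos (by exact_mod_cast h.isPositive m)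
        (pairing_simple_nonpos hj hm hmj)
  have h3 := (Finset.sum_eq_zero_iff_of_nonpos h2).1 (le_antisymm (Finset.sum_nonpos h2) h1) l hl
  rcases mul_eq_zero.1 h3 with h4 | h4
  · exact absurd (by exact_mod_cast h4) hli
  · exact h4

lemma coef_reflectionPerm (j i l : ι) (hj : j ∈ b.support) (hl : l ≠ j) :
    coef b (P.reflectionPerm j i) l = coef b i l := by
  classical
  by_cases hs : l ∈ b.support
  · have := coef_eq_of_coroot_eq b (i := P.reflectionPerm j i)
      (f := fun l => coef b i l - if l = j then P.pairingIn ℤ j i else 0) ?_ hs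
    · simpa [hl] using this
    · rw [coroot_reflectionPerm, coreflection_apply]
      simp only [sub_smul, Finset.sum_sub_distrib, ite_smul, zero_smul, Finset.sum_ite_eq',
        hj, if_true]
      rw [← coroot_eq_sum, root'_coroot_eq_pairing, ← P.algebraMap_pairingIn ℤ]
      simp [Int.cast_smul_eq_zsmul]
  · simp [coef_eq_zero b hs]

lemma reflectionPerm_eq_of_coef (j i : ι)
    (h : ∀ l ∈ b.support, coef b i l ≠ 0 → P.pairing j l = 0) :
    P.reflectionPerm j i = i := by
  apply P.reflectionPerm_eq_of_pairing_eq_zero'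
  rw [pairing_eq_sum b j i]
  refine Finset.sum_eq_zero fun l hl => ?_
  by_cases h0 : coef b i l = 0
  · rw [h0, Int.cast_zero, zero_mul]
  · rw [h l hl h0, mul_zero]

/-- The support of `t` is orthogonal to its complement, so simple reflections cannot move a coroot
from one to the other. -/
lemma IsMaximalCoroot.coef_dichotomy {t : ι} (h : IsMaximalCoroot b t) (i : ι) :
    (∀ l ∈ b.support, coef b i l ≠ 0 → coef b t l ≠ 0) ∨
      (∀ l ∈ b.support, coef b i l ≠ 0 → coef b t l = 0) := by
  refine b.flip.induction_reflect i (p := fun i =>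
    (∀ l ∈ b.support, coef b i l ≠ 0 → coef b t l ≠ 0) ∨
      (∀ l ∈ b.support, coef b i l ≠ 0 → coef b t l = 0)) ?_ ?_ ?_
  · intro i hi
    change (∀ l ∈ b.support, coef b (opp P i) l ≠ 0 → _) ∨
      (∀ l ∈ b.support, coef b (opp P i) l ≠ 0 → _)
    simpa only [coef_opp, neg_ne_zero] using hi
  · intro i hi
    have : ∀ l, coef b i l ≠ 0 → l = i := by
      intro l hl
      by_contra hne
      rw [coef_simple b hi, if_neg hne] at hl
      exact hl rfl
    by_cases h0 : coef b t i = 0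
    · exact Or.inr fun l _ hl => by rw [this l hl, h0]
    · exact Or.inl fun l _ hl => by rw [this l hl]; exact h0
  · intro i j hi hj
    change j ∈ b.support at hj
    change (∀ l ∈ b.support, coef b (P.reflectionPerm j i) l ≠ 0 → _) ∨
      (∀ l ∈ b.support, coef b (P.reflectionPerm j i) l ≠ 0 → _)
    by_cases hj0 : coef b t j = 0
    · rcases hi with hi | hi
      · rw [reflectionPerm_eq_of_coef (b := b) j i fun l hl h0 =>
          h.pairing_eq_zero hj hl hj0 (hi l hl h0)]
        exact Or.inl hi
      · refine Or.inr fun l hl h0 => ?_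
        by_cases hlj : l = j
        · rw [hlj, hj0]
        · rw [coef_reflectionPerm j i l hj hlj] at h0
          exact hi l hl h0
    · rcases hi with hi | hi
      · refine Or.inl fun l hl h0 => ?_
        by_cases hlj : l = j
        · rw [hlj]; exact hj0
        · rw [coef_reflectionPerm j i l hj hlj] at h0
          exact hi l hl h0
      · rw [reflectionPerm_eq_of_coef (b := b) j i fun l hl h0 => by
          by_contra h1
          exact pairing_ne_zero_symm P h1 (h.pairing_eq_zero hl hj (hi l hl h0) hj0)]
        exact Or.inr hi

/-- A path in `rootGraph` cannot leave the coroots supported in the support of `t`: by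
`coef_dichotomy` the next coroot would be supported off it, hence orthogonal to the previous one. -/
lemma IsMaximalCoroot.coef_ne_zero_of_reachable {t : ι} (h : IsMaximalCoroot b t) {i : ι}
    (hi : comp P i = comp P t) : ∀ l ∈ b.support, coef b i l ≠ 0 → coef b t l ≠ 0 := by
  have hr : (rootGraph P).Reachable t i := SimpleGraph.ConnectedComponent.exact hi.symm
  obtain ⟨p⟩ := hr
  suffices ∀ {u v : ι} (p : (rootGraph P).Walk u v),
      (∀ l ∈ b.support, coef b u l ≠ 0 → coef b t l ≠ 0) →
      (∀ l ∈ b.support, coef b v l ≠ 0 → coef b t l ≠ 0) from this p fun l _ hl => hl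
  intro u v p
  induction p with
  | nil => exact id
  | @cons u v w hadj p ih =>
    intro hu
    apply ih
    rcases h.coef_dichotomy v with hv | hv
    · exact hv
    · exfalso
      rw [rootGraph, SimpleGraph.fromRel_adj] at hadj
      have hne : P.pairing v u ≠ 0 := by
        rcases hadj.2 with h1 | h1
        · exact pairing_ne_zero_symm P h1
        · exact h1
      apply hne
      rw [pairing_eq_sum b]
      refine Finset.sum_eq_zero fun l hl => ?_
      by_cases h0 : coef b u l = 0
      · simp [h0]
      · have : P.pairing l v = 0 := by
          rw [pairing_eq_sum b]
          refine Finset.sum_eq_zero fun m hm => ?_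
          by_cases h0' : coef b v m = 0
          · simp [h0']
          · have h2 := h.pairing_eq_zero hm hl (hv m hm h0') (hu l hl h0)
            by_cases h3 : P.pairing l m = 0
            · simp [h3]
            · exact absurd h2 (pairing_ne_zero_symm P h3)
        by_cases h3 : P.pairing v l = 0
        · simp [h3]
        · exact absurd this (pairing_ne_zero_symm P h3)

lemma IsMaximalCoroot.coef_pos {t : ι} (h : IsMaximalCoroot b t) {j : ι} (hj : j ∈ b.support)
    (hc : comp P j = comp P t) : 0 < coef b t j := by
  refine lt_of_le_of_ne (h.isPositive j) (Ne.symm ?_)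
  apply h.coef_ne_zero_of_reachable hc j hj
  rw [coef_simple b hj, if_pos rfl]
  exact one_ne_zero

/-- The coroot `u` has full support in the component and `t` is dominant and not orthogonal to every
simple root, so the two pair positively. If they differed, their difference would be a coroot,
positive or negative, contradicting the maximality of one of them. -/
lemma IsMaximalCoroot.eq_of_comp_eq {t u : ι} (ht : IsMaximalCoroot b t)
    (hu : IsMaximalCoroot b u) (hc : comp P t = comp P u) : t = u := by
  have h1 : ∀ j ∈ b.support, 0 ≤ P.pairing t j := by
    intro j hj
    by_contra! h
    exact absurd ((pairing_neg_iff P _ _).1 h) (not_lt.2 (ht.pairing_nonneg hj))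
  have h2 : 0 < P.pairing t u := by
    rw [pairing_eq_sum b]
    obtain ⟨j, hj, hj0⟩ := b.exists_mem_support_pos_pairingIn_ne_zero t
    have hj1 : P.pairing j t ≠ 0 := by
      rw [← P.algebraMap_pairingIn ℤ]
      simpa using hj0
    have hj2 := pairing_ne_zero_symm P hj1
    refine Finset.sum_pos' (fun l hl => mul_nonneg (by exact_mod_cast hu.isPositive l) (h1 l hl))
      ⟨j, hj, mul_pos ?_ (lt_of_le_of_ne (h1 j hj) (Ne.symm hj2))⟩
    exact_mod_cast hu.coef_pos hj ((comp_eq_of_pairing_ne_zero P hj1).trans hc)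
  by_contra hne
  obtain ⟨k, hk⟩ : ∃ k, P.coroot k = P.coroot t + P.coroot (opp P u) := by
    apply exists_coroot_add
    · rw [(pairing_neg_iff P _ _), ← root_coroot'_eq_pairing, coroot'_opp,
        root_coroot'_eq_pairing]
      simpa using h2
    · intro h
      apply hne
      apply P.coroot.injective
      rw [h, coroot_opp, coroot_opp, neg_neg]
  have hk' := coef_add b hk
  rcases isPositive_or_opp b k with hp | hp
  · refine hne ((isMaximalCoroot_iff b u).1 hu t (Pi.le_def.2 fun l => ?_))
    have h3 := hp l
    rw [hk' l, coef_opp] at h3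
    omega
  · refine hne ((isMaximalCoroot_iff b t).1 ht u (Pi.le_def.2 fun l => ?_)).symm
    have h3 := hp l
    rw [coef_opp, hk' l, coef_opp] at h3
    omega

lemma comp_eq_of_coef_le {i t : ι} (hi : IsPositive b i) (h : coef b i ≤ coef b t) :
    comp P t = comp P i := by
  obtain ⟨l, -, hl⟩ := exists_coef_ne_zero b i
  have h1 := hi l
  have h2 := Pi.le_def.1 h l
  rw [← comp_eq_of_coef_ne_zero b hl, ← comp_eq_of_coef_ne_zero b (i := t) (j := l) (by omega)]

variable (b) in
lemma exists_highest (c : Component P) : ∃ t, comp P t = c ∧ IsMaximalCoroot b t := by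
  induction c using SimpleGraph.ConnectedComponent.ind with
  | h i =>
    obtain ⟨j, hj, hp⟩ : ∃ j, comp P j = comp P i ∧ IsPositive b j := by
      rcases isPositive_or_opp b i with h | h
      · exact ⟨i, rfl, h⟩
      · exact ⟨_, comp_opp P i, h⟩
    obtain ⟨t, ht, hle⟩ := exists_maximal_ge b j
    exact ⟨t, (comp_eq_of_coef_le hp hle).trans hj, ht⟩

variable (b) in
/-- The highest coroot of a component. -/
def highest (c : Component P) : ι := (exists_highest b c).choose

lemma comp_highest (c : Component P) : comp P (highest b c) = c :=
  (exists_highest b c).choose_spec.1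

lemma isMaximalCoroot_highest (c : Component P) : IsMaximalCoroot b (highest b c) :=
  (exists_highest b c).choose_spec.2

lemma IsMaximalCoroot.eq_highest {t : ι} (ht : IsMaximalCoroot b t) : t = highest b (comp P t) :=
  ht.eq_of_comp_eq (isMaximalCoroot_highest _) (comp_highest _).symm

lemma IsPositive.coef_le_highest {i : ι} (h : IsPositive b i) :
    coef b i ≤ coef b (highest b (comp P i)) := by
  obtain ⟨t, ht, hle⟩ := exists_maximal_ge b i
  have := ht.eq_highest
  rw [comp_eq_of_coef_le h hle] at this
  rwa [← this]

end Highest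

/-! ### Points with prescribed coordinates -/

lemma exists_coroot'_eq {P : RootPairing ι ℝ E N} [P.IsRootSystem] (b : P.Base) (t : ι → ℝ) :
    ∃ x : E, ∀ j ∈ b.support, P.coroot' j x = t j := by
  let f : N →ₗ[ℝ] ℝ := b.toCoweightBasis.constr ℝ fun j => t j
  refine ⟨P.toPerfPair.symm f, fun j hj => ?_⟩
  have h1 : P.toLinearMap (P.toPerfPair.symm f) = f := P.toPerfPair.apply_symm_apply f
  have h2 : f (P.coroot j) = t j := by
    have := b.toCoweightBasis.constr_basis ℝ (fun j => t j) ⟨j, hj⟩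
    rwa [Base.toCoweightBasis_apply] at this
  rw [← h2]
  exact LinearMap.congr_fun h1 (P.coroot j)

section Proj

variable (P : RootPairing ι ℝ E N)

lemma coroot'_eq_zero_of_mem_span {c : Component P} {x : E}
    (hx : x ∈ Submodule.span ℝ (P.root '' c.supp)) {i : ι} (hi : comp P i ≠ c) :
    P.coroot' i x = 0 := by
  induction hx using Submodule.span_induction with
  | mem x hx =>
    obtain ⟨j, hj, rfl⟩ := hx
    rw [root_coroot'_eq_pairing]
    apply pairing_eq_zero_of_comp_ne
    rw [mem_supp_iff.1 hj]
    exact Ne.symm hi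
  | zero => simp
  | add x y _ _ hx hy => rw [map_add, hx, hy, add_zero]
  | smul t x _ hx => rw [map_smul, hx, smul_zero]

open Classical in
-- Splits a translation of `W^aff` into its components, each again in the root lattice.
lemma exists_component_proj_int (c : Component P) {v : E} (hv : v ∈ P.rootSpan ℤ) :
    ∃ y ∈ P.rootSpan ℤ, y ∈ Submodule.span ℝ (P.root '' c.supp) ∧
      ∀ i, P.coroot' i y = if comp P i = c then P.coroot' i v else 0 := by
  induction hv using Submodule.span_induction with
  | mem x hx =>
    obtain ⟨j, rfl⟩ := hx
    by_cases hj : comp P j = c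
    · refine ⟨P.root j, Submodule.subset_span ⟨j, rfl⟩, Submodule.subset_span ⟨j, hj, rfl⟩,
        fun i => ?_⟩
      split_ifs with hi
      · rfl
      · rw [root_coroot'_eq_pairing]
        apply pairing_eq_zero_of_comp_ne
        rw [hj]
        exact Ne.symm hi
    · refine ⟨0, zero_mem _, zero_mem _, fun i => ?_⟩
      split_ifs with hi
      · rw [root_coroot'_eq_pairing, pairing_eq_zero_of_comp_ne P (by rwa [hi]), map_zero]
      · rw [map_zero]
  | zero => exact ⟨0, zero_mem _, zero_mem _, fun i => by simp⟩
  | add x y _ _ hx hy =>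
    obtain ⟨x', h1, h2, h3⟩ := hx
    obtain ⟨y', h4, h5, h6⟩ := hy
    refine ⟨x' + y', add_mem h1 h4, add_mem h2 h5, fun i => ?_⟩
    rw [map_add, map_add, h3, h6]
    split_ifs <;> simp
  | smul t x _ hx =>
    obtain ⟨x', h1, h2, h3⟩ := hx
    refine ⟨t • x', Submodule.smul_mem _ _ h1, zsmul_mem h2 _, fun i => ?_⟩
    rw [map_zsmul, map_zsmul, h3]
    split_ifs <;> simp

variable [P.IsRootSystem]

open Classical in
lemma exists_component_proj (c : Component P) (v : E) :
    ∃ y ∈ Submodule.span ℝ (P.root '' c.supp),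
      ∀ i, P.coroot' i y = if comp P i = c then P.coroot' i v else 0 := by
  have hv : v ∈ Submodule.span ℝ (P.rootSpan ℤ : Set E) := by
    have : Submodule.span ℝ (Set.range P.root) ≤ Submodule.span ℝ (P.rootSpan ℤ : Set E) :=
      Submodule.span_mono Submodule.subset_span
    apply this
    rw [IsRootSystem.span_root_eq_top]
    trivial
  induction hv using Submodule.span_induction with
  | mem x hx =>
    obtain ⟨y, -, h⟩ := exists_component_proj_int P c hx
    exact ⟨y, h⟩
  | zero => exact ⟨0, zero_mem _, fun i => by simp⟩
  | add x y _ _ hx hy =>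
    obtain ⟨x', h2, h3⟩ := hx
    obtain ⟨y', h5, h6⟩ := hy
    refine ⟨x' + y', add_mem h2 h5, fun i => ?_⟩
    rw [map_add, map_add, h3, h6]
    split_ifs <;> simp
  | smul t x _ hx =>
    obtain ⟨x', h2, h3⟩ := hx
    refine ⟨t • x', Submodule.smul_mem _ _ h2, fun i => ?_⟩
    rw [map_smul, map_smul, h3]
    split_ifs <;> simp

lemma mem_span_component_iff {c : Component P} {x : E} :
    x ∈ Submodule.span ℝ (P.root '' c.supp) ↔ ∀ i, comp P i ≠ c → P.coroot' i x = 0 := by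
  refine ⟨fun hx i hi => coroot'_eq_zero_of_mem_span P hx hi, fun h => ?_⟩
  obtain ⟨y, hy, h'⟩ := exists_component_proj P c x
  have : x = y := ext_of_coroot' P fun i => by
    rw [h']
    split_ifs with hi
    · rfl
    · exact h i hi
  rwa [this]

end Proj

/-! ### Points of the fundamental alcove -/

section BasePoint

variable {P : RootPairing ι ℝ E N} [Finite ι] [P.IsCrystallographic] [P.IsRootSystem]
  [P.IsReduced] (b : P.Base)

lemma exists_mem_alcove : ∃ p : E, ∀ i, IsPositive b i → 0 < P.coroot' i p ∧ P.coroot' i p < 1 := by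
  have := Fintype.ofFinite ι
  obtain ⟨x, hx⟩ := exists_coroot'_eq b fun _ => 1
  have hpos : ∀ i, IsPositive b i → 0 < P.coroot' i x := by
    intro i hi
    rw [coroot'_eq_sum b]
    obtain ⟨j, hj, hj0⟩ := exists_coef_ne_zero b i
    refine Finset.sum_pos' (fun l hl => ?_) ⟨j, hj, ?_⟩
    · rw [hx l hl, mul_one]
      exact_mod_cast hi l
    · rw [hx j hj, mul_one]
      exact_mod_cast lt_of_le_of_ne (hi j) (Ne.symm hj0)
  -- `x` has value `1` on all simple coroots. Dividing by a number that exceeds every coroot value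
  -- at `x` moves it into the alcove.
  set S : ℝ := 1 + ∑ i, |P.coroot' i x| with hS
  have hS0 : 0 < S := by positivity
  refine ⟨S⁻¹ • x, fun i hi => ?_⟩
  rw [map_smul, smul_eq_mul]
  refine ⟨mul_pos (inv_pos.2 hS0) (hpos i hi), ?_⟩
  rw [inv_mul_lt_one₀ hS0, hS]
  have h1 : |P.coroot' i x| ≤ ∑ i, |P.coroot' i x| :=
    Finset.single_le_sum (f := fun i => |P.coroot' i x|) (fun _ _ => abs_nonneg _)
      (Finset.mem_univ i)
  have h2 := le_abs_self (P.coroot' i x)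
  linarith

variable {b}

/-- A positive coroot is dominated by the highest coroot of its component, so the walls of the
alcove control all coroots. -/
lemma coroot'_mem_Icc_of_mem_closedAlcove {x : E} (hx : x ∈ closedAlcove b) {i : ι}
    (hi : IsPositive b i) : 0 ≤ P.coroot' i x ∧ P.coroot' i x ≤ 1 := by
  constructor
  · rw [coroot'_eq_sum b]
    exact Finset.sum_nonneg fun j hj => mul_nonneg (by exact_mod_cast hi j) (hx.1 j hj)
  · have h1 := hx.2 _ (isMaximalCoroot_highest (b := b) (comp P i))
    have h2 : P.coroot' i x ≤ P.coroot' (highest b (comp P i)) x := by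
      rw [coroot'_eq_sum b i, coroot'_eq_sum b (highest b (comp P i))]
      refine Finset.sum_le_sum fun j hj => mul_le_mul_of_nonneg_right ?_ (hx.1 j hj)
      exact_mod_cast hi.coef_le_highest j
    linarith

variable {p : E} (hp : ∀ i, IsPositive b i → 0 < P.coroot' i p ∧ P.coroot' i p < 1)

include hp

lemma mem_alcove_of_pos : p ∈ alcove b :=
  ⟨fun i hi => (hp i (isPositive_simple b hi)).1, fun i hi => by
    linarith [(hp i hi.isPositive).2]⟩

lemma abs_coroot'_lt_one (i : ι) : |P.coroot' i p| < 1 := by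
  rcases isPositive_or_opp b i with h | h
  · rw [abs_lt]
    constructor <;> linarith [(hp i h).1, (hp i h).2]
  · have := hp _ h
    rw [coroot'_opp] at this
    rw [abs_lt]
    constructor <;> linarith [this.1, this.2]

lemma affineRoot_ne_zero (a : ι × ℤ) : affineRoot P a p ≠ 0 := by
  obtain ⟨i, k⟩ := a
  unfold affineRoot
  intro h
  dsimp only at h
  have h1 : |P.coroot' i p| = |(k : ℝ)| := by
    rw [eq_neg_of_add_eq_zero_left h, abs_neg]
  have h2 := abs_coroot'_lt_one hp i
  rw [h1] at h2
  have h3 : k = 0 := by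
    have : |k| < 1 := by exact_mod_cast h2
    exact Int.abs_lt_one_iff.1 this
  rw [h3, Int.cast_zero, add_zero] at h
  rcases isPositive_or_opp b i with h4 | h4
  · linarith [(hp i h4).1]
  · have := (hp _ h4).1
    rw [coroot'_opp] at this
    linarith

lemma closedFacet_eq_closedAlcove : closedFacet P p = closedAlcove b := by
  ext y
  constructor
  · intro hy
    refine ⟨fun i hi => ?_, fun i hi => ?_⟩
    · have := hy (i, 0)
      simp only [affineRoot, Int.cast_zero, add_zero] at this
      exact this (hp i (isPositive_simple b hi)).1.le
    · have := hy (opp P i, 1)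
      simp only [affineRoot, Int.cast_one, coroot'_opp] at this
      exact this (by linarith [(hp i hi.isPositive).2])
  -- All positive coroots lie in `(0, 1)` at `p`, so the condition at `p` leaves only `0 ≤ k` for a
  -- positive coroot and `1 ≤ k` for a negative one.
  · rintro hy ⟨i, k⟩ h
    simp only [affineRoot] at h ⊢
    rcases isPositive_or_opp b i with h1 | h1
    · have h2 : 0 ≤ k := by
        have h3 : (-1 : ℝ) < k := by linarith [(hp i h1).2]
        have : (-1 : ℤ) < k := by exact_mod_cast h3
        omega
      have h2' : (0 : ℝ) ≤ k := by exact_mod_cast h2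
      linarith [(coroot'_mem_Icc_of_mem_closedAlcove hy h1).1]
    · have h4 := hp _ h1
      have h5 := (coroot'_mem_Icc_of_mem_closedAlcove hy h1)
      rw [coroot'_opp] at h4 h5
      have h2 : 1 ≤ k := by
        have h3 : (0 : ℝ) < k := by linarith
        have : (0 : ℤ) < k := by exact_mod_cast h3
        omega
      have h2' : (1 : ℝ) ≤ k := by exact_mod_cast h2
      linarith

end BasePoint

/-! ### The affine Weyl group -/

section Affine

variable (P : RootPairing ι ℝ E N)

instance finite_weylGroup [Finite ι] [P.IsRootSystem] : Finite P.weylGroup := by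
  refine Finite.of_injective (fun w : P.weylGroup => P.weylGroupToPerm w) fun u v h => ?_
  apply Subtype.ext
  apply Equiv.weightHom_injective P
  apply LinearEquiv.toLinearMap_injective
  apply LinearMap.ext_on_range (v := P.root) IsRootSystem.span_root_eq_top
  intro i
  have h1 := P.weylGroup_apply_root u i
  have h2 := P.weylGroup_apply_root v i
  have h3 : P.weylGroupToPerm u = P.weylGroupToPerm v := h
  rw [h3, ← h2] at h1
  exact h1

lemma smul_mem_rootSpan (w : P.weylGroup) {v : E} (hv : v ∈ P.rootSpan ℤ) :
    w • v ∈ P.rootSpan ℤ := by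
  induction hv using Submodule.span_induction with
  | mem x hx =>
    obtain ⟨i, rfl⟩ := hx
    rw [weylGroup_apply_root]
    exact Submodule.subset_span ⟨_, rfl⟩
  | zero => rw [smul_zero]; exact zero_mem _
  | add x y _ _ hx hy => rw [smul_add]; exact add_mem hx hy
  | smul t x _ hx =>
    have : w • (t • x) = t • (w • x) := map_zsmul (DistribSMul.toAddMonoidHom E w) t x
    rw [this]
    exact Submodule.smul_mem _ _ hx

lemma affineRoot_neg_index (a : ι × ℤ) (x : E) :
    affineRoot P (opp P a.1, -a.2) x = -affineRoot P a x := by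
  simp only [affineRoot, coroot'_opp, Int.cast_neg]
  ring

lemma exists_int_coroot' [P.IsCrystallographic] (i : ι) {v : E} (hv : v ∈ P.rootSpan ℤ) :
    ∃ m : ℤ, P.coroot' i v = m := by
  obtain ⟨m, hm⟩ := P.coroot'_apply_apply_mem_of_mem_span ℤ hv i
  exact ⟨m, by simpa using hm.symm⟩

lemma exists_affineRoot_comp [P.IsCrystallographic] (w : P.weylGroup) {v : E}
    (hv : v ∈ P.rootSpan ℤ) (a : ι × ℤ) :
    ∃ a' : ι × ℤ, comp P a'.1 = comp P a.1 ∧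
      ∀ x, affineRoot P a (w • x + v) = affineRoot P a' x := by
  obtain ⟨j, hc, hj⟩ := exists_index_smul P w a.1
  obtain ⟨m, hm⟩ := exists_int_coroot' P a.1 hv
  refine ⟨(j, m + a.2), hc, fun x => ?_⟩
  simp only [affineRoot, map_add, hj, hm, Int.cast_add]
  ring

variable {P}

lemma AffineConj.symm {x y : E} (h : AffineConj P x y) : AffineConj P y x := by
  obtain ⟨w, v, hv, rfl⟩ := h
  refine ⟨w⁻¹, -(w⁻¹ • v), neg_mem (smul_mem_rootSpan P _ hv), ?_⟩
  rw [smul_add, inv_smul_smul, add_neg_cancel_right]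

lemma AffineConj.trans {x y z : E} (h : AffineConj P x y) (h' : AffineConj P y z) :
    AffineConj P x z := by
  obtain ⟨w, v, hv, rfl⟩ := h
  obtain ⟨w', v', hv', rfl⟩ := h'
  refine ⟨w' * w, w' • v + v', add_mem (smul_mem_rootSpan P _ hv) hv', ?_⟩
  rw [smul_add, mul_smul, add_assoc]

/-- No uniqueness of the folded point is involved: both choices by `Classical.epsilon` are made for
the same predicate. -/
lemma fold_eq_of_affineConj {b : P.Base} {x y : E} (h : AffineConj P x y) :
    fold b x = fold b y := by
  unfold fold
  congr 1
  ext z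
  exact and_congr_right fun _ => ⟨fun h' => h'.trans h, fun h' => h'.trans h.symm⟩

lemma affineConj_smul (w : P.weylGroup) (x : E) : AffineConj P x (w • x) :=
  ⟨w, 0, zero_mem _, (add_zero _).symm⟩

/-! ### Nearest points in the orbits of the affine Weyl group -/

section Descent

variable [Fintype ι] [P.IsCrystallographic] [P.IsRootSystem]

/-- Invariance of the form under the reflection in the root `i`, applied to `y` and that root. -/
lemma two_mul_rootForm_root (y : E) (i : ι) :
    2 * P.RootForm y (P.root i) = P.coroot' i y * P.RootForm (P.root i) (P.root i) := by
  have h := P.rootForm_reflection_reflection_apply i y (P.root i)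
  rw [reflection_apply_self, reflection_apply] at h
  simp only [map_sub, map_neg, map_smul, LinearMap.sub_apply, LinearMap.smul_apply,
    smul_eq_mul] at h
  change -(_ - P.coroot' i y * _) = _ at h
  linarith

lemma rootForm_root_self_pos (i : ι) : 0 < P.RootForm (P.root i) (P.root i) := by
  rw [rootForm_root_self]
  refine Finset.sum_pos' (fun j _ => mul_self_nonneg _) ⟨i, Finset.mem_univ _, ?_⟩
  rw [pairing_same]
  norm_num

/-- Reflecting a point in a hyperplane that separates it from `p` brings it closer to `p`. -/
lemma rootForm_sub_lt {x p : E} {a : ι × ℤ} (hx : affineRoot P a x < 0)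
    (hp : 0 < affineRoot P a p) :
    P.RootForm (x - affineRoot P a x • P.root a.1 - p) (x - affineRoot P a x • P.root a.1 - p) <
      P.RootForm (x - p) (x - p) := by
  set c := affineRoot P a x with hc
  have h1 := two_mul_rootForm_root (P := P) (x - p) a.1
  have h2 := rootForm_root_self_pos (P := P) a.1
  have h3 : P.RootForm (P.root a.1) (x - p) = P.RootForm (x - p) (P.root a.1) :=
    P.rootForm_symmetric.eq _ _
  have h4 : P.coroot' a.1 (x - p) = c - affineRoot P a p := by
    rw [map_sub, hc, affineRoot, affineRoot]
    ring
  have e : x - c • P.root a.1 - p = (x - p) - c • P.root a.1 := by abel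
  rw [e]
  simp only [map_sub (P.RootForm), LinearMap.sub_apply, map_smul, LinearMap.smul_apply,
    smul_eq_mul, LinearMap.map_sub] at h1 h3 ⊢
  rw [map_sub] at h4
  rw [← map_sub] at h4
  simp only [map_sub] at h4
  rw [h4] at h1
  nlinarith [mul_pos (mul_pos (neg_pos.2 hx) hp) h2]

/-- Composing with the reflection in `H_a` stays in `W^aff`, because coroots are integral on the
root lattice. -/
lemma exists_affine_reflection (w : P.weylGroup) {v : E} (hv : v ∈ P.rootSpan ℤ) (a : ι × ℤ) :
    ∃ (w' : P.weylGroup) (v' : E), v' ∈ P.rootSpan ℤ ∧ ∀ z,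
      w' • z + v' = w • z + v - affineRoot P a (w • z + v) • P.root a.1 := by
  obtain ⟨m, hm⟩ := exists_int_coroot' P a.1 hv
  refine ⟨weylGroup.ofIdx P a.1 * w, v - (m + a.2) • P.root a.1,
    sub_mem hv (Submodule.smul_mem _ _ (Submodule.subset_span ⟨_, rfl⟩)), fun z => ?_⟩
  rw [mul_smul, weylGroup.ofIdx_smul, Equiv.reflection_smul, reflection_apply]
  change w • z - P.coroot' a.1 (w • z) • _ + _ = _
  rw [affineRoot, map_add, hm, ← Int.cast_smul_eq_zsmul ℝ]
  push_cast
  generalize w • z = y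
  module

lemma coroot'_sq_le_rootForm (i : ι) (x : E) : P.coroot' i x ^ 2 ≤ P.RootForm x x := by
  rw [rootForm_apply_apply]
  have := Finset.single_le_sum (f := fun i => P.coroot' i x * P.coroot' i x)
    (fun _ _ => mul_self_nonneg _) (Finset.mem_univ i)
  simpa [sq] using this

/-- A bound on the distance to `p` bounds the coroots of the translation part. These are integers,
and the Weyl group is finite, so only finitely many elements compete. -/
lemma exists_min_rootForm (T : Set (P.weylGroup × E)) (hT : ∀ g ∈ T, g.2 ∈ P.rootSpan ℤ)
    (hne : T.Nonempty) (z p : E) : ∃ g ∈ T, ∀ g' ∈ T,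
      P.RootForm (g.1 • z + g.2 - p) (g.1 • z + g.2 - p) ≤
        P.RootForm (g'.1 • z + g'.2 - p) (g'.1 • z + g'.2 - p) := by
  obtain ⟨g₀, hg₀⟩ := hne
  set q : P.weylGroup × E → ℝ := fun g => P.RootForm (g.1 • z + g.2 - p) (g.1 • z + g.2 - p)
  set R := q g₀
  set T' : Set (P.weylGroup × E) := {g | g ∈ T ∧ q g ≤ R}
  -- From `c ^ 2 ≤ R` follows `|c| ≤ R + 1`. The two sums absorb the contributions of `z` and `p`,
  -- leaving a bound for the coroots of `g.2`.
  set B : ℝ := R + 1 + (∑ j, |P.coroot' j z|) + ∑ j, |P.coroot' j p| with hB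
  have hfin : T'.Finite := by
    set F : P.weylGroup × E → P.weylGroup × (ι → ℤ) := fun g => (g.1, fun i => ⌊P.coroot' i g.2⌋)
    refine Set.Finite.of_finite_image (f := F) ?_ ?_
    · refine Set.Finite.subset (Set.Finite.prod (Set.finite_univ)
        (Set.Finite.pi' fun _ : ι => Set.finite_Icc (-⌈B⌉) ⌈B⌉)) ?_
      rintro - ⟨g, ⟨hg, hgR⟩, rfl⟩
      refine ⟨trivial, fun i => ?_⟩
      obtain ⟨m, hm⟩ := exists_int_coroot' P i (hT g hg)
      simp only [F, hm, Int.floor_intCast]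
      obtain ⟨j, -, hj⟩ := exists_index_smul P g.1 i
      have h1 := (coroot'_sq_le_rootForm (P := P) i (g.1 • z + g.2 - p)).trans hgR
      have h2 : |P.coroot' i (g.1 • z + g.2 - p)| ≤ R + 1 := by
        rw [← sq_abs] at h1
        nlinarith [abs_nonneg (P.coroot' i (g.1 • z + g.2 - p)), h1]
      rw [map_sub, map_add, hj, hm] at h2
      have h3 : |P.coroot' j z| ≤ ∑ j, |P.coroot' j z| :=
        Finset.single_le_sum (f := fun i => |P.coroot' i z|) (fun _ _ => abs_nonneg _)
          (Finset.mem_univ j)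
      have h4 : |P.coroot' i p| ≤ ∑ j, |P.coroot' j p| :=
        Finset.single_le_sum (f := fun i => |P.coroot' i p|) (fun _ _ => abs_nonneg _)
          (Finset.mem_univ i)
      rw [abs_le] at h2 h3 h4
      have h5 := Int.le_ceil B
      constructor
      · have : (-⌈B⌉ : ℝ) ≤ m := by linarith
        exact_mod_cast this
      · have : (m : ℝ) ≤ ⌈B⌉ := by linarith
        exact_mod_cast this
    · rintro g ⟨hg, -⟩ g' ⟨hg', -⟩ h
      simp only [F, Prod.mk.injEq] at h
      refine Prod.ext h.1 (ext_of_coroot' P fun i => ?_)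
      have := congrFun h.2 i
      obtain ⟨m, hm⟩ := exists_int_coroot' P i (hT g hg)
      obtain ⟨m', hm'⟩ := exists_int_coroot' P i (hT g' hg')
      simp only [hm, hm', Int.floor_intCast] at this
      rw [hm, hm', this]
  obtain ⟨g, hg, hmin⟩ := Set.exists_min_image T' q hfin ⟨g₀, hg₀, le_rfl⟩
  refine ⟨g, hg.1, fun g' hg' => ?_⟩
  by_cases h : q g' ≤ R
  · exact hmin g' ⟨hg', h⟩
  · exact hg.2.trans (not_le.1 h).le

end Descent

end Affine

/-! ### Words in simple reflections -/

section Words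

variable (P : RootPairing ι ℝ E N)

/-- The product of the reflections listed in a word, as a map. -/
def wordAct (L : List ι) (x : E) : E := L.foldr (fun j y => P.reflection j y) x

/-- The index of the coroot obtained by composing a coroot with `wordAct`. -/
def wordIndex (L : List ι) (i : ι) : ι := L.foldl (fun i j => P.reflectionPerm j i) i

lemma coroot'_wordAct (L : List ι) (i : ι) (x : E) :
    P.coroot' i (wordAct P L x) = P.coroot' (wordIndex P L i) x := by
  induction L generalizing i with
  | nil => rfl
  | cons j L ih =>
    change P.coroot' i (P.reflection j (wordAct P L x)) = _
    rw [coroot'_reflection, ih]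
    rfl

lemma wordAct_append (L L' : List ι) (x : E) :
    wordAct P (L ++ L') x = wordAct P L (wordAct P L' x) := by
  simp [wordAct]

/-- The relation `s_i w = w s_{w⁻¹ i}`; `wordIndex` computes `w⁻¹ i`. -/
lemma reflection_wordAct (L : List ι) (i : ι) (x : E) :
    P.reflection i (wordAct P L x) = wordAct P L (P.reflection (wordIndex P L i) x) := by
  induction L generalizing i with
  | nil => rfl
  | cons j L ih =>
    change _ = P.reflection j (wordAct P L (P.reflection (wordIndex P L (P.reflectionPerm j i)) x))
    rw [← ih, reflection_reflectionPerm]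
    change P.reflection i (P.reflection j (wordAct P L x)) =
      P.reflection j (P.reflection j (P.reflection i (P.reflection j (wordAct P L x))))
    rw [reflection_same]

lemma reflection_opp (i : ι) : P.reflection (opp P i) = P.reflection i := by
  ext x
  rw [reflection_apply, reflection_apply, coroot'_opp, root_opp, neg_smul, smul_neg, neg_neg]

lemma eq_of_coroot'_eq {i j : ι} (h : ∀ x, P.coroot' i x = P.coroot' j x) : i = j := by
  apply P.coroot.injective
  apply P.flip.toPerfPair.injective
  ext x
  exact h x

variable {P} [Finite ι] [P.IsCrystallographic] [P.IsRootSystem] [P.IsReduced] (b : P.Base)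

lemma exists_word (w : P.weylGroup) :
    ∃ L : List ι, (∀ j ∈ L, j ∈ b.support) ∧ ∀ x : E, w • x = wordAct P L x := by
  obtain ⟨w, hw⟩ := w
  induction hw using RootPairing.weylGroup.induction with
  | mem i =>
    change ∃ L : List ι, (∀ j ∈ L, j ∈ b.support) ∧ ∀ x : E, P.reflection i x = wordAct P L x
    refine b.induction_reflect i (p := fun i =>
      ∃ L : List ι, (∀ j ∈ L, j ∈ b.support) ∧ ∀ x : E, P.reflection i x = wordAct P L x) ?_ ?_ ?_
    · intro i hi
      change ∃ L : List ι, _ ∧ ∀ x : E, P.reflection (opp P i) x = wordAct P L x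
      rwa [reflection_opp]
    · intro i hi
      exact ⟨[i], by simpa using hi, fun x => rfl⟩
    · rintro i j ⟨L, hL, h⟩ hj
      refine ⟨j :: (L ++ [j]), ?_, fun x => ?_⟩
      · intro k hk
        simp only [List.mem_cons, List.mem_append, List.not_mem_nil, or_false] at hk
        rcases hk with rfl | hk | rfl
        exacts [hj, hL k hk, hj]
      · rw [reflection_reflectionPerm]
        change P.reflection j (P.reflection i (P.reflection j x)) =
          P.reflection j (wordAct P (L ++ [j]) x)
        rw [h, wordAct_append]
        rfl
  | one => exact ⟨[], by simp, fun x => one_smul P.Aut x⟩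
  | mul u v hu hv ihu ihv =>
    obtain ⟨L, hL, h⟩ := ihu
    obtain ⟨L', hL', h'⟩ := ihv
    refine ⟨L ++ L', fun j hj => ?_, fun x => ?_⟩
    · rcases List.mem_append.1 hj with hj | hj
      exacts [hL j hj, hL' j hj]
    · change (u * v) • x = _
      rw [mul_smul, wordAct_append, ← h', ← h]
      rfl

variable {b}

lemma IsPositive.reflectionPerm {i j : ι} (hi : IsPositive b i) (hj : j ∈ b.support)
    (hij : i ≠ j) : IsPositive b (P.reflectionPerm j i) := by
  rw [isPositive_iff] at hi ⊢
  exact Base.IsPos.reflectionPerm hi hj hij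

/-- The only positive coroot that a simple reflection makes negative is its own. The sign can
therefore only change at a letter that equals the coroot reached so far. -/
lemma exists_sign_change {L : List ι} (hL : ∀ j ∈ L, j ∈ b.support) {i : ι}
    (hi : IsPositive b i) (hneg : ¬IsPositive b (wordIndex P L i)) :
    ∃ u l r, L = u ++ l :: r ∧ wordIndex P u i = l := by
  induction L generalizing i with
  | nil => exact absurd hi hneg
  | cons j L ih =>
    by_cases hij : i = j
    · exact ⟨[], j, L, rfl, hij⟩
    · obtain ⟨u, l, r, h1, h2⟩ := ih (fun k hk => hL k (List.mem_cons_of_mem _ hk))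
        (hi.reflectionPerm (hL j List.mem_cons_self) hij) hneg
      exact ⟨j :: u, l, r, by rw [h1]; rfl, h2⟩

/-- An element of the Weyl group that permutes the positive coroots is trivial. -/
lemma wordAct_eq_self {L : List ι} (hL : ∀ j ∈ L, j ∈ b.support)
    (hpos : ∀ i, IsPositive b i → IsPositive b (wordIndex P L i)) (x : E) :
    wordAct P L x = x := by
  induction hn : L.length using Nat.strong_induction_on generalizing L with
  | _ n ih =>
    cases L with
    | nil => rfl
    | cons j L =>
      have hj := hL j List.mem_cons_self
      have hL' : ∀ k ∈ L, k ∈ b.support := fun k hk => hL k (List.mem_cons_of_mem _ hk)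
      have h1 : IsPositive b (wordIndex P L (opp P j)) := hpos j (isPositive_simple b hj)
      have h2 : ¬IsPositive b (wordIndex P L j) := by
        intro h
        apply not_isPositive_opp b h
        convert h1 using 1
        apply eq_of_coroot'_eq P
        intro y
        rw [coroot'_opp, ← coroot'_wordAct, ← coroot'_wordAct, coroot'_opp]
      -- Deletion: the leading letter `j` makes its own coroot negative, so the rest of the word
      -- must change the sign back. By the conjugation relation `j` cancels against the letter `l`
      -- where this happens, leaving a shorter word with the same action.
      obtain ⟨u, l, r, rfl, hu⟩ := exists_sign_change hL' (isPositive_simple b hj) h2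
      have key : ∀ y, wordAct P (j :: (u ++ l :: r)) y = wordAct P (u ++ r) y := by
        intro y
        change P.reflection j (wordAct P (u ++ l :: r) y) = _
        rw [wordAct_append, wordAct_append, reflection_wordAct, hu]
        change wordAct P u (P.reflection l (P.reflection l (wordAct P r y))) = _
        rw [reflection_same]
      rw [key]
      refine ih (u ++ r).length ?_ ?_ ?_ rfl
      · rw [← hn]
        simp only [List.length_cons, List.length_append]
        omega
      · intro k hk
        apply hL' k
        simp only [List.mem_append, List.mem_cons] at hk ⊢
        tauto
      · intro i hi
        convert hpos i hi using 1
        apply eq_of_coroot'_eq P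
        intro y
        rw [← coroot'_wordAct, ← coroot'_wordAct, key]

end Words

/-! ### The root lattice has no nonzero minuscule elements -/

section Minuscule

variable {P : RootPairing ι ℝ E N}

lemma exists_list_sum_root {v : E} (hv : v ∈ P.rootSpan ℤ) :
    ∃ l : List ι, v = (l.map P.root).sum := by
  let S : AddSubgroup E :=
    { carrier := {v | ∃ l : List ι, v = (l.map P.root).sum}
      zero_mem' := ⟨[], rfl⟩
      add_mem' := by
        rintro _ _ ⟨l, rfl⟩ ⟨l', rfl⟩
        exact ⟨l ++ l', by simp⟩
      neg_mem' := by
        rintro _ ⟨l, rfl⟩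
        refine ⟨l.map (opp P), ?_⟩
        induction l with
        | nil => simp
        | cons i l ih =>
          simp only [List.map_cons, List.sum_cons, neg_add, ih, root_opp] }
  have : P.rootSpan ℤ ≤ AddSubgroup.toIntSubmodule S := by
    rw [Submodule.span_le]
    rintro _ ⟨i, rfl⟩
    exact ⟨[i], by simp⟩
  exact this hv

variable [Finite ι] [P.IsCrystallographic]

/-- In a shortest expression of `v` as a sum of roots the first root `i` has nonnegative pairing
with the others: a negative pairing would allow two terms to be cancelled or merged into one root.
If the sum is not empty, the coroot of `i` is then at least `2` on `v`. -/
lemma eq_zero_of_abs_coroot'_le_one {v : E} (hv : v ∈ P.rootSpan ℤ)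
    (h : ∀ i, P.coroot' i v ≤ 1) : v = 0 := by
  classical
  have hex : ∃ n, ∃ l : List ι, v = (l.map P.root).sum ∧ l.length = n := by
    obtain ⟨l, hl⟩ := exists_list_sum_root hv
    exact ⟨_, l, hl, rfl⟩
  obtain ⟨l, hl, hlen⟩ := Nat.find_spec hex
  cases l with
  | nil => simpa using hl
  | cons i t =>
    exfalso
    have key : ∀ j ∈ t, 0 ≤ P.pairing j i := by
      intro j hj
      by_contra! hneg
      obtain ⟨t', ht'⟩ : ∃ t' : List ι, (t.map P.root).sum = P.root j + (t'.map P.root).sum ∧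
          t.length = t'.length + 1 := by
        refine ⟨t.erase j, ?_, ?_⟩
        · rw [((List.perm_cons_erase hj).map P.root).sum_eq]
          simp
        · rw [List.length_erase_of_mem hj]
          have := List.length_pos_of_mem hj
          omega
      have hneg' : P.pairingIn ℤ j i < 0 := by
        rw [← P.algebraMap_pairingIn ℤ, algebraMap_int_eq, eq_intCast] at hneg
        exact_mod_cast hneg
      simp only [List.map_cons, List.sum_cons] at hl
      rw [ht'.1] at hl
      simp only [List.length_cons] at hlen
      by_cases hopp : P.root j = -P.root i
      · refine Nat.find_min hex (m := t'.length) (by omega) ⟨t', ?_, rfl⟩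
        rw [hl, hopp]
        abel
      · obtain ⟨k, hk⟩ := P.root_add_root_mem_of_pairingIn_neg hneg' hopp
        refine Nat.find_min hex (m := t'.length + 1) (by omega) ⟨k :: t', ?_, rfl⟩
        rw [hl]
        simp only [List.map_cons, List.sum_cons, hk]
        abel
    have h1 := h i
    have h2 : 0 ≤ P.coroot' i (t.map P.root).sum := by
      rw [map_list_sum, List.map_map]
      apply List.sum_nonneg
      intro x hx
      obtain ⟨j, hj, rfl⟩ := List.mem_map.1 hx
      exact key j hj
    rw [hl] at h1
    simp only [List.map_cons, List.sum_cons, map_add, root_coroot'_eq_pairing, pairing_same] at h1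
    linarith

end Minuscule

/-! ### The closed alcove is a fundamental domain -/

section FundamentalDomain

variable {P : RootPairing ι ℝ E N} [Finite ι] [P.IsCrystallographic] [P.IsRootSystem]
  [P.IsReduced] (b : P.Base)

lemma zero_mem_closedAlcove : (0 : E) ∈ closedAlcove b :=
  ⟨fun i _ => by simp, fun i _ => by simp⟩

/-- A point of the orbit nearest to an interior point `p` of the alcove works: reflecting in a
hyperplane that separated the two would bring it closer. -/
lemma exists_affineConj_mem_closedAlcove (x : E) : ∃ y ∈ closedAlcove b, AffineConj P y x := by
  have := Fintype.ofFinite ι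
  obtain ⟨p, hp⟩ := exists_mem_alcove b
  obtain ⟨⟨w, v⟩, hv, hmin⟩ := exists_min_rootForm (P := P)
    {g : P.weylGroup × E | g.2 ∈ P.rootSpan ℤ} (fun g hg => hg) ⟨(1, 0), zero_mem (P.rootSpan ℤ)⟩ x p
  refine ⟨w • x + v, ?_, AffineConj.symm ⟨w, v, hv, rfl⟩⟩
  rw [← closedFacet_eq_closedAlcove hp]
  intro a ha
  by_contra! hneg
  obtain ⟨w', v', hv', h⟩ := exists_affine_reflection w hv a
  have h1 := hmin (w', v') hv'
  have h2 := rootForm_sub_lt hneg (lt_of_le_of_ne ha (affineRoot_ne_zero hp a).symm)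
  simp only [h] at h1
  exact absurd h1 (not_le.2 h2)

variable {b}

/-- Among the elements of `W^aff` that take `x` to `y`, choose one that moves `p` least. A
hyperplane separating `p` from its image would contain `y`, and composing with its reflection would
give a better choice. So no hyperplane separates them; the translation part is then minuscule, hence
zero, and the linear part preserves positivity of coroots, hence is trivial. -/
lemma eq_of_affineConj {x y : E} (hx : x ∈ closedAlcove b) (hy : y ∈ closedAlcove b)
    (h : AffineConj P x y) : x = y := by
  have := Fintype.ofFinite ι
  obtain ⟨p, hp⟩ := exists_mem_alcove b
  have hpos : ∀ {z}, z ∈ closedAlcove b → ∀ {a}, 0 < affineRoot P a p → 0 ≤ affineRoot P a z := by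
    intro z hz a ha
    rw [← closedFacet_eq_closedAlcove hp] at hz
    exact hz a ha.le
  have hneg : ∀ {z}, z ∈ closedAlcove b → ∀ {a}, affineRoot P a p < 0 → affineRoot P a z ≤ 0 := by
    intro z hz a ha
    have := hpos hz (a := (opp P a.1, -a.2)) (by rw [affineRoot_neg_index P]; linarith)
    rw [affineRoot_neg_index P] at this
    linarith
  obtain ⟨w₀, v₀, hv₀, h₀⟩ := h
  obtain ⟨⟨w, v⟩, ⟨hv, hy'⟩, hmin⟩ := exists_min_rootForm (P := P)
    {g : P.weylGroup × E | g.2 ∈ P.rootSpan ℤ ∧ y = g.1 • x + g.2} (fun g hg => hg.1)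
    ⟨(w₀, v₀), hv₀, h₀⟩ p p
  dsimp only at hv hy'
  have hmove : ∀ a, 0 < affineRoot P a p → 0 < affineRoot P a (w • p + v) := by
    intro a ha
    obtain ⟨a', -, ha'⟩ := exists_affineRoot_comp P w hv a
    by_contra! hle
    have hlt : affineRoot P a (w • p + v) < 0 := by
      refine lt_of_le_of_ne hle ?_
      rw [ha']
      exact affineRoot_ne_zero hp a'
    have hy0 : affineRoot P a y = 0 := by
      refine le_antisymm ?_ (hpos hy ha)
      rw [hy', ha']
      rw [ha'] at hlt
      exact hneg hx hlt
    obtain ⟨w', v', hv', h'⟩ := exists_affine_reflection w hv a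
    have h1 := hmin (w', v') ⟨hv', by rw [h', ← hy', hy0, zero_smul, sub_zero]⟩
    have h2 := rootForm_sub_lt hlt ha
    simp only [h'] at h1
    exact absurd h1 (not_le.2 h2)
  -- The image of `0` is `v`, which lies in the closed alcove because no hyperplane separates `p`
  -- from its image.
  have hv0 : v = 0 := by
    apply eq_zero_of_abs_coroot'_le_one hv
    have hvC : v ∈ closedAlcove b := by
      rw [← closedFacet_eq_closedAlcove hp]
      intro a ha
      obtain ⟨a', -, ha'⟩ := exists_affineRoot_comp P w hv a
      have h1 := hmove a (lt_of_le_of_ne ha (affineRoot_ne_zero hp a).symm)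
      rw [ha'] at h1
      have h2 := hpos (zero_mem_closedAlcove b) h1
      rwa [← ha', smul_zero, zero_add] at h2
    intro i
    rcases isPositive_or_opp b i with hi | hi
    · exact (coroot'_mem_Icc_of_mem_closedAlcove hvC hi).2
    · have := (coroot'_mem_Icc_of_mem_closedAlcove hvC hi).1
      rw [coroot'_opp] at this
      linarith
  subst hv0
  obtain ⟨L, hL, hw⟩ := exists_word b w
  rw [hy', add_zero, hw, wordAct_eq_self hL]
  intro i hi
  have h1 := hmove (i, 0) (by simpa [affineRoot] using (hp i hi).1)
  simp only [affineRoot, Int.cast_zero, add_zero, hw, coroot'_wordAct] at h1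
  rcases isPositive_or_opp b (wordIndex P L i) with h2 | h2
  · exact h2
  · have := (hp _ h2).1
    rw [coroot'_opp] at this
    linarith

lemma fold_eq_of_mem {x y : E} (hy : y ∈ closedAlcove b) (h : AffineConj P y x) :
    fold b x = y := by
  have h1 : fold b x ∈ closedAlcove b ∧ AffineConj P (fold b x) x :=
    Classical.epsilon_spec (p := fun y => y ∈ closedAlcove b ∧ AffineConj P y x) ⟨y, hy, h⟩
  exact eq_of_affineConj h1.1 hy (h1.2.trans h.symm)

end FundamentalDomain

/-! ### Barycentric coordinates on a closed alcove -/

section Charts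
open scoped Classical

/-- Barycentric coordinates with respect to a closed alcove: for each component, a family of
affine functions with sum `1` (rescaled affine roots), which together are coordinates on `E`,
and which are nonnegative precisely on the closed alcove. -/
structure Chart (P : RootPairing ι ℝ E N) (S : Type*) [Fintype S] (kind : S → Component P) where
  lam : S → E → ℝ
  aff : S → ι × ℤ
  scale : S → ℝ
  scale_pos : ∀ s, 0 < scale s
  lam_eq : ∀ s x, lam s x = scale s * affineRoot P (aff s) x
  comp_aff : ∀ s, comp P (aff s).1 = kind s
  sum_eq : ∀ c x, ∑ s with kind s = c, lam s x = 1
  exists_point : ∀ t : S → ℝ, (∀ c, ∑ s with kind s = c, t s = 1) → ∃ x, ∀ s, lam s x = t s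
  ext_comp : ∀ c x y, (∀ s, kind s = c → lam s x = lam s y) →
    ∀ i, comp P i = c → P.coroot' i x = P.coroot' i y
  sign : ∀ a, (∀ x, (∀ s, 0 ≤ lam s x) → 0 ≤ affineRoot P a x) ∨
    (∀ x, (∀ s, 0 ≤ lam s x) → affineRoot P a x ≤ 0)

/-- Gives room to move from a point with coordinates `f` a little way in the direction `g`, keeping
the coordinates nonnegative. -/
lemma exists_pos_mul_abs_le {S : Type*} [Finite S] {f g : S → ℝ} (hf : ∀ s, 0 ≤ f s)
    (hg : ∀ s, f s = 0 → g s = 0) : ∃ ε > 0, ∀ s, ε * |g s| ≤ f s := by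
  have key : ∀ s, ∃ ε > 0, ∀ δ, δ ≤ ε → δ * |g s| ≤ f s := by
    intro s
    rcases (hf s).eq_or_lt with h | h
    · exact ⟨1, one_pos, fun δ _ => by rw [hg s h.symm, ← h]; simp⟩
    · refine ⟨f s / (1 + |g s|), by positivity, fun δ hδ => ?_⟩
      have h1 : 0 < 1 + |g s| := by positivity
      have h2 : δ * |g s| ≤ f s / (1 + |g s|) * |g s| :=
        mul_le_mul_of_nonneg_right hδ (abs_nonneg _)
      refine h2.trans ?_
      rw [div_mul_eq_mul_div, div_le_iff₀ h1]
      nlinarith [abs_nonneg (g s)]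
  choose ε h0 h1 using key
  cases isEmpty_or_nonempty S with
  | inl h => exact ⟨1, one_pos, fun s => h.elim s⟩
  | inr h =>
    obtain ⟨s, hs⟩ := Finite.exists_min ε
    exact ⟨ε s, h0 s, fun t => h1 t _ (hs t)⟩

namespace Chart

variable {P : RootPairing ι ℝ E N} {S : Type*} [Fintype S] {kind : S → Component P}
  (C : Chart P S kind)

lemma lam_congr {s : S} {x y : E} (h : ∀ i, comp P i = kind s → P.coroot' i x = P.coroot' i y) :
    C.lam s x = C.lam s y := by
  rw [C.lam_eq, C.lam_eq, affineRoot, affineRoot, h _ (C.comp_aff s)]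

lemma lam_add_smul_sub (s : S) (x y z : E) (t : ℝ) :
    C.lam s (x + t • (y - z)) = C.lam s x + t * (C.lam s y - C.lam s z) := by
  simp only [C.lam_eq, affineRoot, map_add, map_smul, map_sub, smul_eq_mul]
  ring

lemma lam_add_smul (s : S) (x u : E) (t : ℝ) :
    C.lam s (x + t • u) = C.lam s x + t * (C.scale s * P.coroot' (C.aff s).1 u) := by
  simp only [C.lam_eq, affineRoot, map_add, map_smul, smul_eq_mul]
  ring

lemma lam_sum {T : Type*} (A : Finset T) (w : T → ℝ) (hw : ∑ t ∈ A, w t = 1) (v : T → E) (s : S) :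
    C.lam s (∑ t ∈ A, w t • v t) = ∑ t ∈ A, w t * C.lam s (v t) := by
  have h : ∀ k : ℝ, k = ∑ t ∈ A, w t * k := fun k => by rw [← Finset.sum_mul, hw, one_mul]
  simp only [C.lam_eq, affineRoot, map_sum, map_smul, smul_eq_mul]
  rw [h ((C.aff s).2 : ℝ), ← Finset.sum_add_distrib, Finset.mul_sum, ← h]
  exact Finset.sum_congr rfl fun t _ => by ring

lemma lam_ext [P.IsRootSystem] {x y : E} (h : ∀ s, C.lam s x = C.lam s y) : x = y :=
  ext_of_coroot' P fun i => C.ext_comp _ x y (fun s _ => h s) i rfl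

/-- The face of the closed alcove on which the coordinates outside `J` vanish. -/
def face (J : Finset S) : Set E := {x | ∀ s, 0 ≤ C.lam s x ∧ (s ∉ J → C.lam s x = 0)}

/-- `J` contains a vertex of each of the factors. -/
def _root_.AlcoveComplex.Transversal (kind : S → Component P) (J : Finset S) : Prop :=
  ∀ c, ∃ s ∈ J, kind s = c

lemma closedFacet_eq_face {x : E} (hx : ∀ s, 0 ≤ C.lam s x) :
    closedFacet P x = C.face (Finset.univ.filter fun s => 0 < C.lam s x) := by
  ext y
  constructor
  · intro hy s
    have h1 := hy (C.aff s)
    have h2 := hy (opp P (C.aff s).1, -(C.aff s).2)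
    rw [affineRoot_neg_index P, affineRoot_neg_index P] at h2
    have h3 := hx s
    rw [C.lam_eq] at h3
    have h4 := C.scale_pos s
    have h5 := nonneg_of_mul_nonneg_right h3 h4
    have h6 := h1 h5
    refine ⟨by rw [C.lam_eq]; exact mul_nonneg h4.le h6, fun hs => ?_⟩
    simp only [Finset.mem_filter, Finset.mem_univ, true_and, not_lt, C.lam_eq] at hs
    have h7 : affineRoot P (C.aff s) x = 0 := by
      have := le_antisymm hs h3
      exact (mul_eq_zero.1 this).resolve_left h4.ne'
    rw [h7] at h2
    have h8 := h2 (by simp)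
    rw [C.lam_eq, le_antisymm (by linarith : affineRoot P (C.aff s) y ≤ 0) h6, mul_zero]
  · intro hy a ha
    rcases C.sign a with h | h
    · exact h y fun s => (hy s).1
    · have h0 : affineRoot P a x = 0 := le_antisymm (h x hx) ha
      -- The segment from `y` to `x` can be prolonged a little beyond `x` inside the alcove. As `a`
      -- vanishes at `x` and is nonpositive on the alcove, it cannot be negative at `y`.
      obtain ⟨ε, hε, hle⟩ := exists_pos_mul_abs_le (f := fun s => C.lam s x)
        (g := fun s => C.lam s y) hx (fun s hs => (hy s).2 (by simp [hs]))
      have h1 := h (x + ε • (x - y)) fun s => by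
        rw [C.lam_add_smul_sub]
        have h2 := hle s
        rw [abs_of_nonneg (hy s).1] at h2
        nlinarith [hx s]
      have h3 : affineRoot P a (x + ε • (x - y)) =
          affineRoot P a x + ε * (affineRoot P a x - affineRoot P a y) := by
        simp only [affineRoot, map_add, map_smul, map_sub, smul_eq_mul]
        ring
      rw [h3, h0] at h1
      by_contra! hneg
      nlinarith

lemma exists_lam_pos {x : E} (hx : ∀ s, 0 ≤ C.lam s x) (c : Component P) :
    ∃ s, kind s = c ∧ 0 < C.lam s x := by
  by_contra! h
  have h1 := C.sum_eq c x
  rw [Finset.sum_eq_zero fun s hs => le_antisymm (h s (by simpa using hs)) (hx s)] at h1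
  exact zero_ne_one h1

lemma transversal_of_mem_face {J : Finset S} {x : E} (hx : x ∈ C.face J) : Transversal kind J := by
  intro c
  obtain ⟨s, hs, h⟩ := C.exists_lam_pos (fun s => (hx s).1) c
  refine ⟨s, ?_, hs⟩
  by_contra hJ
  rw [(hx s).2 hJ] at h
  exact lt_irrefl _ h

lemma exists_interior {J : Finset S} (hJ : Transversal kind J) :
    ∃ x, ∀ s, (s ∈ J → 0 < C.lam s x) ∧ (s ∉ J → C.lam s x = 0) := by
  -- With the weights `1 / n c` the point found is the barycentre in each factor.
  set n : Component P → ℝ := fun c => (J.filter fun s => kind s = c).card with hn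
  have hpos : ∀ c, 0 < n c := by
    intro c
    obtain ⟨s, hs, hc⟩ := hJ c
    simp only [hn, Nat.cast_pos, Finset.card_pos]
    exact ⟨s, by simp [hs, hc]⟩
  obtain ⟨x, hx⟩ := C.exists_point (fun s => if s ∈ J then (n (kind s))⁻¹ else 0) fun c => by
    rw [← Finset.sum_filter]
    have h1 : (Finset.univ.filter fun s => kind s = c).filter (fun s => s ∈ J) =
        J.filter fun s => kind s = c := by
      ext s
      simp [and_comm]
    rw [h1, Finset.sum_congr rfl (g := fun _ => (n c)⁻¹) fun s hs => by
      rw [(Finset.mem_filter.1 hs).2]]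
    rw [Finset.sum_const, nsmul_eq_mul]
    exact mul_inv_cancel₀ (hpos c).ne'
  refine ⟨x, fun s => ⟨fun hs => ?_, fun hs => ?_⟩⟩
  · rw [hx, if_pos hs]
    exact inv_pos.2 (hpos _)
  · rw [hx, if_neg hs]

lemma exists_closedFacet_eq_face {J : Finset S} (hJ : Transversal kind J) :
    ∃ x ∈ C.face J, closedFacet P x = C.face J ∧ ∀ s ∈ J, 0 < C.lam s x := by
  obtain ⟨x, hx⟩ := C.exists_interior hJ
  have h0 : ∀ s, 0 ≤ C.lam s x := by
    intro s
    by_cases hs : s ∈ J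
    · exact ((hx s).1 hs).le
    · exact ((hx s).2 hs).ge
  refine ⟨x, fun s => ⟨h0 s, (hx s).2⟩, ?_, fun s => (hx s).1⟩
  rw [C.closedFacet_eq_face h0]
  congr 1
  ext s
  simp only [Finset.mem_filter, Finset.mem_univ, true_and]
  refine ⟨fun h => ?_, (hx s).1⟩
  by_contra hs
  rw [(hx s).2 hs] at h
  exact lt_irrefl _ h

lemma face_mem_polysimplices {J : Finset S} (hJ : Transversal kind J) :
    C.face J ∈ polysimplices P := by
  obtain ⟨x, -, h, -⟩ := C.exists_closedFacet_eq_face hJ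
  exact ⟨x, h⟩

lemma self_mem_closedFacet (P : RootPairing ι ℝ E N) (x : E) : x ∈ closedFacet P x :=
  fun _ h => h

lemma transversal_of_face_mem_polysimplices {J : Finset S} (h : C.face J ∈ polysimplices P) :
    Transversal kind J := by
  obtain ⟨x, hx⟩ := h
  apply C.transversal_of_mem_face (x := x)
  rw [← hx]
  exact self_mem_closedFacet P x

lemma face_mono {J J' : Finset S} (h : J ⊆ J') : C.face J ⊆ C.face J' :=
  fun _ hx s => ⟨(hx s).1, fun hs => (hx s).2 fun h' => hs (h h')⟩

lemma face_subset_iff {J J' : Finset S} (hJ : Transversal kind J) :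
    C.face J ⊆ C.face J' ↔ J ⊆ J' := by
  refine ⟨fun h s hs => ?_, C.face_mono⟩
  obtain ⟨x, hx, -, hpos⟩ := C.exists_closedFacet_eq_face hJ
  by_contra hs'
  have := (h hx s).2 hs'
  exact (hpos s hs).ne' this

lemma face_injective {J J' : Finset S} (hJ : Transversal kind J) (hJ' : Transversal kind J')
    (h : C.face J = C.face J') : J = J' :=
  Finset.Subset.antisymm ((C.face_subset_iff hJ).1 h.subset) ((C.face_subset_iff hJ').1 h.superset)

lemma exists_face_of_mem {x : E} (hx : ∀ s, 0 ≤ C.lam s x) :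
    ∃ J, Transversal kind J ∧ closedFacet P x = C.face J := by
  refine ⟨_, ?_, C.closedFacet_eq_face hx⟩
  intro c
  obtain ⟨s, hs, h⟩ := C.exists_lam_pos hx c
  exact ⟨s, by simpa using h, hs⟩

lemma exists_face_of_subset {σ : Set E} (hσ : σ ∈ polysimplices P) {J : Finset S}
    (h : σ ⊆ C.face J) : ∃ J' ⊆ J, Transversal kind J' ∧ σ = C.face J' := by
  obtain ⟨x, rfl⟩ := hσ
  obtain ⟨J', hJ', he⟩ :=
    C.exists_face_of_mem fun s => (h (self_mem_closedFacet P x) s).1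
  rw [he] at h
  exact ⟨J', (C.face_subset_iff hJ').1 h, hJ', he⟩

include C in
lemma exists_kind (c : Component P) : ∃ s, kind s = c := by
  by_contra! h
  have h1 := C.sum_eq c 0
  rw [Finset.sum_eq_zero fun s hs => absurd (by simpa using hs) (h s)] at h1
  exact zero_ne_one h1

/-! ### Vertices of the factors, opposite faces and dimensions -/

variable [P.IsRootSystem]

lemma exists_vertex (s : S) : ∃ x ∈ Submodule.span ℝ (P.root '' (kind s).supp),
    ∀ t, kind t = kind s → C.lam t x = if t = s then 1 else 0 := by
  choose r hr using C.exists_kind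
  -- The vertices `r` of the other factors only serve to satisfy the sum conditions; the projection
  -- to the factor of `s` forgets them.
  obtain ⟨y, hy⟩ := C.exists_point (fun t => if t = (if kind t = kind s then s else r (kind t))
      then 1 else 0) fun c => by
    rw [Finset.sum_congr rfl (g := fun t => if t = (if c = kind s then s else r c) then (1 : ℝ)
      else 0) fun t ht => by rw [(Finset.mem_filter.1 ht).2]]
    rw [Finset.sum_ite_eq', if_pos]
    simp only [Finset.mem_filter, Finset.mem_univ, true_and]
    split_ifs with h
    · exact h.symm
    · exact hr c
  obtain ⟨x, hx, h⟩ := exists_component_proj P (kind s) y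
  refine ⟨x, hx, fun t ht => ?_⟩
  rw [C.lam_congr (x := x) (y := y) fun i hi => by rw [h, if_pos (hi.trans ht)], hy, if_pos ht]

/-- The vertices of the factors of the closed alcove. -/
def vertex (s : S) : E := (C.exists_vertex s).choose

lemma vertex_mem_span (s : S) : C.vertex s ∈ Submodule.span ℝ (P.root '' (kind s).supp) :=
  (C.exists_vertex s).choose_spec.1

lemma lam_vertex {s t : S} (h : kind t = kind s) : C.lam t (C.vertex s) = if t = s then 1 else 0 :=
  (C.exists_vertex s).choose_spec.2 t h

lemma ext_span {c : Component P} {x y : E} (hx : x ∈ Submodule.span ℝ (P.root '' c.supp))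
    (hy : y ∈ Submodule.span ℝ (P.root '' c.supp))
    (h : ∀ s, kind s = c → C.lam s x = C.lam s y) : x = y :=
  ext_of_coroot' P fun i => by
    by_cases hi : comp P i = c
    · exact C.ext_comp c x y h i hi
    · rw [coroot'_eq_zero_of_mem_span P hx hi, coroot'_eq_zero_of_mem_span P hy hi]

lemma eq_vertex {s : S} {x : E} (hx : x ∈ Submodule.span ℝ (P.root '' (kind s).supp))
    (h : ∀ t, kind t = kind s → t ≠ s → C.lam t x = 0) : x = C.vertex s := by
  refine C.ext_span hx (C.vertex_mem_span s) fun t ht => ?_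
  rw [C.lam_vertex ht]
  split_ifs with hts
  · subst hts
    have h1 := C.sum_eq (kind t) x
    rwa [Finset.sum_eq_single t (fun r hr hrt => h r (by simpa using hr) hrt) (by simp)] at h1
  · exact h t ht hts

lemma vertex_injOn {s t : S} (hst : kind s = kind t) (h : C.vertex s = C.vertex t) : s = t := by
  have h1 := C.lam_vertex hst
  rw [← h, C.lam_vertex rfl, if_pos rfl] at h1
  by_contra hne
  rw [if_neg hne] at h1
  exact one_ne_zero h1

lemma mem_factor_face {J : Finset S} (hJ : Transversal kind J) {c : Component P} {x : E} :
    x ∈ factor P c (C.face J) ↔ x ∈ Submodule.span ℝ (P.root '' c.supp) ∧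
      ∀ s, kind s = c → 0 ≤ C.lam s x ∧ (s ∉ J → C.lam s x = 0) := by
  constructor
  · rintro ⟨hx, y, hy, h⟩
    refine ⟨hx, fun s hs => ?_⟩
    rw [C.lam_congr (x := x) (y := y) fun i hi => h i (hi.trans hs)]
    exact hy s
  · rintro ⟨hx, h⟩
    -- Coordinates in different components are independent, so `x` is completed to a point of the
    -- face by those of an interior point.
    obtain ⟨z, hz⟩ := C.exists_interior hJ
    obtain ⟨y, hy⟩ := C.exists_point (fun s => if kind s = c then C.lam s x else C.lam s z)
      fun c' => by
        by_cases hc : c' = c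
        · rw [← C.sum_eq c' x]
          refine Finset.sum_congr rfl fun s hs => ?_
          rw [(Finset.mem_filter.1 hs).2, if_pos hc]
        · rw [← C.sum_eq c' z]
          refine Finset.sum_congr rfl fun s hs => ?_
          rw [(Finset.mem_filter.1 hs).2, if_neg hc]
    refine ⟨hx, y, fun s => ?_, fun i hi => C.ext_comp c x y (fun s hs => ?_) i hi⟩
    · rw [hy]
      split_ifs with hs
      · exact h s hs
      · refine ⟨?_, (hz s).2⟩
        by_cases hs' : s ∈ J
        · exact ((hz s).1 hs').le
        · exact ((hz s).2 hs').ge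
    · rw [hy, if_pos hs]

lemma vertex_mem_factor {J : Finset S} (hJ : Transversal kind J) {s : S} (hs : s ∈ J) :
    C.vertex s ∈ factor P (kind s) (C.face J) := by
  rw [C.mem_factor_face hJ]
  refine ⟨C.vertex_mem_span s, fun t ht => ?_⟩
  rw [C.lam_vertex ht]
  split_ifs with h
  · exact ⟨zero_le_one, fun h' => absurd (h ▸ hs) h'⟩
  · exact ⟨le_rfl, fun _ => rfl⟩

/-- A point with two positive coordinates `s`, `t` in the factor is the midpoint of a small segment
in the direction `vertex s - vertex t`, so extreme points have just one positive coordinate.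
Conversely, where a coordinate of a vertex vanishes, it vanishes on any segment through that vertex.
-/
lemma factorVertices_face {J : Finset S} (hJ : Transversal kind J) (c : Component P) :
    factorVertices P c (C.face J) = C.vertex '' {s | s ∈ J ∧ kind s = c} := by
  ext x
  unfold factorVertices
  rw [mem_extremePoints]
  constructor
  · rintro ⟨hx, hext⟩
    rw [C.mem_factor_face hJ] at hx
    obtain ⟨hxc, hx⟩ := hx
    obtain ⟨s, hs, hpos⟩ : ∃ s, kind s = c ∧ 0 < C.lam s x := by
      by_contra! h
      have h1 := C.sum_eq c x
      rw [Finset.sum_eq_zero fun s hs => le_antisymm (h s (by simpa using hs))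
        (hx s (by simpa using hs)).1] at h1
      exact zero_ne_one h1
    have hsJ : s ∈ J := by
      by_contra h
      exact hpos.ne' ((hx s hs).2 h)
    refine ⟨s, ⟨hsJ, hs⟩, ?_⟩
    subst hs
    refine (C.eq_vertex hxc fun t ht hts => ?_).symm
    by_contra h0
    have htpos : 0 < C.lam t x := lt_of_le_of_ne (hx t ht).1 (Ne.symm h0)
    have htJ : t ∈ J := by
      by_contra h
      exact h0 ((hx t ht).2 h)
    set ε := min (C.lam s x) (C.lam t x) with hε
    have hε0 : 0 < ε := lt_min hpos htpos
    have hmem : ∀ δ : ℝ, |δ| ≤ ε →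
        x + δ • (C.vertex s - C.vertex t) ∈ factor P (kind s) (C.face J) := by
      intro δ hδ
      rw [C.mem_factor_face hJ]
      have hδ' := abs_le.1 hδ
      refine ⟨add_mem hxc (Submodule.smul_mem _ _ (sub_mem (C.vertex_mem_span s)
        (ht ▸ C.vertex_mem_span t))), fun r hr => ?_⟩
      rw [C.lam_add_smul_sub, C.lam_vertex hr, C.lam_vertex (hr.trans ht.symm)]
      by_cases hrs : r = s
      · subst hrs
        rw [if_pos rfl, if_neg (Ne.symm hts)]
        exact ⟨by linarith [min_le_left (C.lam r x) (C.lam t x)], fun h => absurd hsJ h⟩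
      · by_cases hrt : r = t
        · subst hrt
          rw [if_neg hrs, if_pos rfl]
          exact ⟨by linarith [min_le_right (C.lam s x) (C.lam r x)], fun h => absurd htJ h⟩
        · rw [if_neg hrs, if_neg hrt]
          simpa using hx r hr
    have h1 := (hext _ (hmem ε (abs_of_pos hε0).le) _ (hmem (-ε) (by rw [abs_neg, abs_of_pos hε0]))
      ⟨1 / 2, 1 / 2, by norm_num, by norm_num, by norm_num, by module⟩).1
    have h2 := congrArg (C.lam s) h1
    rw [C.lam_add_smul_sub, C.lam_vertex rfl, C.lam_vertex ht.symm, if_pos rfl,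
      if_neg (Ne.symm hts)] at h2
    linarith
  · rintro ⟨s, ⟨hs, rfl⟩, rfl⟩
    refine ⟨C.vertex_mem_factor hJ hs, ?_⟩
    have key : ∀ y ∈ factor P (kind s) (C.face J), ∀ z ∈ factor P (kind s) (C.face J),
        C.vertex s ∈ openSegment ℝ y z → y = C.vertex s := by
      rintro y hy z hz ⟨a, d, ha, hd, had, h⟩
      rw [C.mem_factor_face hJ] at hy hz
      refine C.eq_vertex hy.1 fun t ht hts => ?_
      have h1 := C.lam_vertex ht
      have h2 : C.lam t (a • y + d • z) = a * C.lam t y + d * C.lam t z := by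
        have hd' : d = 1 - a := by linarith
        simp only [C.lam_eq, affineRoot, map_add, map_smul, smul_eq_mul, hd']
        ring
      rw [if_neg hts, ← h, h2] at h1
      nlinarith [mul_nonneg ha.le (hy.2 t ht).1, mul_nonneg hd.le (hz.2 t ht).1]
    exact fun y hy z hz h => ⟨key y hy z hz h, key z hz y hy (openSegment_symm ℝ y z ▸ h)⟩

/-- The coordinate `s` vanishes at all the other vertices of the factor, hence on their convex hull.
Conversely, when it vanishes at `y`, the remaining coordinates express the projection of `y` as a
convex combination of the other vertices. -/
lemma oppositeFace_face [DecidableEq S] {J : Finset S} (hJ : Transversal kind J) {s : S} :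
    oppositeFace P (kind s) (C.face J) (C.vertex s) = C.face (J.erase s) := by
  ext y
  unfold oppositeFace
  rw [C.factorVertices_face hJ]
  constructor
  · rintro ⟨hy, z, hz, h⟩
    have hz0 : C.lam s z = 0 := by
      have hconv : Convex ℝ {z | C.lam s z = 0} := by
        intro u hu v hv a d _ _ had
        have hd' : d = 1 - a := by linarith
        have : C.lam s (a • u + d • v) = a * C.lam s u + d * C.lam s v := by
          simp only [C.lam_eq, affineRoot, map_add, map_smul, smul_eq_mul, hd']
          ring
        change C.lam s _ = 0
        rw [this, hu, hv]
        simp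
      refine convexHull_min ?_ hconv hz
      rintro _ ⟨⟨t, ⟨ht, hts⟩, rfl⟩, hne⟩
      change C.lam s _ = 0
      rw [C.lam_vertex hts.symm, if_neg]
      rintro rfl
      exact hne rfl
    intro t
    refine ⟨(hy t).1, fun ht => ?_⟩
    by_cases hts : t = s
    · subst hts
      rw [← C.lam_congr (x := z) (y := y) fun i hi => h i hi, hz0]
    · exact (hy t).2 fun htJ => ht (Finset.mem_erase.2 ⟨hts, htJ⟩)
  · intro hy
    refine ⟨C.face_mono (Finset.erase_subset _ _) hy, ?_⟩
    set A := (J.erase s).filter fun t => kind t = kind s with hA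
    have hsum : ∀ f : S → ℝ, ∑ t ∈ A, C.lam t y * f t =
        ∑ t with kind t = kind s, C.lam t y * f t := by
      intro f
      refine Finset.sum_subset (fun t ht => ?_) fun t ht hA' => ?_
      · simpa using (Finset.mem_filter.1 ht).2
      · rw [(hy t).2, zero_mul]
        intro h
        exact hA' (Finset.mem_filter.2 ⟨h, by simpa using ht⟩)
    have hone : ∑ t ∈ A, C.lam t y = 1 := by
      have := hsum fun _ => 1
      simp only [mul_one] at this
      rw [this, C.sum_eq]
    refine ⟨∑ t ∈ A, C.lam t y • C.vertex t, ?_, fun i hi => C.ext_comp (kind s) _ _ ?_ i hi⟩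
    · refine (convex_convexHull ℝ _).sum_mem (fun t _ => (hy t).1) hone fun t ht => ?_
      apply subset_convexHull
      simp only [hA, Finset.mem_filter, Finset.mem_erase] at ht
      exact ⟨⟨t, ⟨ht.1.2, ht.2⟩, rfl⟩, fun h => ht.1.1 (C.vertex_injOn ht.2 h)⟩
    · intro r hr
      rw [C.lam_sum A _ hone, hsum, Finset.sum_eq_single r]
      · rw [C.lam_vertex rfl, if_pos rfl, mul_one]
      · intro t ht htr
        rw [C.lam_vertex (hr.trans (Finset.mem_filter.1 ht).2.symm), if_neg (Ne.symm htr), mul_zero]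
      · simp [hr]

/-! ### Dimensions of faces -/

lemma vectorSpan_face {J : Finset S} (hJ : Transversal kind J) {u : E} :
    u ∈ vectorSpan ℝ (C.face J) ↔ ∀ s ∉ J, P.coroot' (C.aff s).1 u = 0 := by
  constructor
  · intro hu s hs
    have : vectorSpan ℝ (C.face J) ≤ LinearMap.ker (P.coroot' (C.aff s).1) := by
      rw [vectorSpan_def, Submodule.span_le]
      rintro _ ⟨x, hx, y, hy, rfl⟩
      have h1 := (hx s).2 hs
      have h2 := (hy s).2 hs
      rw [C.lam_eq] at h1 h2
      have h3 := (mul_eq_zero.1 h1).resolve_left (C.scale_pos s).ne'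
      have h4 := (mul_eq_zero.1 h2).resolve_left (C.scale_pos s).ne'
      rw [affineRoot] at h3 h4
      simp only [vsub_eq_sub, SetLike.mem_coe, LinearMap.mem_ker, map_sub]
      linarith
    exact this hu
  · intro hu
    obtain ⟨x, hx⟩ := C.exists_interior hJ
    have h0 : ∀ s, 0 ≤ C.lam s x := by
      intro s
      by_cases hs : s ∈ J
      · exact ((hx s).1 hs).le
      · exact ((hx s).2 hs).ge
    have hmem : x ∈ C.face J := fun s => ⟨h0 s, (hx s).2⟩
    obtain ⟨ε, hε, hle⟩ := exists_pos_mul_abs_le (f := fun s => C.lam s x)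
      (g := fun s => C.scale s * P.coroot' (C.aff s).1 u) h0 (fun s hs => by
        rw [hu s, mul_zero]
        intro h
        exact ((hx s).1 h).ne' hs)
    have hmem' : x + ε • u ∈ C.face J := by
      intro s
      rw [C.lam_add_smul]
      constructor
      · have := hle s
        have h2 := neg_abs_le (C.scale s * P.coroot' (C.aff s).1 u)
        nlinarith
      · intro hs
        rw [hu s hs, (hx s).2 hs]
        ring
    have h1 := vsub_mem_vectorSpan ℝ hmem' hmem
    rw [vsub_eq_sub, add_sub_cancel_left] at h1
    exact (Submodule.smul_mem_iff _ hε.ne').1 h1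

/-- In barycentric coordinates the directions of the face are the families on `J` whose sum over
each component vanishes. As `J` meets every component, these are independent conditions, one for
each component. -/
lemma setDim_face [Finite ι] {J : Finset S} (hJ : Transversal kind J) :
    setDim (C.face J) + Nat.card (Component P) = J.card := by
  have hfin : Finite (Component P) := Quot.finite _
  have := Fintype.ofFinite (Component P)
  let V := vectorSpan ℝ (C.face J)
  let L : V →ₗ[ℝ] (J → ℝ) := LinearMap.pi fun s =>
    (C.scale s • P.coroot' (C.aff s).1) ∘ₗ V.subtype
  have hL : ∀ (u : V) (s : J), L u s = C.scale s * P.coroot' (C.aff s).1 u := fun u s => rfl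
  let M : (J → ℝ) →ₗ[ℝ] (Component P → ℝ) := LinearMap.pi fun c =>
    ∑ s ∈ (Finset.univ : Finset J).filter (fun s => kind s.1 = c), LinearMap.proj (R := ℝ) (φ := fun _ : J => ℝ) s
  have hM : ∀ t c, M t c = ∑ s ∈ (Finset.univ : Finset J).filter (fun s => kind s.1 = c), t s := by
    intro t c
    simp [M, LinearMap.pi_apply]
  have hLinj : Function.Injective L := by
    intro u v h
    apply Subtype.ext
    refine C.lam_ext fun s => ?_
    rw [C.lam_eq, C.lam_eq, affineRoot, affineRoot]
    congr 2
    by_cases hs : s ∈ J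
    · have := congrFun h ⟨s, hs⟩
      rw [hL, hL] at this
      exact mul_left_cancel₀ (C.scale_pos s).ne' this
    · rw [(C.vectorSpan_face hJ).1 u.2 s hs, (C.vectorSpan_face hJ).1 v.2 s hs]
  have hsumJ : ∀ (f : S → ℝ) (c : Component P), (∀ s ∉ J, f s = 0) →
      ∑ s ∈ (Finset.univ : Finset J).filter (fun s => kind s.1 = c), f s = ∑ s with kind s = c, f s := by
    intro f c hf
    rw [Finset.sum_filter, Finset.sum_filter,
      Finset.sum_coe_sort J (fun s => if kind s = c then f s else 0)]
    refine Finset.sum_subset (Finset.subset_univ _) fun s _ hs => ?_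
    rw [hf s hs]
    simp
  have hrange : LinearMap.range L = LinearMap.ker M := by
    ext t
    rw [LinearMap.mem_range, LinearMap.mem_ker]
    constructor
    · rintro ⟨u, rfl⟩
      funext c
      rw [hM, Pi.zero_apply]
      simp only [hL]
      rw [hsumJ (fun s => C.scale s * P.coroot' (C.aff s).1 u) c fun s hs => by
        rw [(C.vectorSpan_face hJ).1 u.2 s hs, mul_zero]]
      have h1 := C.sum_eq c (u : E)
      have h2 := C.sum_eq c 0
      rw [← h1, ← sub_eq_zero, ← Finset.sum_sub_distrib] at h2
      rw [← neg_eq_zero, ← h2, ← Finset.sum_neg_distrib]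
      refine Finset.sum_congr rfl fun s _ => ?_
      rw [C.lam_eq, C.lam_eq, affineRoot, affineRoot, map_zero]
      ring
    · intro ht
      set t' : S → ℝ := fun s => if h : s ∈ J then t ⟨s, h⟩ else 0 with ht'
      have h0 : ∀ s ∉ J, t' s = 0 := fun s hs => by simp [ht', hs]
      obtain ⟨u, hu⟩ := C.exists_point (fun s => C.lam s 0 + t' s) fun c => by
        rw [Finset.sum_add_distrib, C.sum_eq, ← hsumJ t' c h0]
        have h1 := congrFun ht c
        rw [hM, Pi.zero_apply] at h1
        rw [Finset.sum_congr rfl fun s _ => (by simp [ht'] : t' s.1 = t s), h1, add_zero]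
      have hu' : ∀ s, C.scale s * P.coroot' (C.aff s).1 u = t' s := by
        intro s
        have h1 := hu s
        rw [C.lam_eq, C.lam_eq, affineRoot, affineRoot, map_zero] at h1
        linarith
      refine ⟨⟨u, (C.vectorSpan_face hJ).2 fun s hs => ?_⟩, ?_⟩
      · have h1 := hu' s
        rw [h0 s hs] at h1
        exact (mul_eq_zero.1 h1).resolve_left (C.scale_pos s).ne'
      · funext s
        rw [hL, hu']
        simp [ht']
  have hsurj : LinearMap.range M = ⊤ := by
    rw [LinearMap.range_eq_top]
    intro g
    choose r hr hrk using hJ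
    refine ⟨fun s => if s = ⟨r (kind s), hr _⟩ then g (kind s) else 0, ?_⟩
    funext c
    rw [hM, Finset.sum_congr rfl (g := fun s : J => if s = ⟨r c, hr c⟩ then g c else 0)
      fun s hs => by rw [(Finset.mem_filter.1 hs).2]]
    rw [Finset.sum_ite_eq', if_pos]
    simp [hrk]
  have h1 := LinearMap.finrank_range_add_finrank_ker M
  rw [hsurj, finrank_top, Module.finrank_fintype_fun_eq_card, Module.finrank_fintype_fun_eq_card,
    Fintype.card_coe, ← hrange, LinearMap.finrank_range_of_inj hLinj] at h1
  rw [Nat.card_eq_fintype_card, ← h1, add_comm]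
  rfl

end Chart

end Charts

/-! ### The chart of the fundamental alcove and its translates -/

section StandardCharts
open scoped Classical

instance finite_component [Finite ι] (P : RootPairing ι ℝ E N) : Finite (Component P) :=
  Quot.finite _

instance fintype_component [Finite ι] (P : RootPairing ι ℝ E N) : Fintype (Component P) :=
  Fintype.ofFinite _

/-- Index set for the vertices of (the factors of) an alcove. -/
abbrev VertexIndex {P : RootPairing ι ℝ E N} (b : P.Base) : Type _ := b.support ⊕ Component P

/-- The component to which a vertex belongs. -/
def vertexKind {P : RootPairing ι ℝ E N} (b : P.Base) : VertexIndex b → Component P :=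
  Sum.elim (fun j => comp P j) id

variable {P : RootPairing ι ℝ E N} [Finite ι] [P.IsCrystallographic] [P.IsRootSystem]

namespace Chart

variable {S : Type*} [Fintype S] {kind : S → Component P} (C : Chart P S kind)

/-- Transport of barycentric coordinates by an element of the affine Weyl group. -/
def transport (w : P.weylGroup) (v : E) (hv : v ∈ P.rootSpan ℤ) : Chart P S kind :=
  have hu : -(w⁻¹ • v) ∈ P.rootSpan ℤ := neg_mem (smul_mem_rootSpan P _ hv)
  { lam := fun s x => C.lam s (w⁻¹ • x + -(w⁻¹ • v))
    aff := fun s => (exists_affineRoot_comp P w⁻¹ hu (C.aff s)).choose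
    scale := C.scale
    scale_pos := C.scale_pos
    lam_eq := fun s x => by
      rw [C.lam_eq, (exists_affineRoot_comp P w⁻¹ hu (C.aff s)).choose_spec.2]
    comp_aff := fun s => by
      rw [(exists_affineRoot_comp P w⁻¹ hu (C.aff s)).choose_spec.1, C.comp_aff]
    sum_eq := fun c x => C.sum_eq c _
    exists_point := fun t ht => by
      obtain ⟨x, hx⟩ := C.exists_point t ht
      refine ⟨w • x + v, fun s => ?_⟩
      rw [smul_add, inv_smul_smul, add_neg_cancel_right, hx]
    ext_comp := fun c x y h i hi => by
      obtain ⟨j, hj, hij⟩ := exists_index_smul P w i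
      have h1 := C.ext_comp c _ _ h j (hj.trans hi)
      have h2 : ∀ z, P.coroot' i z = P.coroot' j (w⁻¹ • z + -(w⁻¹ • v)) + P.coroot' i v := by
        intro z
        rw [← hij, smul_add, smul_neg, smul_inv_smul, smul_inv_smul, map_add, map_neg]
        ring
      rw [h2, h2 y, h1]
    sign := fun a => by
      obtain ⟨a', -, ha'⟩ := exists_affineRoot_comp P w hv a
      have h2 : ∀ z, affineRoot P a z = affineRoot P a' (w⁻¹ • z + -(w⁻¹ • v)) := by
        intro z
        rw [← ha', smul_add, smul_neg, smul_inv_smul, smul_inv_smul, neg_add_cancel_right]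
      rcases C.sign a' with h | h
      · exact Or.inl fun x hx => by rw [h2]; exact h _ hx
      · exact Or.inr fun x hx => by rw [h2]; exact h _ hx }

lemma transport_lam (w : P.weylGroup) {v : E} (hv : v ∈ P.rootSpan ℤ) (s : S) (x : E) :
    (C.transport w v hv).lam s (w • x + v) = C.lam s x := by
  change C.lam s (w⁻¹ • (w • x + v) + -(w⁻¹ • v)) = _
  rw [smul_add, inv_smul_smul, add_neg_cancel_right]

lemma transport_face (w : P.weylGroup) (J : Finset S) :
    (C.transport w 0 (zero_mem _)).face J = (fun y : E => w • y) '' C.face J := by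
  ext x
  have h : ∀ s, (C.transport w 0 (zero_mem _)).lam s x = C.lam s (w⁻¹ • x) := by
    intro s
    conv_lhs => rw [show x = w • (w⁻¹ • x) + 0 by rw [smul_inv_smul, add_zero]]
    rw [transport_lam]
  constructor
  · intro hx
    refine ⟨w⁻¹ • x, fun s => ?_, smul_inv_smul w x⟩
    rw [← h]
    exact hx s
  · rintro ⟨y, hy, rfl⟩ s
    rw [h, inv_smul_smul]
    exact hy s

/-- A vertex lives in a single factor, so the translation to use is the component of `v` in that
factor, which is again in the root lattice. -/
lemma affineConj_transport_vertex (w : P.weylGroup) {v : E} (hv : v ∈ P.rootSpan ℤ) (s : S) :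
    AffineConj P (C.vertex s) ((C.transport w v hv).vertex s) := by
  obtain ⟨u, hu, hus, hui⟩ := exists_component_proj_int P (kind s) hv
  refine ⟨w, u, hu, ?_⟩
  symm
  apply eq_vertex
  · refine add_mem ?_ hus
    rw [mem_span_component_iff]
    intro i hi
    obtain ⟨j, hj, hij⟩ := exists_index_smul P w i
    rw [hij]
    exact coroot'_eq_zero_of_mem_span P (C.vertex_mem_span s) (by rwa [hj])
  · intro t ht hts
    have : (C.transport w v hv).lam t (w • C.vertex s + u) =
        (C.transport w v hv).lam t (w • C.vertex s + v) :=
      lam_congr _ fun i hi => by rw [map_add, map_add, hui, if_pos (hi.trans ht)]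
    rw [this, transport_lam, C.lam_vertex ht, if_neg hts]

end Chart

variable [P.IsReduced] (b : P.Base)

/-- The barycentric coordinates on the closure of the fundamental alcove. -/
def baseLam : VertexIndex b → E → ℝ
  | Sum.inl j, x => coef b (highest b (comp P j)) j * P.coroot' j x
  | Sum.inr c, x => 1 - P.coroot' (highest b c) x

lemma coef_highest_pos (j : b.support) : 0 < coef b (highest b (comp P j)) j :=
  (isMaximalCoroot_highest _).coef_pos j.2 (comp_highest _).symm

lemma baseLam_nonneg_iff (x : E) : (∀ s, 0 ≤ baseLam b s x) ↔ x ∈ closedAlcove b := by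
  constructor
  · intro h
    refine ⟨fun i hi => ?_, fun i hi => ?_⟩
    · have h1 := h (Sum.inl ⟨i, hi⟩)
      have h2 : (0 : ℝ) < coef b (highest b (comp P i)) i := by
        exact_mod_cast coef_highest_pos b ⟨i, hi⟩
      exact nonneg_of_mul_nonneg_right h1 h2
    · have h1 := h (Sum.inr (comp P i))
      rw [baseLam, ← hi.eq_highest] at h1
      linarith
  · rintro ⟨h1, h2⟩ (j | c)
    · exact mul_nonneg (by exact_mod_cast (coef_highest_pos b j).le) (h1 j j.2)
    · have := h2 _ (isMaximalCoroot_highest (b := b) c)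
      rw [baseLam]
      linarith

lemma sum_vertexKind (c : Component P) (f : VertexIndex b → ℝ) :
    ∑ s with vertexKind b s = c, f s =
      (∑ j : b.support, if comp P j = c then f (Sum.inl j) else 0) + f (Sum.inr c) := by
  rw [Finset.sum_filter, Fintype.sum_sum_type]
  congr 1
  exact (Finset.sum_congr rfl fun d _ => rfl).trans
    ((Finset.sum_eq_single c (fun d _ hd => if_neg hd) (by simp)).trans (if_pos rfl))

lemma coroot'_highest (c : Component P) (x : E) :
    P.coroot' (highest b c) x = ∑ j : b.support, if comp P j = c then
      (coef b (highest b (comp P j)) j : ℝ) * P.coroot' j x else 0 := by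
  rw [coroot'_eq_sum b, ← Finset.sum_coe_sort]
  refine Finset.sum_congr rfl fun j _ => ?_
  split_ifs with h
  · rw [h]
  · have : coef b (highest b c) j = 0 := by
      by_contra h0
      exact h ((comp_eq_of_coef_ne_zero b h0).trans (comp_highest c))
    rw [this]
    simp

/-- The chart of the fundamental alcove. -/
def baseChart : Chart P (VertexIndex b) (vertexKind b) where
  lam := baseLam b
  aff := fun
    | Sum.inl j => (j, 0)
    | Sum.inr c => (opp P (highest b c), 1)
  scale := fun
    | Sum.inl j => coef b (highest b (comp P j)) j
    | Sum.inr _ => 1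
  scale_pos := by
    rintro (j | c)
    · change (0 : ℝ) < coef b (highest b (comp P j)) j
      exact_mod_cast coef_highest_pos b j
    · exact one_pos (α := ℝ)
  lam_eq := by
    rintro (j | c) x
    · simp [baseLam, affineRoot]
    · simp only [baseLam, affineRoot, coroot'_opp, Int.cast_one]
      ring
  comp_aff := by
    rintro (j | c)
    · rfl
    · change comp P (opp P (highest b c)) = c
      rw [comp_opp, comp_highest]
  sum_eq := fun c x => by
    rw [sum_vertexKind]
    simp only [baseLam]
    rw [coroot'_highest b c x]
    ring
  exists_point := fun t ht => by
    obtain ⟨x, hx⟩ := exists_coroot'_eq b fun i => if h : i ∈ b.support then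
      t (Sum.inl ⟨i, h⟩) / coef b (highest b (comp P i)) i else 0
    have h1 : ∀ j : b.support, (coef b (highest b (comp P j)) j : ℝ) * P.coroot' j x =
        t (Sum.inl j) := by
      intro j
      have h2 : (coef b (highest b (comp P j)) j : ℝ) ≠ 0 := by
        exact_mod_cast (coef_highest_pos b j).ne'
      rw [hx j j.2, dif_pos j.2]
      field_simp
    refine ⟨x, ?_⟩
    rintro (j | c)
    · exact h1 j
    · have h3 := ht c
      rw [sum_vertexKind] at h3
      change 1 - P.coroot' (highest b c) x = _
      rw [coroot'_highest]
      simp only [h1]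
      linarith
  ext_comp := fun c x y h i hi => by
    rw [coroot'_eq_sum b i, coroot'_eq_sum b i]
    refine Finset.sum_congr rfl fun j hj => ?_
    by_cases h0 : coef b i j = 0
    · rw [h0]
      simp
    · have h1 := h (Sum.inl ⟨j, hj⟩) ((comp_eq_of_coef_ne_zero b h0).trans hi)
      have h2 : (coef b (highest b (comp P j)) j : ℝ) ≠ 0 := by
        exact_mod_cast (coef_highest_pos b ⟨j, hj⟩).ne'
      rw [mul_left_cancel₀ h2 h1]
  sign := fun a => by
    obtain ⟨p, hp⟩ := exists_mem_alcove b
    simp only [baseLam_nonneg_iff, ← closedFacet_eq_closedAlcove hp]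
    rcases le_total 0 (affineRoot P a p) with h | h
    · exact Or.inl fun x hx => hx a h
    · refine Or.inr fun x hx => ?_
      have := hx (opp P a.1, -a.2)
      rw [affineRoot_neg_index P, affineRoot_neg_index P] at this
      linarith [this (by linarith)]

lemma baseChart_vertex_mem (s : VertexIndex b) : (baseChart b).vertex s ∈ closedAlcove b := by
  rw [← baseLam_nonneg_iff]
  intro t
  change 0 ≤ (baseChart b).lam t _
  by_cases h : vertexKind b t = vertexKind b s
  · rw [(baseChart b).lam_vertex h]
    split_ifs <;> norm_num
  · rw [(baseChart b).lam_congr (y := 0) fun i hi => by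
      rw [map_zero]
      exact coroot'_eq_zero_of_mem_span P ((baseChart b).vertex_mem_span s) (by rwa [hi])]
    exact (baseLam_nonneg_iff b 0).2 (zero_mem_closedAlcove b) t

lemma closedAlcove_eq_face : closedAlcove b = (baseChart b).face Finset.univ := by
  ext x
  rw [← baseLam_nonneg_iff]
  exact forall_congr' fun s => by simp [baseChart]

lemma transversal_univ : Transversal (vertexKind b) Finset.univ :=
  fun c => ⟨Sum.inr c, Finset.mem_univ _, rfl⟩

variable {b} in
/-- A chart whose vertices are matched with those of the fundamental alcove by the affine Weyl
group. -/
def Chart.IsStandard (C : Chart P (VertexIndex b) (vertexKind b)) : Prop :=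
  ∀ s, fold b (C.vertex s) = (baseChart b).vertex s

lemma baseChart_isStandard : (baseChart b).IsStandard := fun s =>
  fold_eq_of_mem (baseChart_vertex_mem b s) ⟨1, 0, zero_mem _, by rw [one_smul, add_zero]⟩

variable {b}

lemma Chart.IsStandard.transport {C : Chart P (VertexIndex b) (vertexKind b)} (h : C.IsStandard)
    (w : P.weylGroup) {v : E} (hv : v ∈ P.rootSpan ℤ) : (C.transport w v hv).IsStandard :=
  fun s => by rw [← h s, fold_eq_of_affineConj (C.affineConj_transport_vertex w hv s)]

variable (b) in
lemma exists_standard_chart (x : E) :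
    ∃ C : Chart P (VertexIndex b) (vertexKind b), C.IsStandard ∧ ∀ s, 0 ≤ C.lam s x := by
  obtain ⟨y, hy, w, v, hv, rfl⟩ := exists_affineConj_mem_closedAlcove b x
  refine ⟨_, (baseChart_isStandard b).transport w hv, fun s => ?_⟩
  rw [Chart.transport_lam]
  exact (baseLam_nonneg_iff b y).2 hy s

variable (b) in
lemma exists_standard_face {σ : Set E} (hσ : σ ∈ polysimplices P) :
    ∃ C : Chart P (VertexIndex b) (vertexKind b), C.IsStandard ∧
      ∃ J, Transversal (vertexKind b) J ∧ σ = C.face J := by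
  obtain ⟨x, rfl⟩ := hσ
  obtain ⟨C, hC, hx⟩ := exists_standard_chart b x
  obtain ⟨J, hJ, h⟩ := C.exists_face_of_mem hx
  exact ⟨C, hC, J, hJ, h⟩

end StandardCharts

/-! ### The oriented complex of a simplex with prescribed signs -/

section Combinatorial

variable {S K : Type*} [DecidableEq S] [LinearOrder K] (key : S → K) (η : S → ℤˣ)

/-- The sign with which `J.erase s` occurs in the boundary of `J`. -/
def faceSign (J : Finset S) (s : S) : ℤˣ := η s * (-1) ^ (J.filter fun t => key t < key s).card

lemma faceSign_insert {J : Finset S} {s : S} (hs : s ∉ J) (t : S) :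
    faceSign key η (insert s J) t = (if key s < key t then -1 else 1) * faceSign key η J t := by
  unfold faceSign
  rw [Finset.filter_insert]
  split_ifs with h
  · rw [Finset.card_insert_of_notMem (by simp [hs]), pow_succ]
    simp
  · rw [one_mul]

lemma faceSign_erase {J : Finset S} {s : S} (hs : s ∈ J) (t : S) :
    faceSign key η (J.erase s) t = (if key s < key t then -1 else 1) * faceSign key η J t := by
  have h := faceSign_insert key η (Finset.notMem_erase s J) t
  rw [Finset.insert_erase hs] at h
  rw [h, ← mul_assoc]
  split_ifs <;> simp

/-- A sign, as a complex number. -/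
abbrev signC (u : ℤˣ) : ℂ := ((u : ℤ) : ℂ)

lemma signC_mul (u v : ℤˣ) : signC (u * v) = signC u * signC v := by simp [signC]

lemma signC_mul_self (u : ℤˣ) : signC u * signC u = 1 := by
  rw [← signC_mul, Int.units_mul_self]
  simp [signC]

lemma signC_neg (u : ℤˣ) : signC (-u) = -signC u := by simp [signC]

lemma norm_signC (u : ℤˣ) : ‖signC u‖ = 1 := by
  rcases Int.units_eq_one_or u with rfl | rfl <;> simp [signC]

/-- The boundary map of the oriented complex of all finite subsets. -/
def simplexBoundary : (Finset S →₀ ℂ) →ₗ[ℂ] (Finset S →₀ ℂ) :=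
  Finsupp.linearCombination ℂ fun J =>
    ∑ s ∈ J, Finsupp.single (J.erase s) (signC (faceSign key η J s))

lemma simplexBoundary_single (J : Finset S) :
    simplexBoundary key η (Finsupp.single J 1) =
      ∑ s ∈ J, signC (faceSign key η J s) • Finsupp.single (J.erase s) (1 : ℂ) := by
  simp [simplexBoundary]

variable {key} in
-- Of two removed vertices, only the position of the later one is shifted by the removal of the
-- other.
lemma faceSign_swap (hkey : Function.Injective key) {J : Finset S} {s t : S} (hs : s ∈ J)
    (ht : t ∈ J) (hst : s ≠ t) : faceSign key η J s * faceSign key η (J.erase s) t =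
      -(faceSign key η J t * faceSign key η (J.erase t) s) := by
  rw [faceSign_erase key η hs, faceSign_erase key η ht]
  rcases lt_or_gt_of_ne (hkey.ne hst) with h | h
  · rw [if_pos h, if_neg h.not_gt]
    simp [mul_comm]
  · rw [if_pos h, if_neg h.not_gt]
    simp [mul_comm]

variable {key} in
lemma simplexBoundary_simplexBoundary (hkey : Function.Injective key) (x : Finset S →₀ ℂ) :
    simplexBoundary key η (simplexBoundary key η x) = 0 := by
  suffices h : simplexBoundary key η ∘ₗ simplexBoundary key η = 0 from LinearMap.congr_fun h x
  ext1 J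
  ext1
  simp only [LinearMap.comp_apply, Finsupp.lsingle_apply, LinearMap.zero_apply]
  rw [simplexBoundary_single, map_sum]
  simp only [map_smul, simplexBoundary_single, Finset.smul_sum, smul_smul]
  rw [Finset.sum_sigma']
  refine Finset.sum_involution (fun a _ => ⟨a.2, a.1⟩) ?_ ?_ ?_ ?_
  · rintro ⟨s, t⟩ h
    simp only [Finset.mem_sigma, Finset.mem_erase] at h
    dsimp only
    rw [Finset.erase_right_comm, ← add_smul, ← signC_mul, ← signC_mul,
      faceSign_swap η hkey h.1 h.2.2 (Ne.symm h.2.1), signC_neg, neg_add_cancel, zero_smul]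
  · rintro ⟨s, t⟩ h _ heq
    simp only [Finset.mem_sigma, Finset.mem_erase] at h
    simp only [Sigma.mk.injEq, heq_eq_eq] at heq
    exact h.2.1 heq.1
  · rintro ⟨s, t⟩ h
    simp only [Finset.mem_sigma, Finset.mem_erase] at h ⊢
    exact ⟨h.2.2, Ne.symm h.2.1, h.1⟩
  · rintro ⟨s, t⟩ h
    rfl

/-- The contraction of the oriented complex that joins a set with the point `s`. -/
def simplexCone (s : S) : (Finset S →₀ ℂ) →ₗ[ℂ] (Finset S →₀ ℂ) :=
  Finsupp.linearCombination ℂ fun J =>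
    if s ∈ J then 0 else Finsupp.single (insert s J) (signC (faceSign key η J s))

lemma simplexCone_single (s : S) (J : Finset S) :
    simplexCone key η s (Finsupp.single J 1) = if s ∈ J then 0 else
      signC (faceSign key η J s) • Finsupp.single (insert s J) (1 : ℂ) := by
  simp [simplexCone]

variable {key} in
-- The empty set belongs to this complex, so there is no correction term in the lowest degree.
lemma simplexBoundary_simplexCone (hkey : Function.Injective key) (s : S) (x : Finset S →₀ ℂ) :
    simplexBoundary key η (simplexCone key η s x) + simplexCone key η s (simplexBoundary key η x)
      = x := by
  suffices h : simplexBoundary key η ∘ₗ simplexCone key η s +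
      simplexCone key η s ∘ₗ simplexBoundary key η = LinearMap.id from LinearMap.congr_fun h x
  ext1 J
  ext1
  simp only [LinearMap.comp_apply, LinearMap.add_apply, Finsupp.lsingle_apply, LinearMap.id_apply]
  rw [simplexBoundary_single, map_sum, simplexCone_single]
  simp only [map_smul, simplexCone_single]
  split_ifs with h
  · rw [map_zero, zero_add, Finset.sum_eq_single_of_mem s h]
    · rw [if_neg (Finset.notMem_erase _ _), Finset.insert_erase h, smul_smul, ← signC_mul,
        faceSign_erase key η h, if_neg (lt_irrefl _), one_mul, signC_mul, signC_mul_self, one_smul]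
    · intro t _ hts
      rw [if_pos (Finset.mem_erase.2 ⟨Ne.symm hts, h⟩), smul_zero]
  · rw [map_smul, simplexBoundary_single, Finset.sum_insert h, Finset.erase_insert h, smul_add,
      smul_smul, faceSign_insert key η h, if_neg (lt_irrefl _), one_mul, signC_mul_self, one_smul,
      add_assoc, Finset.smul_sum, ← Finset.sum_add_distrib, Finset.sum_eq_zero, add_zero]
    intro t ht
    have hst : s ≠ t := fun e => h (e ▸ ht)
    rw [if_neg fun h' => h (Finset.mem_of_mem_erase h'), Finset.erase_insert_of_ne hst, smul_smul,
      smul_smul, ← add_smul, ← signC_mul, ← signC_mul, faceSign_insert key η h,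
      faceSign_erase key η ht]
    rcases lt_or_gt_of_ne (hkey.ne hst) with h1 | h1
    · rw [if_pos h1, if_neg h1.not_gt, mul_left_comm, neg_one_mul, signC_neg, one_mul,
        mul_comm (faceSign key η J t), neg_add_cancel, zero_smul]
    · rw [if_pos h1, if_neg h1.not_gt, mul_left_comm (faceSign key η J t), neg_one_mul, signC_neg,
        one_mul, mul_comm (faceSign key η J t), add_neg_cancel, zero_smul]

end Combinatorial

/-! ### The boundary maps in a standard chart -/

section ChartBoundary
open scoped Classical

/-- The basis element of `C_n(Σ)` given by a subset of `E` (zero unless the subset is an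
`n`-dimensional polysimplex). -/
def cellChain (P : RootPairing ι ℝ E N) (n : ℕ) (σ : Set E) : Chain P n :=
  if h : σ ∈ polysimplices P ∧ setDim σ = n then Finsupp.single ⟨σ, h⟩ 1 else 0

lemma cellChain_cell {P : RootPairing ι ℝ E N} {n : ℕ} (σ : Cell P n) :
    cellChain P n σ.1 = Finsupp.single σ 1 := dif_pos σ.2

lemma cellChain_apply {P : RootPairing ι ℝ E N} {n : ℕ} (σ : Set E) (τ : Cell P n) :
    cellChain P n σ τ = if σ = τ.1 then 1 else 0 := by
  by_cases h : σ = τ.1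
  · rw [if_pos h, h, cellChain_cell, Finsupp.single_eq_same]
  · rw [if_neg h]
    by_cases h' : σ ∈ polysimplices P ∧ setDim σ = n
    · obtain ⟨ρ, rfl⟩ : ∃ ρ : Cell P n, ρ.1 = σ := ⟨⟨σ, h'⟩, rfl⟩
      rw [cellChain_cell, Finsupp.single_eq_of_ne]
      rintro rfl
      exact h rfl
    · rw [cellChain, dif_neg h', Finsupp.zero_apply]

variable {P : RootPairing ι ℝ E N} {b : P.Base} (o : AlcoveOrientation b)

lemma cellBoundary_eq (n : ℕ) (σ : Cell P (n + 1)) : cellBoundary o n σ =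
    ∑ j : Fin o.numComponents, ∑ᶠ x ∈ factorVertices P (o.component j) σ.1,
      signC (incidence o σ.1 j x) • cellChain P n (oppositeFace P (o.component j) σ.1 x) := by
  refine Finset.sum_congr rfl fun j _ => finsum_congr fun x => finsum_congr fun _ => ?_
  unfold cellChain
  by_cases h : oppositeFace P (o.component j) σ.1 x ∈ polysimplices P ∧
      setDim (oppositeFace P (o.component j) σ.1 x) = n
  · rw [dif_pos h, dif_pos h]
    exact (Finsupp.smul_single_one _ _).symm
  · rw [dif_neg h, dif_neg h, smul_zero]

lemma boundary_cell (n : ℕ) (σ : Cell P (n + 1)) :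
    boundary o n (cellChain P (n + 1) σ.1) = cellBoundary o n σ := by
  rw [cellChain_cell, boundary, Finsupp.linearCombination_single, one_smul]

variable [Finite ι] [P.IsCrystallographic] [P.IsRootSystem] [P.IsReduced]

/-- The position of a vertex of the fundamental alcove in the order given by the orientation. -/
def vertexKey (s : VertexIndex b) : Fin o.numComponents ×ₗ ℕ :=
  toLex (o.component.symm (vertexKind b s), o.vertexNumber ((baseChart b).vertex s))

lemma vertexKey_injective : Function.Injective (vertexKey o) := by
  intro s t h
  have h' := toLex.injective h
  rw [Prod.mk.injEq] at h'
  have hk : vertexKind b s = vertexKind b t := o.component.symm.injective h'.1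
  refine (baseChart b).vertex_injOn hk ?_
  have key : ∀ r, vertexKind b r = vertexKind b s → (baseChart b).vertex r ∈
      factorVertices P (o.component (o.component.symm (vertexKind b s))) (closedAlcove b) := by
    intro r hr
    rw [closedAlcove_eq_face, (baseChart b).factorVertices_face (transversal_univ b)]
    exact ⟨r, ⟨Finset.mem_univ _, by rw [hr, Equiv.apply_symm_apply]⟩, rfl⟩
  exact o.injOn _ (key s rfl) (key t hk.symm) h'.2

/-- The sign that comes from the dimensions of the preceding factors. -/
def kindSign (s : VertexIndex b) : ℤˣ :=
  (-1) ^ (Finset.univ.filter (· < o.component.symm (vertexKind b s))).card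

/-- The boundary map on the subsets of the set of vertices. -/
abbrev indexBoundary : (Finset (VertexIndex b) →₀ ℂ) →ₗ[ℂ] (Finset (VertexIndex b) →₀ ℂ) :=
  simplexBoundary (vertexKey o) (kindSign o)

/-- The sign of a set of vertices in the boundary of a larger one. -/
abbrev indexSign (J : Finset (VertexIndex b)) (s : VertexIndex b) : ℤˣ :=
  faceSign (vertexKey o) (kindSign o) J s

namespace Chart

variable {C : Chart P (VertexIndex b) (vertexKind b)}

lemma IsStandard.vertexPosition_face (hC : C.IsStandard) {J : Finset (VertexIndex b)}
    (hJ : Transversal (vertexKind b) J) (s : VertexIndex b) :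
    vertexPosition o (C.face J) (o.component.symm (vertexKind b s)) (C.vertex s) =
      (J.filter fun t => vertexKind b t = vertexKind b s ∧
        o.vertexNumber ((baseChart b).vertex t) < o.vertexNumber ((baseChart b).vertex s)).card := by
  rw [vertexPosition, C.factorVertices_face hJ, Equiv.apply_symm_apply, hC s]
  rw [← Set.ncard_coe_finset]
  refine Eq.trans ?_ (Set.InjOn.ncard_image (f := C.vertex) ?_)
  · congr 1
    ext x
    simp only [Set.mem_ofPred_eq, Set.mem_image, Finset.coe_filter]
    constructor
    · rintro ⟨⟨t, ⟨ht, hts⟩, rfl⟩, h⟩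
      rw [hC t] at h
      exact ⟨t, ⟨ht, hts, h⟩, rfl⟩
    · rintro ⟨t, ⟨ht, hts, h⟩, rfl⟩
      refine ⟨⟨t, ⟨ht, hts⟩, rfl⟩, ?_⟩
      rwa [hC t]
  · intro t ht u hu h
    simp only [Finset.coe_filter, Set.mem_ofPred_eq] at ht hu
    exact C.vertex_injOn (ht.2.1.trans hu.2.1.symm) h

lemma factorDim_face (C : Chart P (VertexIndex b) (vertexKind b)) {J : Finset (VertexIndex b)}
    (hJ : Transversal (vertexKind b) J) (j : Fin o.numComponents) :
    factorDim o (C.face J) j + 1 =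
      (J.filter fun t => o.component.symm (vertexKind b t) = j).card := by
  have h : (J.filter fun t => o.component.symm (vertexKind b t) = j).card ≠ 0 := by
    obtain ⟨s, hs, h⟩ := hJ (o.component j)
    exact Finset.card_ne_zero_of_mem (Finset.mem_filter.2 ⟨hs, by rw [h, Equiv.symm_apply_apply]⟩)
  rw [factorDim, C.factorVertices_face hJ, Set.InjOn.ncard_image]
  · have : {s | s ∈ J ∧ vertexKind b s = o.component j} =
        ((J.filter fun t => o.component.symm (vertexKind b t) = j : Finset _) : Set _) := by
      ext t
      simp [Equiv.symm_apply_eq]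
    rw [this, Set.ncard_coe_finset]
    omega
  · intro t ht u hu h
    exact C.vertex_injOn (ht.2.trans hu.2.symm) h

lemma card_filter_vertexKey (J : Finset (VertexIndex b)) (s : VertexIndex b) :
    (J.filter fun t => vertexKey o t < vertexKey o s).card =
      (∑ j with j < o.component.symm (vertexKind b s),
        (J.filter fun t => o.component.symm (vertexKind b t) = j).card) +
      (J.filter fun t => vertexKind b t = vertexKind b s ∧
        o.vertexNumber ((baseChart b).vertex t) < o.vertexNumber ((baseChart b).vertex s)).card := by
  have h1 : (J.filter fun t => vertexKey o t < vertexKey o s) =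
      (J.filter fun t => o.component.symm (vertexKind b t) < o.component.symm (vertexKind b s)) ∪
      (J.filter fun t => vertexKind b t = vertexKind b s ∧
        o.vertexNumber ((baseChart b).vertex t) < o.vertexNumber ((baseChart b).vertex s)) := by
    rw [← Finset.filter_or]
    refine Finset.filter_congr fun t _ => ?_
    simp only [vertexKey, Prod.Lex.toLex_lt_toLex, EmbeddingLike.apply_eq_iff_eq]
  rw [h1, Finset.card_union_of_disjoint]
  · congr 1
    rw [Finset.card_eq_sum_card_fiberwise (f := fun t => o.component.symm (vertexKind b t))
      (t := Finset.univ.filter (· < o.component.symm (vertexKind b s)))]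
    · refine Finset.sum_congr rfl fun j hj => ?_
      rw [Finset.filter_filter]
      congr 1
      refine Finset.filter_congr fun t _ => ?_
      have := (Finset.mem_filter.1 hj).2
      constructor
      · exact fun h => h.2
      · rintro rfl
        exact ⟨this, rfl⟩
    · intro t ht
      simp only [Finset.coe_filter, Set.mem_ofPred_eq, Finset.mem_univ, true_and] at ht ⊢
      exact ht.2
  · rw [Finset.disjoint_filter]
    rintro t _ h ⟨h', -⟩
    rw [h'] at h
    exact lt_irrefl _ h

/-- The number of vertices preceding `s` in `J` counts `d_i + 1` for each earlier factor, while the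
boundary formula uses `d_i`. The sign `kindSign` compensates for the number of earlier factors. -/
lemma IsStandard.incidence_face (hC : C.IsStandard) {J : Finset (VertexIndex b)}
    (hJ : Transversal (vertexKind b) J) (s : VertexIndex b) :
    incidence o (C.face J) (o.component.symm (vertexKind b s)) (C.vertex s) =
      cellSign o (C.face J) * cellSign o (C.face (J.erase s)) * indexSign o J s := by
  rw [incidence, hC.vertexPosition_face o hJ, Equiv.apply_symm_apply, C.oppositeFace_face hJ,
    mul_assoc, indexSign, faceSign, card_filter_vertexKey, kindSign, pow_add]
  rw [← mul_assoc, ← mul_assoc, ← mul_assoc]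
  congr 1
  rw [mul_assoc (cellSign o (C.face J) * cellSign o (C.face (J.erase s)))]
  congr 1
  simp only [← C.factorDim_face o hJ]
  rw [Finset.sum_add_distrib, pow_add, Finset.sum_const, smul_eq_mul, mul_one]
  rw [mul_left_comm, Int.units_mul_self, mul_one]

/-- The chain given by the faces of a polysimplex, with their chosen orientations corrected to the
reference ones. -/
def faceChain (C : Chart P (VertexIndex b) (vertexKind b)) (n : ℕ) :
    (Finset (VertexIndex b) →₀ ℂ) →ₗ[ℂ] Chain P n :=
  Finsupp.linearCombination ℂ fun J => signC (cellSign o (C.face J)) • cellChain P n (C.face J)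

lemma faceChain_single (C : Chart P (VertexIndex b) (vertexKind b)) (n : ℕ)
    (J : Finset (VertexIndex b)) : C.faceChain o n (Finsupp.single J 1) =
      signC (cellSign o (C.face J)) • cellChain P n (C.face J) := by
  simp [faceChain]

/-- Thus `faceChain` kills the sets that miss a factor, and degrees are shifted by the number of
components. -/
lemma cellChain_face_eq_zero (C : Chart P (VertexIndex b) (vertexKind b)) {n : ℕ}
    {J : Finset (VertexIndex b)}
    (h : ¬(Transversal (vertexKind b) J ∧ J.card = n + Nat.card (Component P))) :
    cellChain P n (C.face J) = 0 := by
  refine dif_neg fun h' => h ?_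
  have hJ := C.transversal_of_face_mem_polysimplices h'.1
  exact ⟨hJ, by rw [← C.setDim_face hJ, h'.2]⟩

lemma cellBoundary_face (C : Chart P (VertexIndex b) (vertexKind b)) {n : ℕ} {J : Finset (VertexIndex b)}
    (hJ : Transversal (vertexKind b) J) (h : C.face J ∈ polysimplices P ∧
      setDim (C.face J) = n + 1) :
    cellBoundary o n ⟨C.face J, h⟩ =
      ∑ s ∈ J, signC (incidence o (C.face J) (o.component.symm (vertexKind b s)) (C.vertex s)) •
        cellChain P n (C.face (J.erase s)) := by
  refine (cellBoundary_eq o n _).trans ?_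
  dsimp only
  rw [← Finset.sum_fiberwise J (fun s => o.component.symm (vertexKind b s))]
  refine Finset.sum_congr rfl fun j _ => ?_
  have h1 : factorVertices P (o.component j) (C.face J) =
      C.vertex '' ((J.filter fun s => o.component.symm (vertexKind b s) = j : Finset _) : Set _) := by
    rw [C.factorVertices_face hJ]
    congr 1
    ext t
    simp [Equiv.symm_apply_eq]
  rw [h1, finsum_mem_image, finsum_mem_coe_finset]
  · refine Finset.sum_congr rfl fun s hs => ?_
    obtain rfl := (Finset.mem_filter.1 hs).2
    rw [Equiv.apply_symm_apply, C.oppositeFace_face hJ]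
  · intro t ht u hu h
    simp only [Finset.coe_filter, Set.mem_ofPred_eq] at ht hu
    exact C.vertex_injOn (o.component.symm.injective (ht.2.trans hu.2.symm)) h

/-- This reduces the polysimplicial boundary to that of an ordinary simplex on all the vertices of
an alcove. -/
lemma IsStandard.boundary_faceChain (hC : C.IsStandard) (n : ℕ)
    (x : Finset (VertexIndex b) →₀ ℂ) :
    boundary o n (C.faceChain o (n + 1) x) = C.faceChain o n (indexBoundary o x) := by
  suffices h : boundary o n ∘ₗ C.faceChain o (n + 1) = C.faceChain o n ∘ₗ indexBoundary o from
    LinearMap.congr_fun h x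
  ext1 J
  ext1
  simp only [LinearMap.comp_apply, Finsupp.lsingle_apply]
  rw [simplexBoundary_single, map_sum, faceChain_single]
  simp only [map_smul, faceChain_single]
  by_cases h : C.face J ∈ polysimplices P ∧ setDim (C.face J) = n + 1
  · have hJ := C.transversal_of_face_mem_polysimplices h.1
    rw [boundary_cell o n ⟨C.face J, h⟩, C.cellBoundary_face o hJ, Finset.smul_sum]
    refine Finset.sum_congr rfl fun s hs => ?_
    rw [hC.incidence_face o hJ s, smul_smul, smul_smul, ← signC_mul, ← signC_mul, ← mul_assoc,
      ← mul_assoc, Int.units_mul_self, one_mul, mul_comm]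
  -- When `J` does not index an `(n + 1)`-cell, no `J.erase s` indexes an `n`-cell, since a set
  -- containing a transversal one is transversal.
  · rw [cellChain, dif_neg h, map_zero, smul_zero, Finset.sum_eq_zero]
    intro s hs
    rw [C.cellChain_face_eq_zero, smul_zero, smul_zero]
    rintro ⟨hJ, hc⟩
    have hJ' : Transversal (vertexKind b) J := fun c => by
      obtain ⟨t, ht, h'⟩ := hJ c
      exact ⟨t, Finset.mem_of_mem_erase ht, h'⟩
    have h1 := C.setDim_face hJ'
    have h2 := Finset.card_erase_add_one hs
    exact h ⟨C.face_mem_polysimplices hJ', by omega⟩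

end Chart

variable (b) in
lemma exists_faceChain_eq {n : ℕ} (σ : Cell P n) :
    ∃ C : Chart P (VertexIndex b) (vertexKind b), C.IsStandard ∧ ∃ J,
      Transversal (vertexKind b) J ∧ J.card = n + Nat.card (Component P) ∧ σ.1 = C.face J ∧
      Finsupp.single σ 1 = C.faceChain o n (signC (cellSign o σ.1) • Finsupp.single J 1) := by
  obtain ⟨C, hC, J, hJ, h⟩ := exists_standard_face b σ.2.1
  refine ⟨C, hC, J, hJ, ?_, h, ?_⟩
  · rw [← C.setDim_face hJ, ← h, σ.2.2]
  · rw [map_smul, C.faceChain_single, ← h, smul_smul, signC_mul_self, one_smul, cellChain_cell]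

lemma boundary_boundary (n : ℕ) (x : Chain P (n + 2)) :
    boundary o n (boundary o (n + 1) x) = 0 := by
  suffices h : boundary o n ∘ₗ boundary o (n + 1) = 0 from LinearMap.congr_fun h x
  ext1 σ
  ext1
  simp only [LinearMap.comp_apply, Finsupp.lsingle_apply, LinearMap.zero_apply]
  obtain ⟨C, hC, J, hJ, -, h, h1⟩ := exists_faceChain_eq b o σ
  rw [h1, hC.boundary_faceChain, hC.boundary_faceChain,
    simplexBoundary_simplexBoundary _ (vertexKey_injective o), map_zero]

lemma subsingleton_of_setDim_eq_zero (P : RootPairing ι ℝ E N) [P.IsRootSystem] {σ : Set E}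
    (h : setDim σ = 0) : σ.Subsingleton := by
  have : FiniteDimensional ℝ E := Module.finite_def.2
    (IsRootSystem.span_root_eq_top (P := P) ▸ Submodule.fg_span (Set.finite_range P.root))
  rw [setDim, Submodule.finrank_eq_zero] at h
  exact (vectorSpan_eq_bot_iff_subsingleton ℝ).1 h

/-- The `0`-dimensional polysimplices are single points. -/
lemma exists_eq_singleton (σ : Cell P 0) : ∃ x, σ.1 = {x} := by
  obtain ⟨x, hx⟩ := σ.2.1
  exact ⟨x, (subsingleton_of_setDim_eq_zero P σ.2.2).eq_singleton_of_mem
    (hx ▸ Chart.self_mem_closedFacet P x)⟩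

lemma cellSign_vertex (σ : Cell P 0) : cellSign o σ.1 = 1 := by
  obtain ⟨x, hx⟩ := exists_eq_singleton σ
  rw [cellSign, hx, Set.image_singleton, o.sign_vertex]

lemma augmentation_single (σ : Cell P 0) : augmentation P (Finsupp.single σ 1) = 1 := by
  rw [augmentation, Finsupp.linearCombination_single, one_smul]

lemma augmentation_faceChain (C : Chart P (VertexIndex b) (vertexKind b))
    {J : Finset (VertexIndex b)} (hJ : Transversal (vertexKind b) J)
    (h : J.card = Nat.card (Component P)) :
    augmentation P (C.faceChain o 0 (Finsupp.single J 1)) = 1 := by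
  have h0 : C.face J ∈ polysimplices P ∧ setDim (C.face J) = 0 :=
    ⟨C.face_mem_polysimplices hJ, by have := C.setDim_face hJ; omega⟩
  have h1 := cellSign_vertex o (⟨C.face J, h0⟩ : Cell P 0)
  have h2 := cellChain_cell (⟨C.face J, h0⟩ : Cell P 0)
  dsimp only at h1
  rw [C.faceChain_single, h1, map_smul, show augmentation P (cellChain P 0 (C.face J)) = 1 from
    (congrArg _ h2).trans (augmentation_single _)]
  simp [signC]

/-- For an edge, `J` has one element in each component except for one component with two, `s` and
`t`. Only the removal of `s` or `t` leaves a vertex of `Σ`, and the signs are opposite because `s`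
and `t` are adjacent in the order. -/
lemma augmentation_boundary (x : Chain P 1) : augmentation P (boundary o 0 x) = 0 := by
  suffices h : augmentation P ∘ₗ boundary o 0 = 0 from LinearMap.congr_fun h x
  ext1 σ
  ext1
  simp only [LinearMap.comp_apply, Finsupp.lsingle_apply, LinearMap.zero_apply]
  obtain ⟨C, hC, J, hJ, hc, h, h1⟩ := exists_faceChain_eq b o σ
  rw [h1, hC.boundary_faceChain, map_smul, map_smul, map_smul, simplexBoundary_single]
  simp only [map_sum, map_smul]
  have hcard : Fintype.card (Component P) < J.card := by
    rw [hc, Nat.card_eq_fintype_card]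
    omega
  obtain ⟨s, hs, t, ht, hst, hk⟩ := Finset.exists_ne_map_eq_of_card_lt_of_maps_to
    (s := J) (t := Finset.univ) hcard (f := vertexKind b) fun _ _ => Finset.mem_univ _
  wlog hlt : vertexKey o s < vertexKey o t generalizing s t
  · exact this t ht s hs hst.symm hk.symm
      (lt_of_le_of_ne (not_lt.1 hlt) ((vertexKey_injective o).ne hst.symm))
  have hinj : ∀ r ∈ J, Transversal (vertexKind b) (J.erase r) →
      Set.InjOn (vertexKind b) (J.erase r) := by
    intro r hr h'
    rw [← Finset.card_image_iff]
    have : (J.erase r).image (vertexKind b) = Finset.univ := by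
      ext c
      obtain ⟨u, hu, huc⟩ := h' c
      simp only [Finset.mem_image, Finset.mem_univ, iff_true]
      exact ⟨u, hu, huc⟩
    rw [this, Finset.card_univ, Finset.card_erase_of_mem hr, hc, Nat.card_eq_fintype_card]
    omega
  have htrans : ∀ r ∈ J, ∀ u ∈ J, r ≠ u → vertexKind b r = vertexKind b u →
      Transversal (vertexKind b) (J.erase r) := by
    intro r _ u hu hru hk c
    obtain ⟨v, hv, hvc⟩ := hJ c
    by_cases h' : v = r
    · exact ⟨u, Finset.mem_erase.2 ⟨hru.symm, hu⟩, by rw [← hk, ← h', hvc]⟩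
    · exact ⟨v, Finset.mem_erase.2 ⟨h', hv⟩, hvc⟩
  have hJs := htrans s hs t ht hst hk
  have hJt := htrans t ht s hs hst.symm hk.symm
  rw [← Finset.sum_subset (s₁ := {s, t})]
  · rw [Finset.sum_pair hst, augmentation_faceChain o C hJs, augmentation_faceChain o C hJt]
    · have h2 : J.filter (fun u => vertexKey o u < vertexKey o t) =
          insert s (J.filter fun u => vertexKey o u < vertexKey o s) := by
        ext u
        simp only [Finset.mem_filter, Finset.mem_insert]
        constructor
        · rintro ⟨hu, hut⟩
          by_contra! hne
          have h3 := hne.2 hu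
          have h4 : vertexKind b u = vertexKind b t := by
            rw [vertexKey, vertexKey, Prod.Lex.toLex_le_toLex, hk] at h3
            rw [vertexKey, vertexKey, Prod.Lex.toLex_lt_toLex] at hut
            rcases hut with hut | hut
            · rcases h3 with h3 | h3
              · exact absurd h3 hut.not_gt
              · rw [h3.1] at hut
                exact absurd hut (lt_irrefl _)
            · exact o.component.symm.injective hut.1
          have h5 := hinj s hs hJs (Finset.mem_erase.2 ⟨hne.1, hu⟩)
            (Finset.mem_erase.2 ⟨hst.symm, ht⟩) h4
          rw [h5] at hut
          exact lt_irrefl _ hut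
        · rintro (rfl | ⟨hu, hus⟩)
          · exact ⟨hs, hlt⟩
          · exact ⟨hu, hus.trans hlt⟩
      have h3 : faceSign (vertexKey o) (kindSign o) J t =
          -faceSign (vertexKey o) (kindSign o) J s := by
        rw [faceSign, faceSign, h2, Finset.card_insert_of_notMem (by simp), pow_succ, kindSign,
          kindSign, hk]
        simp
      rw [h3, signC_neg]
      simp
    · rw [Finset.card_erase_of_mem ht, hc]
      omega
    · rw [Finset.card_erase_of_mem hs, hc]
      omega
  · intro u hu
    rcases Finset.mem_insert.1 hu with rfl | hu
    · exact hs
    · rwa [Finset.mem_singleton.1 hu]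
  · intro u hu hu'
    simp only [Finset.mem_insert, Finset.mem_singleton, not_or] at hu'
    rw [C.faceChain_single, C.cellChain_face_eq_zero, smul_zero, map_zero, smul_zero]
    rintro ⟨h', -⟩
    exact hst (hinj u hu h' (Finset.mem_erase.2 ⟨Ne.symm hu'.1, hs⟩)
      (Finset.mem_erase.2 ⟨Ne.symm hu'.2, ht⟩) hk)

end ChartBoundary

/-! ### Chains and cycles with support in a set -/

section Supports
open scoped Classical

lemma map_mem_of_mem_supported {α M : Type*} [AddCommGroup M] [Module ℂ M] {f : (α →₀ ℂ) →ₗ[ℂ] M}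
    {s : Set α} {T : Submodule ℂ M} (h : ∀ a ∈ s, f (Finsupp.single a 1) ∈ T) {x : α →₀ ℂ}
    (hx : x ∈ Finsupp.supported ℂ ℂ s) : f x ∈ T := by
  rw [Finsupp.supported_eq_span_single] at hx
  have : Submodule.span ℂ ((fun i => Finsupp.single i (1 : ℂ)) '' s) ≤ T.comap f := by
    rw [Submodule.span_le]
    rintro _ ⟨a, ha, rfl⟩
    exact h a ha
  exact this hx

/-- The chains supported in `K`. -/
def chainsOn (P : RootPairing ι ℝ E N) (K : Set E) (n : ℕ) : Submodule ℂ (Chain P n) :=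
  Finsupp.supported ℂ ℂ {σ | σ.1 ⊆ K}

variable {P : RootPairing ι ℝ E N}

lemma mem_chainsOn {K : Set E} {n : ℕ} {x : Chain P n} :
    x ∈ chainsOn P K n ↔ ∀ σ, x σ ≠ 0 → σ.1 ⊆ K := by
  rw [chainsOn, Finsupp.mem_supported]
  exact ⟨fun h σ hσ => h (Finsupp.mem_support_iff.2 hσ),
    fun h σ hσ => h σ (Finsupp.mem_support_iff.1 hσ)⟩

lemma chainsOn_mono {K L : Set E} (h : K ⊆ L) (n : ℕ) : chainsOn P K n ≤ chainsOn P L n :=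
  Finsupp.supported_mono fun _ hσ => hσ.trans h

lemma single_mem_chainsOn {K : Set E} {n : ℕ} {σ : Cell P n} (h : σ.1 ⊆ K) (a : ℂ) :
    Finsupp.single σ a ∈ chainsOn P K n := Finsupp.single_mem_supported _ _ h

lemma cellChain_mem_chainsOn {K σ : Set E} (h : σ ⊆ K) (n : ℕ) :
    cellChain P n σ ∈ chainsOn P K n := by
  unfold cellChain
  split_ifs with h'
  · exact single_mem_chainsOn (σ := ⟨σ, h'⟩) h 1
  · exact zero_mem _

lemma chainSupport_subset_iff {K : Set E} {n : ℕ} {x : Chain P n} :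
    chainSupport x ⊆ K ↔ x ∈ chainsOn P K n := by
  rw [mem_chainsOn, chainSupport, Set.iUnion₂_subset_iff]
  simp only [Finsupp.mem_support_iff]

lemma chainMap_single (w : P.weylGroup) {n : ℕ} (σ : Cell P n) (a : ℂ) :
    chainMap P w n (Finsupp.single σ a) = Finsupp.single (cellMap P w n σ) a :=
  Finsupp.mapDomain_single

variable {b : P.Base} (o : AlcoveOrientation b)

/-- The cycles of the augmented complex. -/
def cycles : ∀ n, Submodule ℂ (Chain P n)
  | 0 => LinearMap.ker (augmentation P)
  | n + 1 => LinearMap.ker (boundary o n)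

/-- The augmented complex of chains supported in `K` is exact. -/
def IsAcyclic (K : Set E) : Prop := (∃ σ : Cell P 0, σ.1 ⊆ K) ∧
  ∀ n, ∀ z ∈ chainsOn P K n, z ∈ cycles o n → ∃ u ∈ chainsOn P K (n + 1), boundary o n u = z

variable [Finite ι] [P.IsCrystallographic] [P.IsRootSystem] [P.IsReduced]

lemma boundary_mem_cycles (n : ℕ) (x : Chain P (n + 1)) : boundary o n x ∈ cycles o n := by
  cases n with
  | zero => exact augmentation_boundary o x
  | succ n => exact boundary_boundary o n x

/-- Enough for support and norm estimates: a signed sum of faces, with at most as many terms as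
there are vertex indices. -/
lemma exists_boundary_single_eq {n : ℕ} (σ : Cell P (n + 1)) :
    ∃ (F : Finset (VertexIndex b)) (u : VertexIndex b → ℤˣ) (τ : VertexIndex b → Set E),
      (∀ s, τ s ⊆ σ.1) ∧
      boundary o n (Finsupp.single σ 1) = ∑ s ∈ F, signC (u s) • cellChain P n (τ s) := by
  obtain ⟨C, hC, J, hJ, -, h, h1⟩ := exists_faceChain_eq b o σ
  refine ⟨J, fun s => cellSign o σ.1 * (indexSign o J s * cellSign o (C.face (J.erase s))),
    fun s => C.face (J.erase s), fun s => h ▸ C.face_mono (Finset.erase_subset _ _), ?_⟩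
  rw [h1, hC.boundary_faceChain, map_smul, map_smul, simplexBoundary_single, map_sum,
    Finset.smul_sum]
  refine Finset.sum_congr rfl fun s _ => ?_
  rw [map_smul, C.faceChain_single, smul_smul, smul_smul, ← signC_mul, ← signC_mul,
    mul_assoc]

lemma boundary_mem_chainsOn {K : Set E} {n : ℕ} {x : Chain P (n + 1)}
    (hx : x ∈ chainsOn P K (n + 1)) : boundary o n x ∈ chainsOn P K n := by
  refine map_mem_of_mem_supported (fun σ hσ => ?_) hx
  obtain ⟨F, u, τ, hτ, h⟩ := exists_boundary_single_eq o σ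
  rw [h]
  exact Submodule.sum_mem _ fun s _ =>
    Submodule.smul_mem _ _ (cellChain_mem_chainsOn ((hτ s).trans hσ) n)

variable (b) in
/-- The incidence numbers are integers bounded by the number of vertices of an alcove. -/
lemma boundary_single_apply_mem {n : ℕ} (σ : Cell P (n + 1)) (τ : Cell P n) :
    ∃ k : ℤ, |k| ≤ Fintype.card (VertexIndex b) ∧ boundary o n (Finsupp.single σ 1) τ = k := by
  obtain ⟨F, u, ρ, -, h⟩ := exists_boundary_single_eq o σ
  refine ⟨∑ s ∈ F, if ρ s = τ.1 then (u s : ℤ) else 0, ?_, ?_⟩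
  · refine (Finset.abs_sum_le_sum_abs _ _).trans ((Finset.sum_le_card_nsmul _ _ 1 fun s _ => ?_).trans
      ?_)
    · split_ifs
      · rcases Int.units_eq_one_or (u s) with h | h <;> simp [h]
      · simp
    · simp only [nsmul_eq_mul, mul_one, Nat.cast_le]
      exact Finset.card_le_univ F
  · rw [h, Finsupp.finsetSum_apply, Int.cast_sum]
    refine Finset.sum_congr rfl fun s _ => ?_
    rw [Finsupp.smul_apply, cellChain_apply]
    split_ifs <;> simp

variable (b) in
lemma norm_map_boundary_single_le {n : ℕ} {M : Type*} [SeminormedAddCommGroup M] [NormedSpace ℂ M]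
    (L : Chain P n →ₗ[ℂ] M) {A : ℝ} (hA : 0 ≤ A) (σ : Cell P (n + 1))
    (hL : ∀ τ : Cell P n, τ.1 ⊆ σ.1 → ‖L (Finsupp.single τ 1)‖ ≤ A) :
    ‖L (boundary o n (Finsupp.single σ 1))‖ ≤ Fintype.card (VertexIndex b) * A := by
  obtain ⟨F, u, ρ, hρ, h⟩ := exists_boundary_single_eq o σ
  rw [h, map_sum]
  refine (norm_sum_le _ _).trans ((Finset.sum_le_card_nsmul _ _ A fun s _ => ?_).trans ?_)
  · rw [map_smul, norm_smul, norm_signC, one_mul, cellChain]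
    split_ifs with h'
    · exact hL ⟨ρ s, h'⟩ (hρ s)
    · simpa using hA
  · rw [nsmul_eq_mul]
    gcongr
    exact Finset.card_le_univ F

/-! ### Equivariance of the boundary maps -/

lemma chainMap_cellChain (w : P.weylGroup) (n : ℕ) (σ : Set E) :
    chainMap P w n (cellChain P n σ) = cellChain P n ((fun y : E => w • y) '' σ) := by
  by_cases h : σ ∈ polysimplices P ∧ setDim σ = n
  · have h1 := cellChain_cell (⟨σ, h⟩ : Cell P n)
    have h2 := cellChain_cell (cellMap P w n ⟨σ, h⟩)
    exact (congrArg _ h1).trans ((chainMap_single w _ _).trans h2.symm)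
  · have h' : ¬((fun y : E => w • y) '' σ ∈ polysimplices P ∧
        setDim ((fun y : E => w • y) '' σ) = n) := by
      rw [setDim_image]
      rintro ⟨⟨x, hx⟩, hd⟩
      refine h ⟨⟨w⁻¹ • x, ?_⟩, hd⟩
      rw [← image_closedFacet, hx, Set.image_image]
      simp
    rw [cellChain, dif_neg h, map_zero, cellChain, dif_neg h']

/-- Orientations are transported from the alcove, so `W_0` permutes oriented cells without signs. -/
lemma cellSign_image_smul (w : P.weylGroup) (σ : Set E) :
    cellSign o ((fun y : E => w • y) '' σ) = cellSign o σ := by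
  rw [cellSign, cellSign, Set.image_image]
  congr 2
  funext y
  exact (fold_eq_of_affineConj (affineConj_smul w y)).symm

lemma chainMap_faceChain (C : Chart P (VertexIndex b) (vertexKind b)) (w : P.weylGroup) (n : ℕ)
    (x : Finset (VertexIndex b) →₀ ℂ) : chainMap P w n (C.faceChain o n x) =
      (C.transport w 0 (zero_mem _)).faceChain o n x := by
  suffices h : chainMap P w n ∘ₗ C.faceChain o n = (C.transport w 0 (zero_mem _)).faceChain o n from
    LinearMap.congr_fun h x
  ext1 J
  ext1
  simp only [LinearMap.comp_apply, Finsupp.lsingle_apply]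
  rw [C.faceChain_single, Chart.faceChain_single, Chart.transport_face, cellSign_image_smul,
    map_smul, chainMap_cellChain]

lemma chainMap_boundary (w : P.weylGroup) (n : ℕ) (x : Chain P (n + 1)) :
    chainMap P w n (boundary o n x) = boundary o n (chainMap P w (n + 1) x) := by
  suffices h : chainMap P w n ∘ₗ boundary o n = boundary o n ∘ₗ chainMap P w (n + 1) from
    LinearMap.congr_fun h x
  ext1 σ
  ext1
  simp only [LinearMap.comp_apply, Finsupp.lsingle_apply]
  obtain ⟨C, hC, J, hJ, -, h, h1⟩ := exists_faceChain_eq b o σ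
  rw [h1, hC.boundary_faceChain, chainMap_faceChain, chainMap_faceChain,
    (hC.transport w (zero_mem _)).boundary_faceChain]

lemma augmentation_chainMap (w : P.weylGroup) (x : Chain P 0) :
    augmentation P (chainMap P w 0 x) = augmentation P x := by
  suffices h : augmentation P ∘ₗ chainMap P w 0 = augmentation P from LinearMap.congr_fun h x
  ext1 σ
  ext1
  simp only [LinearMap.comp_apply, Finsupp.lsingle_apply]
  rw [chainMap_single, augmentation_single, augmentation_single]

/-! ### Polysimplices are acyclic -/

namespace Chart

variable (C : Chart P (VertexIndex b) (vertexKind b))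

lemma faceChain_mem_chainsOn {K : Set E} (n : ℕ) {A : Set (Finset (VertexIndex b))}
    (hA : ∀ J ∈ A, Transversal (vertexKind b) J → C.face J ⊆ K)
    {x : Finset (VertexIndex b) →₀ ℂ} (hx : x ∈ Finsupp.supported ℂ ℂ A) :
    C.faceChain o n x ∈ chainsOn P K n := by
  refine map_mem_of_mem_supported (fun J hJ => ?_) hx
  rw [C.faceChain_single]
  by_cases h : Transversal (vertexKind b) J
  · exact Submodule.smul_mem _ _ (cellChain_mem_chainsOn (hA J hJ h) n)
  · rw [C.cellChain_face_eq_zero fun h' => h h'.1, smul_zero]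
    exact zero_mem _

lemma exists_faceChain_eq_of_mem_chainsOn {n : ℕ} {J : Finset (VertexIndex b)} {z : Chain P n}
    (hz : z ∈ chainsOn P (C.face J) n) :
    ∃ x ∈ Finsupp.supported ℂ ℂ {J' | J' ⊆ J ∧ Transversal (vertexKind b) J' ∧
      J'.card = n + Nat.card (Component P)}, C.faceChain o n x = z := by
  change z ∈ (Finsupp.supported ℂ ℂ _).map (C.faceChain o n)
  have := map_mem_of_mem_supported (f := LinearMap.id) (T := (Finsupp.supported ℂ ℂ {J' | J' ⊆ J ∧
    Transversal (vertexKind b) J' ∧ J'.card = n + Nat.card (Component P)}).map (C.faceChain o n))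
    (fun σ (hσ : σ.1 ⊆ C.face J) => ?_) hz
  · exact this
  · obtain ⟨J', hJ', hJ, h⟩ := C.exists_face_of_subset σ.2.1 hσ
    have hc := C.setDim_face hJ
    rw [← h, σ.2.2] at hc
    refine ⟨signC (cellSign o σ.1) • Finsupp.single J' 1, Submodule.smul_mem _ _
      (Finsupp.single_mem_supported _ _ ⟨hJ', hJ, hc.symm⟩), ?_⟩
    rw [map_smul, C.faceChain_single, ← h, smul_smul, signC_mul_self, one_smul, cellChain_cell]
    rfl

lemma faceChain_apply {n : ℕ} {J : Finset (VertexIndex b)} (hJ : Transversal (vertexKind b) J)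
    {τ : Cell P n} (h : τ.1 = C.face J) (x : Finset (VertexIndex b) →₀ ℂ) :
    C.faceChain o n x τ = signC (cellSign o (C.face J)) * x J := by
  let f : (Finset (VertexIndex b) →₀ ℂ) →ₗ[ℂ] ℂ := Finsupp.lapply τ ∘ₗ C.faceChain o n
  suffices hf : f = signC (cellSign o (C.face J)) • Finsupp.lapply J from
    LinearMap.congr_fun hf x
  ext1 J'
  ext1
  simp only [f, LinearMap.comp_apply, Finsupp.lsingle_apply, LinearMap.smul_apply,
    Finsupp.lapply_apply]
  rw [C.faceChain_single, Finsupp.smul_apply, cellChain_apply]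
  by_cases hJJ : J' = J
  · rw [hJJ, if_pos h.symm, Finsupp.single_eq_same]
  · rw [Finsupp.single_eq_of_ne (Ne.symm hJJ), smul_zero, if_neg, smul_zero]
    rw [h]
    intro he
    have := τ.2.1
    rw [h, ← he] at this
    exact hJJ (C.face_injective (C.transversal_of_face_mem_polysimplices this) hJ he)

lemma simplexBoundary_mem_supported {n : ℕ} {J : Finset (VertexIndex b)}
    {x : Finset (VertexIndex b) →₀ ℂ}
    (hx : x ∈ Finsupp.supported ℂ ℂ {J' | J' ⊆ J ∧ J'.card = n}) :
    indexBoundary o x ∈ Finsupp.supported ℂ ℂ {J' | J' ⊆ J ∧ J'.card + 1 = n} := by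
  refine map_mem_of_mem_supported (fun J' hJ' => ?_) hx
  rw [simplexBoundary_single]
  refine Submodule.sum_mem _ fun s hs => Submodule.smul_mem _ _
    (Finsupp.single_mem_supported _ _ ⟨(Finset.erase_subset _ _).trans hJ'.1, ?_⟩)
  rw [Finset.card_erase_add_one hs, hJ'.2]

lemma simplexCone_mem_supported {J : Finset (VertexIndex b)} {s : VertexIndex b} (hs : s ∈ J)
    {x : Finset (VertexIndex b) →₀ ℂ} (hx : x ∈ Finsupp.supported ℂ ℂ {J' | J' ⊆ J}) :
    simplexCone (vertexKey o) (kindSign o) s x ∈ Finsupp.supported ℂ ℂ {J' | J' ⊆ J} := by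
  refine map_mem_of_mem_supported (fun J' hJ' => ?_) hx
  rw [simplexCone_single]
  split_ifs
  · exact zero_mem _
  · exact Submodule.smul_mem _ _ (Finsupp.single_mem_supported _ _ (Finset.insert_subset hs hJ'))

variable {C}

/-- A cycle on a face is homologous to one on the smaller face in which the factor of a given
vertex is replaced by this vertex. -/
lemma IsStandard.exists_homologous (hC : C.IsStandard) {n : ℕ} {J : Finset (VertexIndex b)}
    {s : VertexIndex b} (hs : s ∈ J) {z : Chain P n} (hz : z ∈ chainsOn P (C.face J) n)
    (hcyc : z ∈ cycles o n) : ∃ u ∈ chainsOn P (C.face J) (n + 1), z - boundary o n u ∈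
      chainsOn P (C.face (J.filter fun t => vertexKind b t = vertexKind b s → t = s)) n := by
  obtain ⟨x, hx, rfl⟩ := C.exists_faceChain_eq_of_mem_chainsOn o hz
  have hx1 : x ∈ Finsupp.supported ℂ ℂ {J' | J' ⊆ J} :=
    Finsupp.supported_mono (fun J' h => h.1) hx
  have hx2 : x ∈ Finsupp.supported ℂ ℂ {J' | J' ⊆ J ∧ J'.card = n + Nat.card (Component P)} :=
    Finsupp.supported_mono (fun J' h => And.intro h.1 h.2.2) hx
  have hd := simplexBoundary_mem_supported o hx2
  -- The lift of a cycle need not be a cycle of the simplex, but its boundary involves only sets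
  -- that miss a factor. For `n = 0` these sets are too small to be transversal.
  have hd' : indexBoundary o x ∈ Finsupp.supported ℂ ℂ
      {J' | J' ⊆ J ∧ ¬Transversal (vertexKind b) J'} := by
    rw [Finsupp.mem_supported]
    intro J' hJ'
    obtain ⟨h1, h2⟩ := (Finsupp.mem_supported ℂ _).1 hd hJ'
    refine ⟨h1, fun hT => ?_⟩
    have h3 := C.setDim_face hT
    cases n with
    | zero => omega
    | succ n =>
      have h0 : C.faceChain o n (indexBoundary o x) = 0 := by
        rw [← hC.boundary_faceChain]
        exact hcyc
      obtain ⟨τ, hτ⟩ : ∃ τ : Cell P n, τ.1 = C.face J' :=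
        ⟨⟨C.face J', C.face_mem_polysimplices hT, by omega⟩, rfl⟩
      have h4 := C.faceChain_apply o hT hτ (indexBoundary o x)
      rw [h0, Finsupp.zero_apply, eq_comm, mul_eq_zero] at h4
      rcases h4 with h4 | h4
      · have := norm_signC (cellSign o (C.face J'))
        rw [h4, norm_zero] at this
        exact zero_ne_one this
      · exact Finsupp.mem_support_iff.1 hJ' h4
  refine ⟨C.faceChain o (n + 1) (simplexCone (vertexKey o) (kindSign o) s x),
    C.faceChain_mem_chainsOn o _ (fun J' hJ' _ => C.face_mono hJ')
      (simplexCone_mem_supported o hs hx1), ?_⟩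
  rw [hC.boundary_faceChain, ← map_sub]
  -- What is left of the cycle is the cone over its boundary. If `J'` misses a factor but `insert s
  -- J'` does not, then `s` is the only vertex in its factor.
  have h1 := simplexBoundary_simplexCone (kindSign o) (vertexKey_injective o) s x
  rw [← eq_sub_iff_add_eq'] at h1
  rw [← h1]
  refine map_mem_of_mem_supported (f := C.faceChain o n ∘ₗ simplexCone (vertexKey o) (kindSign o) s)
    (fun J' hJ' => ?_) hd'
  rw [LinearMap.comp_apply, simplexCone_single]
  split_ifs with hsJ
  · rw [map_zero]
    exact zero_mem _
  · rw [map_smul]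
    refine Submodule.smul_mem _ _ (C.faceChain_mem_chainsOn o _ (A := {insert s J'}) ?_
      (Finsupp.single_mem_supported _ _ rfl))
    rintro _ rfl hT
    refine C.face_mono fun t ht => Finset.mem_filter.2 ⟨?_, fun hk => ?_⟩
    · exact Finset.insert_subset hs hJ'.1 ht
    · by_contra hts
      have htJ := Finset.mem_of_mem_insert_of_ne ht hts
      refine hJ'.2 fun c => ?_
      obtain ⟨r, hr, hrc⟩ := hT c
      rcases Finset.mem_insert.1 hr with rfl | hr
      · exact ⟨t, htJ, hk.trans hrc⟩
      · exact ⟨r, hr, hrc⟩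

/-- While some factor has two vertices, `exists_homologous` collapses it to a single one. When none
has, the face is a point. -/
lemma IsStandard.isAcyclic_face (hC : C.IsStandard) {J : Finset (VertexIndex b)}
    (hJ : Transversal (vertexKind b) J) : IsAcyclic o (C.face J) := by
  induction hm : J.card using Nat.strong_induction_on generalizing J with
  | _ m ih =>
  subst hm
  by_cases hinj : Set.InjOn (vertexKind b) J
  · have hc : J.card = Nat.card (Component P) := by
      rw [Nat.card_eq_fintype_card, ← Finset.card_univ, ← Finset.card_image_iff.2 hinj]
      congr 1
      ext c
      obtain ⟨u, hu, huc⟩ := hJ c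
      simp only [Finset.mem_image, Finset.mem_univ, iff_true]
      exact ⟨u, hu, huc⟩
    obtain ⟨τ, hτ⟩ : ∃ τ : Cell P 0, τ.1 = C.face J :=
      ⟨⟨C.face J, C.face_mem_polysimplices hJ, by have := C.setDim_face hJ; omega⟩, rfl⟩
    refine ⟨⟨τ, hτ.subset⟩, fun n z hz hcyc => ⟨0, zero_mem _, ?_⟩⟩
    rw [map_zero, eq_comm]
    have hcard : ∀ σ : Cell P n, z σ ≠ 0 → n = 0 ∧ σ.1 = C.face J := by
      intro σ hσ
      obtain ⟨J', hJ', hT, h⟩ := C.exists_face_of_subset σ.2.1 (mem_chainsOn.1 hz σ hσ)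
      have h1 := C.setDim_face hT
      rw [← h, σ.2.2] at h1
      have h2 := Finset.card_le_card hJ'
      have h3 := Finset.eq_of_subset_of_card_le hJ' (by omega)
      exact ⟨by omega, h3 ▸ h⟩
    by_contra hz0
    obtain ⟨σ, hσ⟩ := Finsupp.ne_iff.1 hz0
    obtain ⟨rfl, hσJ⟩ := hcard σ hσ
    have : z = Finsupp.single σ (z σ) := by
      ext ρ
      by_cases h : ρ = σ
      · rw [h, Finsupp.single_eq_same]
      · rw [Finsupp.single_eq_of_ne h]
        by_contra h'
        exact h (Subtype.ext ((hcard ρ h').2.trans hσJ.symm))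
    rw [this] at hcyc
    have h1 : augmentation P (Finsupp.single σ (z σ)) = 0 := hcyc
    rw [augmentation, Finsupp.linearCombination_single, smul_eq_mul, mul_one] at h1
    exact hσ h1
  · rw [Set.InjOn] at hinj
    push Not at hinj
    obtain ⟨s, hs, t, ht, hk, hst⟩ := hinj
    have hlt : (J.filter fun t => vertexKind b t = vertexKind b s → t = s).card < J.card := by
      refine Finset.card_lt_card ((Finset.filter_ssubset).2 ⟨t, ht, fun h => hst (h hk.symm).symm⟩)
    have hT : Transversal (vertexKind b)
        (J.filter fun t => vertexKind b t = vertexKind b s → t = s) := by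
      intro c
      by_cases h : vertexKind b s = c
      · exact ⟨s, Finset.mem_filter.2 ⟨hs, fun _ => rfl⟩, h⟩
      · obtain ⟨r, hr, hrc⟩ := hJ c
        exact ⟨r, Finset.mem_filter.2 ⟨hr, fun h' => absurd (h'.symm.trans hrc) h⟩, hrc⟩
    obtain ⟨⟨τ, hτ⟩, hacyc⟩ := ih _ hlt hT rfl
    have hsub : C.face (J.filter fun t => vertexKind b t = vertexKind b s → t = s) ⊆ C.face J :=
      C.face_mono (Finset.filter_subset _ _)
    refine ⟨⟨τ, hτ.trans hsub⟩, fun n z hz hcyc => ?_⟩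
    obtain ⟨u, hu, huz⟩ := hC.exists_homologous o hs hz hcyc
    obtain ⟨v, hv, hvz⟩ := hacyc n _ huz (sub_mem hcyc (boundary_mem_cycles o n u))
    exact ⟨u + v, add_mem hu (chainsOn_mono hsub _ hv), by rw [map_add, hvz, add_sub_cancel]⟩

end Chart

lemma isAcyclic_closedFacet (x : E) : IsAcyclic o (closedFacet P x) := by
  obtain ⟨C, hC, J, hJ, h⟩ := exists_standard_face b (Set.mem_range_self x)
  rw [h]
  exact hC.isAcyclic_face o hJ

end Supports

/-! ### Convex polyhedra bounded by hyperplanes of the arrangement are acyclic -/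

section Polyhedra
open scoped Classical

/-- The polyhedron given by integral lower bounds for the coroots. -/
def polyhedron (P : RootPairing ι ℝ E N) (m : ι → ℤ) : Set E := {x | ∀ i, (m i : ℝ) ≤ P.coroot' i x}

variable {P : RootPairing ι ℝ E N}

lemma closedFacet_subset_polyhedron {m : ι → ℤ} {x : E} (hx : x ∈ polyhedron P m) :
    closedFacet P x ⊆ polyhedron P m := by
  intro y hy i
  have h := hy (i, -m i)
  simp only [affineRoot, Int.cast_neg, ← sub_eq_add_neg, sub_nonneg] at h
  exact h (hx i)

lemma polyhedron_update (m : ι → ℤ) {i : ι} {k : ℤ} (h : m i ≤ k) :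
    polyhedron P (Function.update m i k) = polyhedron P m ∩ {x | (k : ℝ) ≤ P.coroot' i x} := by
  ext x
  constructor
  · intro hx
    have hi : (k : ℝ) ≤ P.coroot' i x := by simpa using hx i
    refine ⟨fun j => ?_, hi⟩
    by_cases hj : j = i
    · subst hj
      exact le_trans (by exact_mod_cast h) hi
    · simpa [hj] using hx j
  · rintro ⟨hx, hi⟩ j
    by_cases hj : j = i
    · subst hj
      simpa using hi
    · simpa [hj] using hx j

variable {b : P.Base} (o : AlcoveOrientation b)
variable [Finite ι] [P.IsCrystallographic] [P.IsRootSystem] [P.IsReduced]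

/-- Mayer–Vietoris. A cycle splits as `zA + zB`, where the boundary of `zA` lies in `A ∩ B` and so
bounds some `v` there; then `zA - v` and `zB + v` are cycles. In degree `0`, `v` is the multiple of
a vertex with the augmentation of `zA`. -/
lemma IsAcyclic.union {A B : Set E} (hA : IsAcyclic o A) (hB : IsAcyclic o B)
    (hAB : IsAcyclic o (A ∩ B)) (h : ∀ σ ∈ polysimplices P, σ ⊆ A ∪ B → σ ⊆ A ∨ σ ⊆ B) :
    IsAcyclic o (A ∪ B) := by
  refine ⟨hA.1.imp fun σ hσ => hσ.trans Set.subset_union_left, fun n z hz hcyc => ?_⟩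
  have key : ∃ zA ∈ chainsOn P A n, ∃ zB ∈ chainsOn P B n, z = zA + zB := by
    have : z ∈ chainsOn P A n ⊔ chainsOn P B n := by
      refine map_mem_of_mem_supported (f := LinearMap.id) (fun σ hσ => ?_) hz
      rcases h σ.1 σ.2.1 hσ with h | h
      · exact Submodule.mem_sup_left (single_mem_chainsOn h 1)
      · exact Submodule.mem_sup_right (single_mem_chainsOn h 1)
    obtain ⟨zA, hzA, zB, hzB, h⟩ := Submodule.mem_sup.1 this
    exact ⟨zA, hzA, zB, hzB, h.symm⟩
  obtain ⟨zA, hzA, zB, hzB, rfl⟩ := key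
  have key2 : ∃ v ∈ chainsOn P (A ∩ B) n, zA - v ∈ cycles o n := by
    cases n with
    | zero =>
      obtain ⟨σ, hσ⟩ := hAB.1
      refine ⟨Finsupp.single σ (augmentation P zA), single_mem_chainsOn hσ _, ?_⟩
      change augmentation P _ = 0
      rw [map_sub, sub_eq_zero]
      exact ((Finsupp.linearCombination_single ℂ _ σ).trans (mul_one _)).symm
    | succ n =>
      have h0 : boundary o n zA = -boundary o n zB := by
        rw [← add_eq_zero_iff_eq_neg, ← map_add]
        exact hcyc
      have h1 : boundary o n zA ∈ chainsOn P (A ∩ B) n := by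
        rw [mem_chainsOn]
        intro σ hσ
        refine Set.subset_inter (mem_chainsOn.1 (boundary_mem_chainsOn o hzA) σ hσ)
          (mem_chainsOn.1 (boundary_mem_chainsOn o hzB) σ fun h' => hσ ?_)
        rw [h0, Finsupp.neg_apply, h', neg_zero]
      obtain ⟨v, hv, hvz⟩ := hAB.2 n _ h1 (boundary_mem_cycles o n zA)
      refine ⟨v, hv, ?_⟩
      change boundary o n _ = 0
      rw [map_sub, hvz, sub_self]
  obtain ⟨v, hv, hvc⟩ := key2
  obtain ⟨u, hu, huz⟩ := hA.2 n _ (sub_mem hzA (chainsOn_mono Set.inter_subset_left n hv)) hvc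
  obtain ⟨u', hu', huz'⟩ := hB.2 n (zB + v)
    (add_mem hzB (chainsOn_mono Set.inter_subset_right n hv))
    (by
      have : zB + v = (zA + zB) - (zA - v) := by abel
      rw [this]
      exact sub_mem hcyc hvc)
  refine ⟨u + u', add_mem (chainsOn_mono Set.subset_union_left _ hu)
    (chainsOn_mono Set.subset_union_right _ hu'), ?_⟩
  rw [map_add, huz, huz']
  abel

lemma midpoint_mem_polyhedron {m : ι → ℤ} {x y : E} (hx : x ∈ polyhedron P m)
    (hy : y ∈ polyhedron P m) : (2⁻¹ : ℝ) • x + (2⁻¹ : ℝ) • y ∈ polyhedron P m := by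
  intro i
  have h1 := hx i
  have h2 := hy i
  rw [map_add, map_smul, map_smul, smul_eq_mul, smul_eq_mul]
  linarith

/-- A polyhedron that is not cut by a hyperplane of the arrangement is a polysimplex. -/
lemma exists_closedFacet_eq_polyhedron {m : ι → ℤ} (hne : (polyhedron P m).Nonempty)
    (hcut : ∀ x ∈ polyhedron P m, ∀ y ∈ polyhedron P m, ∀ i, ∀ k : ℤ,
      ¬(P.coroot' i x < k ∧ k < P.coroot' i y)) :
    ∃ x, polyhedron P m = closedFacet P x := by
  have := Fintype.ofFinite ι
  -- A point with the largest number of nonintegral coroots lies on as few hyperplanes as possible,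
  -- and its closed facet is the whole polyhedron.
  let cnt : E → ℕ := fun x => (Finset.univ.filter fun i => ∀ k : ℤ, P.coroot' i x ≠ k).card
  have hbdd : ∃ x ∈ polyhedron P m, ∀ y ∈ polyhedron P m, cnt y ≤ cnt x := by
    have hfin : (cnt '' polyhedron P m).Finite :=
      (Set.finite_Iic (Fintype.card ι)).subset (by
        rintro _ ⟨x, -, rfl⟩
        exact Finset.card_le_univ _)
    obtain ⟨_, ⟨x, hx, rfl⟩, h⟩ := hfin.exists_maximal (hne.image _)
    refine ⟨x, hx, fun y hy => ?_⟩
    by_contra! hlt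
    exact hlt.not_ge (h ⟨y, hy, rfl⟩ hlt.le)
  obtain ⟨x, hx, hmax⟩ := hbdd
  refine ⟨x, Set.Subset.antisymm ?_ (closedFacet_subset_polyhedron hx)⟩
  rintro y hy ⟨i, k⟩ hik
  by_contra! hlt
  simp only [affineRoot] at hik hlt
  have h1 : P.coroot' i x = -k := by
    by_contra hne'
    refine hcut y hy x hx i (-k) ?_
    push_cast
    exact ⟨by linarith, lt_of_le_of_ne (by linarith) (Ne.symm hne')⟩
  have h2 : (-k - 1 : ℝ) ≤ P.coroot' i y := by
    by_contra! h'
    refine hcut y hy x hx i (-k - 1) ?_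
    push_cast
    exact ⟨by linarith, by linarith⟩
  -- At the midpoint the coroot `i` becomes nonintegral, while by `hcut` the coroots nonintegral at
  -- `x` stay so, contradicting maximality.
  have hmid := midpoint_mem_polyhedron hx hy
  refine (hmax _ hmid).not_gt (Finset.card_lt_card ((Finset.ssubset_iff_of_subset ?_).2
    ⟨i, ?_, ?_⟩))
  · intro j hj
    rw [Finset.mem_filter] at hj ⊢
    refine ⟨hj.1, fun l hl => ?_⟩
    rw [map_add, map_smul, map_smul, smul_eq_mul, smul_eq_mul] at hl
    rcases lt_or_gt_of_ne (hj.2 l) with h | h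
    · exact hcut x hx y hy j l ⟨h, by linarith⟩
    · exact hcut y hy x hx j l ⟨by linarith, h⟩
  · refine Finset.mem_filter.2 ⟨Finset.mem_univ _, fun l hl => ?_⟩
    rw [map_add, map_smul, map_smul, smul_eq_mul, smul_eq_mul] at hl
    have h3 : (-k - 1 : ℤ) < l := by
      have : ((-k - 1 : ℤ) : ℝ) < l := by push_cast; linarith
      exact_mod_cast this
    have h4 : l < -k := by
      have : (l : ℝ) < ((-k : ℤ) : ℝ) := by push_cast; linarith
      exact_mod_cast this
    omega
  · intro h
    exact (Finset.mem_filter.1 h).2 (-k) (by push_cast; exact h1)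

/-- Coroots come in opposite pairs, so their values at a point add up to zero. This bounds the
number of cuts in `isAcyclic_polyhedron`. -/
lemma sum_le_zero_of_nonempty [Fintype ι] {m : ι → ℤ} (hne : (polyhedron P m).Nonempty) :
    ∑ i, m i ≤ 0 := by
  obtain ⟨x, hx⟩ := hne
  have h1 : ((∑ i, m i : ℤ) : ℝ) ≤ ∑ i, P.coroot' i x := by
    push_cast
    exact Finset.sum_le_sum fun i _ => hx i
  have h2 : ∑ i, P.coroot' i x = 0 := by
    have h3 : Function.Involutive (opp P) := fun i => P.coroot.injective (by
      rw [coroot_opp, coroot_opp, neg_neg])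
    have h4 := Equiv.sum_comp (h3.toPerm _) fun i => P.coroot' i x
    have h5 : ∑ i, P.coroot' ((h3.toPerm _) i) x = -∑ i, P.coroot' i x := by
      rw [← Finset.sum_neg_distrib]
      exact Finset.sum_congr rfl fun i _ => coroot'_opp P i x
    linarith
  rw [h2] at h1
  exact_mod_cast h1

/-- A hyperplane that cuts the polyhedron divides it into two polyhedra meeting in a third. Each has
a larger sum of lower bounds, and that sum is at most `0`, so the induction stops at single
polysimplices. -/
lemma isAcyclic_polyhedron {m : ι → ℤ} (hne : (polyhedron P m).Nonempty) :
    IsAcyclic o (polyhedron P m) := by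
  have := Fintype.ofFinite ι
  induction hT : (-∑ i, m i).toNat using Nat.strong_induction_on generalizing m with
  | _ T ih =>
  subst hT
  by_cases hcut : ∀ x ∈ polyhedron P m, ∀ y ∈ polyhedron P m, ∀ i, ∀ k : ℤ,
      ¬(P.coroot' i x < k ∧ k < P.coroot' i y)
  · obtain ⟨x, hx⟩ := exists_closedFacet_eq_polyhedron hne hcut
    rw [hx]
    exact isAcyclic_closedFacet o x
  push Not at hcut
  obtain ⟨x, hx, y, hy, i, k, hxk, hky⟩ := hcut
  have hup : ∀ (m' : ι → ℤ) (j : ι) (l : ℤ), m' j < l →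
      ∑ i, m' i < ∑ i, Function.update m' j l i := by
    intro m' j l hl
    refine Finset.sum_lt_sum (fun r _ => ?_) ⟨j, Finset.mem_univ _, by simpa using hl⟩
    by_cases hr : r = j
    · subst hr
      simpa using hl.le
    · simp [hr]
  have h1 : m i < k := by
    have : (m i : ℝ) < k := (hx i).trans_lt hxk
    exact_mod_cast this
  have h2 : m (opp P i) < -k := by
    have h3 := hy (opp P i)
    rw [coroot'_opp] at h3
    have : (m (opp P i) : ℝ) < ((-k : ℤ) : ℝ) := by push_cast; linarith
    exact_mod_cast this
  set mA := Function.update m i k with hmA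
  set mB := Function.update m (opp P i) (-k) with hmB
  set mC := Function.update mA (opp P i) (-k) with hmC
  have h3 : mA (opp P i) < -k := by
    rwa [hmA, Function.update_of_ne (opp_ne P i)]
  have hA : polyhedron P mA = polyhedron P m ∩ {x | (k : ℝ) ≤ P.coroot' i x} :=
    polyhedron_update m h1.le
  have hopp : {x | ((-k : ℤ) : ℝ) ≤ P.coroot' (opp P i) x} = {x | P.coroot' i x ≤ (k : ℝ)} := by
    ext z
    change ((-k : ℤ) : ℝ) ≤ P.coroot' (opp P i) z ↔ P.coroot' i z ≤ k
    rw [coroot'_opp, Int.cast_neg, neg_le_neg_iff]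
  have hB : polyhedron P mB = polyhedron P m ∩ {x | P.coroot' i x ≤ (k : ℝ)} := by
    rw [hmB, polyhedron_update m h2.le, hopp]
  have hC : polyhedron P mC = polyhedron P mA ∩ polyhedron P mB := by
    rw [hmC, polyhedron_update mA h3.le, hopp, hB, hA]
    ext z
    simp only [Set.mem_inter_iff]
    tauto
  have hAB : polyhedron P m = polyhedron P mA ∪ polyhedron P mB := by
    rw [hA, hB, ← Set.inter_union_distrib_left, eq_comm, Set.inter_eq_left]
    intro z _
    exact le_total (k : ℝ) (P.coroot' i z)
  have hneC : (polyhedron P mC).Nonempty := by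
    -- The parameter at which the segment from `x` to `y` crosses the hyperplane.
    set t : ℝ := (k - P.coroot' i x) / (P.coroot' i y - P.coroot' i x) with ht
    have hd : 0 < P.coroot' i y - P.coroot' i x := by linarith
    have ht0 : 0 ≤ t := div_nonneg (by linarith) hd.le
    have ht1 : t ≤ 1 := (div_le_one hd).2 (by linarith)
    have hval : ∀ j, P.coroot' j (x + t • (y - x)) =
        (1 - t) * P.coroot' j x + t * P.coroot' j y := by
      intro j
      rw [map_add, map_smul, map_sub, smul_eq_mul]
      ring
    have hk : P.coroot' i (x + t • (y - x)) = k := by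
      rw [map_add, map_smul, map_sub, smul_eq_mul, ht, div_mul_cancel₀ _ hd.ne']
      ring
    have hm : x + t • (y - x) ∈ polyhedron P m := by
      intro j
      rw [hval]
      nlinarith [mul_le_mul_of_nonneg_left (hx j) (sub_nonneg.2 ht1),
        mul_le_mul_of_nonneg_left (hy j) ht0]
    refine ⟨x + t • (y - x), ?_⟩
    rw [hC, hA, hB]
    exact ⟨⟨hm, hk.ge⟩, ⟨hm, hk.le⟩⟩
  have hneA : (polyhedron P mA).Nonempty := hneC.mono (hC ▸ Set.inter_subset_left)
  have hneB : (polyhedron P mB).Nonempty := hneC.mono (hC ▸ Set.inter_subset_right)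
  have hm0 := sum_le_zero_of_nonempty hne
  have hA0 := sum_le_zero_of_nonempty hneA
  have hB0 := sum_le_zero_of_nonempty hneB
  have hC0 := sum_le_zero_of_nonempty hneC
  have hA1 := hup m i k h1
  have hB1 := hup m (opp P i) (-k) h2
  have hC1 := hup mA (opp P i) (-k) h3
  rw [← hmA] at hA1
  rw [← hmB] at hB1
  rw [← hmC] at hC1
  rw [hAB]
  refine IsAcyclic.union o (ih _ (by omega) hneA rfl) (ih _ (by omega) hneB rfl)
    (hC ▸ ih _ (by omega) hneC rfl) ?_
  rintro _ ⟨z, rfl⟩ hz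
  rcases hz (Chart.self_mem_closedFacet P z) with h | h
  · exact Or.inl (closedFacet_subset_polyhedron h)
  · exact Or.inr (closedFacet_subset_polyhedron h)

end Polyhedra

/-! ### Uniform bounds for fillings of cycles -/

section UniformBounds
open scoped Classical

/-- A linear system has solutions bounded in terms of the right-hand side. -/
lemma exists_bounded_preimage {X Y : Type*} [Fintype X] [Fintype Y]
    (f : (X → ℂ) →ₗ[ℂ] (Y → ℂ)) :
    ∃ C : ℝ, 0 ≤ C ∧ ∀ v, ∃ v', f v' = f v ∧ ‖v'‖ ≤ C * ‖f v‖ := by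
  obtain ⟨s, hs⟩ := f.rangeRestrict.exists_rightInverse_of_surjective f.range_rangeRestrict
  obtain ⟨g, hg⟩ := s.exists_extend
  refine ⟨‖g.toContinuousLinearMap‖, norm_nonneg _, fun v => ⟨g (f v), ?_, ?_⟩⟩
  · have h1 : g (f v) = s (f.rangeRestrict v) := LinearMap.congr_fun hg (f.rangeRestrict v)
    rw [h1]
    exact congrArg Subtype.val (LinearMap.congr_fun hs (f.rangeRestrict v))
  · exact g.toContinuousLinearMap.le_opNorm (f v)

/-- There are only finitely many integer matrices of bounded size with bounded entries, so a largest
constant exists. -/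
lemma exists_uniform_bounded_preimage (p k : ℕ) : ∃ C : ℝ, 0 ≤ C ∧
    ∀ (a c : ℕ), a ≤ p → c ≤ p → ∀ M : Matrix (Fin c) (Fin a) ℤ, (∀ y x, |M y x| ≤ k) →
      ∀ v : Fin a → ℂ, ∃ v', (M.map (Int.cast : ℤ → ℂ)).mulVec v' =
        (M.map (Int.cast : ℤ → ℂ)).mulVec v ∧
        ‖v'‖ ≤ C * ‖(M.map (Int.cast : ℤ → ℂ)).mulVec v‖ := by
  let Idx := Σ a c : Fin (p + 1), (Fin c → Fin a → Finset.Icc (-(k : ℤ)) k)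
  let mat : ∀ q : Idx, Matrix (Fin q.2.1) (Fin q.1) ℤ := fun q y x => (q.2.2 y x : ℤ)
  choose C hC0 hC using fun q : Idx =>
    exists_bounded_preimage (((mat q).map (Int.cast : ℤ → ℂ)).mulVecLin)
  obtain ⟨B, hB⟩ := (Set.finite_range C).bddAbove
  refine ⟨max B 0, le_max_right _ _, fun a c ha hc M hM v => ?_⟩
  obtain ⟨v', h1, h2⟩ := hC ⟨⟨a, Nat.lt_succ_of_le ha⟩, ⟨c, Nat.lt_succ_of_le hc⟩, fun y x =>
    ⟨M y x, Finset.mem_Icc.2 (abs_le.1 (hM y x))⟩⟩ v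
  exact ⟨v', h1, h2.trans (mul_le_mul_of_nonneg_right
    ((hB (Set.mem_range_self _)).trans (le_max_left _ _)) (norm_nonneg _))⟩

variable {P : RootPairing ι ℝ E N}

/-- Makes it possible to count the cells in a box by integer vectors. -/
lemma closedFacet_eq_of_floor_eq {x y : E} (h : ∀ i, ⌊P.coroot' i x⌋ = ⌊P.coroot' i y⌋) :
    closedFacet P x = closedFacet P y := by
  have key : ∀ a, 0 ≤ affineRoot P a x ↔ 0 ≤ affineRoot P a y := by
    rintro ⟨i, k⟩
    have h1 : ∀ z : E, 0 ≤ affineRoot P (i, k) z ↔ -k ≤ ⌊P.coroot' i z⌋ := by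
      intro z
      rw [Int.le_floor, affineRoot, Int.cast_neg, neg_le_iff_add_nonneg]
    rw [h1, h1, h]
  ext z
  exact forall_congr' fun a => by rw [key a]

/-- `K` is contained in a box with sides of length `L` and integral bounds. -/
def InBox (P : RootPairing ι ℝ E N) (L : ℕ) (K : Set E) : Prop :=
  ∃ m : ι → ℤ, ∀ x ∈ K, ∀ i, (m i : ℝ) ≤ P.coroot' i x ∧ P.coroot' i x ≤ m i + L

lemma InBox.mono {L : ℕ} {K K' : Set E} (h : InBox P L K) (hK : K' ⊆ K) : InBox P L K' :=
  h.imp fun _ hm x hx => hm x (hK hx)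

lemma InBox.finite_cells [Fintype ι] {L : ℕ} {K : Set E} (h : InBox P L K) (n : ℕ) :
    {σ : Cell P n | σ.1 ⊆ K}.Finite ∧
      {σ : Cell P n | σ.1 ⊆ K}.ncard ≤ (L + 1) ^ Fintype.card ι := by
  obtain ⟨m, hm⟩ := h
  let pt : Cell P n → E := fun σ => σ.2.1.choose
  have hpt : ∀ σ : Cell P n, closedFacet P (pt σ) = σ.1 := fun σ => σ.2.1.choose_spec
  let F : Cell P n → ι → ℤ := fun σ i => ⌊P.coroot' i (pt σ)⌋ - m i
  let T : Finset (ι → ℤ) := Fintype.piFinset fun _ => Finset.Icc (0 : ℤ) L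
  have hF : ∀ σ ∈ {σ : Cell P n | σ.1 ⊆ K}, F σ ∈ (T : Set (ι → ℤ)) := by
    intro σ hσ
    have hmem : pt σ ∈ K := hσ (hpt σ ▸ Chart.self_mem_closedFacet P _)
    rw [Finset.mem_coe, Fintype.mem_piFinset]
    intro i
    obtain ⟨h1, h2⟩ := hm _ hmem i
    have h3 : m i ≤ ⌊P.coroot' i (pt σ)⌋ := Int.le_floor.2 h1
    have h4 : ⌊P.coroot' i (pt σ)⌋ ≤ m i + L := by
      have : (⌊P.coroot' i (pt σ)⌋ : ℝ) ≤ ((m i + L : ℤ) : ℝ) := by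
        push_cast
        exact (Int.floor_le _).trans h2
      exact_mod_cast this
    rw [Finset.mem_Icc]
    constructor <;> simp only [F] <;> omega
  have hinj : Set.InjOn F {σ : Cell P n | σ.1 ⊆ K} := by
    intro σ _ τ _ hστ
    apply Subtype.ext
    rw [← hpt σ, ← hpt τ]
    refine closedFacet_eq_of_floor_eq fun i => ?_
    have := congrFun hστ i
    simp only [F] at this
    omega
  refine ⟨Set.Finite.of_injOn hF hinj T.finite_toSet, ?_⟩
  have h1 := Set.ncard_le_ncard_of_injOn F hF hinj T.finite_toSet
  rw [Set.ncard_coe_finset, Fintype.card_piFinset] at h1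
  simpa using h1

variable {b : P.Base} (o : AlcoveOrientation b)
variable [Finite ι] [P.IsCrystallographic] [P.IsRootSystem] [P.IsReduced]

variable (b) in
/-- Cycles in acyclic sets of bounded size have fillings with bounded coefficients. -/
lemma exists_uniform_filling (L : ℕ) : ∃ C : ℝ, 0 ≤ C ∧ ∀ K : Set E, InBox P L K → IsAcyclic o K →
    ∀ n, ∀ z ∈ chainsOn P K n, z ∈ cycles o n → ∃ u ∈ chainsOn P K (n + 1), boundary o n u = z ∧
      ∀ B, 0 ≤ B → (∀ σ, ‖z σ‖ ≤ B) → ∀ τ, ‖u τ‖ ≤ C * B := by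
  have := Fintype.ofFinite ι
  obtain ⟨C, hC0, hC⟩ := exists_uniform_bounded_preimage ((L + 1) ^ Fintype.card ι)
    (Fintype.card (VertexIndex b))
  refine ⟨C, hC0, fun K hbox hK n z hz hcyc => ?_⟩
  obtain ⟨hfX, hcX⟩ := hbox.finite_cells (n + 1)
  obtain ⟨hfY, hcY⟩ := hbox.finite_cells n
  have := hfX.fintype
  have := hfY.fintype
  let eX := Fintype.equivFin {σ : Cell P (n + 1) | σ.1 ⊆ K}
  let eY := Fintype.equivFin {σ : Cell P n | σ.1 ⊆ K}
  rw [← Nat.card_coe_set_eq, Nat.card_eq_fintype_card] at hcX hcY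
  obtain ⟨u, hu, rfl⟩ := hK.2 n z hz hcyc
  choose M hM1 hM2 using fun y x => boundary_single_apply_mem b o (eX.symm x).1 (eY.symm y).1
  let lift : (Fin (Fintype.card {σ : Cell P (n + 1) | σ.1 ⊆ K}) → ℂ) → Chain P (n + 1) :=
    fun v => ∑ x, Finsupp.single (eX.symm x).1 (v x)
  have hlift : ∀ v, lift v ∈ chainsOn P K (n + 1) := fun v =>
    Submodule.sum_mem _ fun x _ => single_mem_chainsOn (eX.symm x).2 _
  have hmul : ∀ v y, (Matrix.map M (Int.cast : ℤ → ℂ)).mulVec v y =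
      boundary o n (lift v) (eY.symm y).1 := by
    intro v y
    simp only [lift, map_sum, Matrix.mulVec, dotProduct, Finsupp.finsetSum_apply]
    refine Finset.sum_congr rfl fun x _ => ?_
    rw [← mul_one (v x), ← smul_eq_mul (v x) 1, ← Finsupp.smul_single, map_smul,
      Finsupp.smul_apply, hM2, smul_eq_mul, smul_eq_mul, mul_one, mul_comm]
    rfl
  have hval : ∀ v x, lift v (eX.symm x).1 = v x := by
    intro v x
    rw [Finsupp.finsetSum_apply, Finset.sum_eq_single x, Finsupp.single_eq_same]
    · intro x' _ hne
      rw [Finsupp.single_eq_of_ne]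
      intro h
      exact hne (eX.symm.injective (Subtype.ext h.symm))
    · simp
  have hout : ∀ (v) (τ : Cell P (n + 1)), ¬τ.1 ⊆ K → lift v τ = 0 := by
    intro v τ hτ
    by_contra h
    exact hτ (mem_chainsOn.1 (hlift v) τ h)
  -- Acyclicity only supplies some filling `u`; it is replaced by a bounded one with the same
  -- boundary.
  obtain ⟨v', h1, h2⟩ := hC _ _ hcX hcY M hM1 fun x => u (eX.symm x).1
  have hlu : lift (fun x => u (eX.symm x).1) = u := by
    ext τ
    by_cases hτ : τ.1 ⊆ K
    · have := hval (fun x => u (eX.symm x).1) (eX ⟨τ, hτ⟩)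
      rwa [Equiv.symm_apply_apply] at this
    · rw [hout _ _ hτ]
      by_contra h
      exact hτ (mem_chainsOn.1 hu τ (Ne.symm h))
  refine ⟨lift v', hlift v', ?_, fun B hB0 hB τ => ?_⟩
  · ext σ
    by_cases hσ : σ.1 ⊆ K
    · have h3 := congrFun h1 (eY ⟨σ, hσ⟩)
      rwa [hmul, hmul, hlu, Equiv.symm_apply_apply] at h3
    · have h3 : ∀ w ∈ chainsOn P K (n + 1), boundary o n w σ = 0 := by
        intro w hw
        by_contra h
        exact hσ (mem_chainsOn.1 (boundary_mem_chainsOn o hw) σ h)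
      rw [h3 _ (hlift v'), h3 _ hu]
  · by_cases hτ : τ.1 ⊆ K
    · have h3 := hval v' (eX ⟨τ, hτ⟩)
      rw [Equiv.symm_apply_apply] at h3
      change lift v' τ = _ at h3
      rw [h3]
      refine (norm_le_pi_norm v' _).trans (h2.trans (mul_le_mul_of_nonneg_left ?_ hC0))
      rw [pi_norm_le_iff_of_nonneg hB0]
      intro y
      rw [hmul, hlu]
      exact hB _
    · rw [hout _ _ hτ, norm_zero]
      exact mul_nonneg hC0 hB0

end UniformBounds

/-! ### Integral hulls and radial retractions -/

section Retractions

/-- The intersection of all half-spaces bounded by hyperplanes of the arrangement that contain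
`K`. -/
def integralHull (P : RootPairing ι ℝ E N) (K : Set E) : Set E :=
  {x | ∀ (i : ι) (m : ℤ), (∀ y ∈ K, (m : ℝ) ≤ P.coroot' i y) → (m : ℝ) ≤ P.coroot' i x}

variable (P : RootPairing ι ℝ E N)

lemma subset_integralHull (K : Set E) : K ⊆ integralHull P K := fun x hx _ _ h => h x hx

lemma integralHull_mono {K K' : Set E} (h : K ⊆ K') : integralHull P K ⊆ integralHull P K' :=
  fun _ hx i m hm => hx i m fun y hy => hm y (h hy)

lemma integralHull_upper {K : Set E} {x : E} (hx : x ∈ integralHull P K) {i : ι} {m : ℤ}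
    (h : ∀ y ∈ K, P.coroot' i y ≤ m) : P.coroot' i x ≤ m := by
  have h1 := hx (opp P i) (-m) fun y hy => by
    rw [coroot'_opp, Int.cast_neg]
    exact neg_le_neg (h y hy)
  rw [coroot'_opp, Int.cast_neg] at h1
  exact neg_le_neg_iff.1 h1

variable {P} in
lemma InBox.exists_integralHull_eq {L : ℕ} {K : Set E} (h : InBox P L K) (hK : K.Nonempty) :
    ∃ m, AlcoveComplex.integralHull P K = polyhedron P m := by
  obtain ⟨m, hm⟩ := h
  obtain ⟨x, hx⟩ := hK
  have key : ∀ i, ∃ k : ℤ, (∀ y ∈ K, (k : ℝ) ≤ P.coroot' i y) ∧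
      ∀ l : ℤ, (∀ y ∈ K, (l : ℝ) ≤ P.coroot' i y) → l ≤ k := by
    intro i
    refine Int.exists_greatest_of_bdd ⟨⌊P.coroot' i x⌋, fun l hl => Int.le_floor.2 (hl x hx)⟩
      ⟨m i, fun y hy => (hm y hy i).1⟩
  choose k hk1 hk2 using key
  refine ⟨k, Set.Subset.antisymm (fun y hy i => hy i _ (hk1 i)) fun y hy i l hl => ?_⟩
  exact le_trans (by exact_mod_cast hk2 i l hl) (hy i)

lemma exists_int_bounds (x : E) (i : ι) : ∃ m : ℤ, ∀ y ∈ closedFacet P x,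
    (m : ℝ) ≤ P.coroot' i y ∧ P.coroot' i y ≤ m + 1 := by
  refine ⟨⌊P.coroot' i x⌋, fun y hy => ⟨?_, ?_⟩⟩
  · have h := hy (i, -⌊P.coroot' i x⌋) (by
      simp only [affineRoot, Int.cast_neg]
      linarith [Int.floor_le (P.coroot' i x)])
    simp only [affineRoot, Int.cast_neg] at h
    linarith
  · have h := hy (opp P i, ⌊P.coroot' i x⌋ + 1) (by
      simp only [affineRoot, coroot'_opp]
      push_cast
      linarith [Int.lt_floor_add_one (P.coroot' i x)])
    simp only [affineRoot, coroot'_opp] at h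
    push_cast at h
    linarith

variable [Fintype ι]

/-- The coordinates given by the coroots. -/
def corootMap : E →ₗ[ℝ] (ι → ℝ) := LinearMap.pi P.coroot'

lemma corootMap_apply (x : E) (i : ι) : corootMap P x i = P.coroot' i x := rfl

lemma abs_coroot'_le (x : E) (i : ι) : |P.coroot' i x| ≤ ‖corootMap P x‖ :=
  norm_le_pi_norm (corootMap P x) i

lemma norm_corootMap_sub_le {σ : Set E} (hσ : σ ∈ polysimplices P) {x y : E} (hx : x ∈ σ)
    (hy : y ∈ σ) : ‖corootMap P x - corootMap P y‖ ≤ 1 := by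
  obtain ⟨z, rfl⟩ := hσ
  rw [pi_norm_le_iff_of_nonneg zero_le_one]
  intro i
  obtain ⟨m, hm⟩ := exists_int_bounds P z i
  have h1 := hm x hx
  have h2 := hm y hy
  rw [Pi.sub_apply, corootMap_apply, corootMap_apply, Real.norm_eq_abs, abs_le]
  constructor <;> linarith

lemma eq_zero_of_norm_corootMap [P.IsRootSystem] {x : E} (h : ‖corootMap P x‖ = 0) : x = 0 := by
  rw [norm_eq_zero] at h
  refine ext_of_coroot' P fun i => ?_
  rw [map_zero]
  exact congrFun h i

/-- Radial retraction by the distance `t`. -/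
def shrink (t : ℝ) (x : E) : E := max 0 (1 - t / ‖corootMap P x‖) • x

lemma shrink_zero (x : E) : shrink P 0 x = x := by simp [shrink]

lemma norm_shrink {t : ℝ} (ht : 0 ≤ t) (x : E) :
    ‖corootMap P (shrink P t x)‖ = max 0 (‖corootMap P x‖ - t) := by
  rw [shrink, map_smul, norm_smul, Real.norm_of_nonneg (le_max_left _ _),
    max_mul_of_nonneg _ _ (norm_nonneg _), zero_mul]
  -- If the norm is `0`, then `t / 0 = 0` makes the scaling factor `1`, which is harmless.
  rcases (norm_nonneg (corootMap P x)).eq_or_lt with h | h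
  · rw [← h]
    simp [ht]
  · rw [sub_mul, one_mul, div_mul_cancel₀ _ h.ne']

lemma shrink_eq_zero [P.IsRootSystem] {t : ℝ} (ht : 0 ≤ t) {x : E} (h : ‖corootMap P x‖ ≤ t) :
    shrink P t x = 0 := by
  apply eq_zero_of_norm_corootMap P
  rw [norm_shrink P ht, max_eq_left (by linarith)]

lemma exists_shrink_eq_smul {t : ℝ} (ht : 0 ≤ t) (x : E) :
    ∃ c : ℝ, 0 ≤ c ∧ c ≤ 1 ∧ shrink P t x = c • x :=
  ⟨_, le_max_left _ _, max_le zero_le_one (by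
    have : 0 ≤ t / ‖corootMap P x‖ := by positivity
    linarith), rfl⟩

lemma shrink_mem_integralHull {t : ℝ} (ht : 0 ≤ t) {K : Set E} {x : E} (hx : x ∈ K) :
    shrink P t x ∈ integralHull P (K ∪ {0}) := by
  intro i m hm
  obtain ⟨c, hc0, hc1, h⟩ := exists_shrink_eq_smul P ht x
  have h1 := hm x (Or.inl hx)
  have h2 := hm 0 (Or.inr rfl)
  rw [map_zero] at h2
  rw [h, map_smul, smul_eq_mul]
  nlinarith

lemma norm_shrink_sub_shrink_le {s t : ℝ} (hs : 0 ≤ s) (hst : s ≤ t) (x : E) :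
    ‖corootMap P (shrink P s x) - corootMap P (shrink P t x)‖ ≤ t - s := by
  have h0 := norm_nonneg (corootMap P x)
  have h1 : max 0 (1 - t / ‖corootMap P x‖) ≤ max 0 (1 - s / ‖corootMap P x‖) :=
    max_le_max le_rfl (sub_le_sub_left (div_le_div_of_nonneg_right hst h0) _)
  have h2 := norm_shrink P hs x
  have h3 := norm_shrink P (hs.trans hst) x
  rw [← map_sub, shrink, shrink, ← sub_smul, map_smul, norm_smul,
    Real.norm_of_nonneg (sub_nonneg.2 h1), sub_mul]
  rw [shrink, map_smul, norm_smul, Real.norm_of_nonneg (le_max_left _ _)] at h2 h3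
  rw [h2, h3]
  rcases max_cases 0 (‖corootMap P x‖ - s) with ⟨h4, h5⟩ | ⟨h4, h5⟩ <;>
  rcases max_cases 0 (‖corootMap P x‖ - t) with ⟨h6, h7⟩ | ⟨h6, h7⟩ <;> linarith

/-- What matters is a Lipschitz constant independent of `t`: the images of cells under all the
retractions have bounded size. -/
lemma norm_shrink_sub_le {t : ℝ} (ht : 0 ≤ t) (x y : E) :
    ‖corootMap P (shrink P t x) - corootMap P (shrink P t y)‖ ≤
      3 * ‖corootMap P x - corootMap P y‖ := by
  set u := corootMap P x with hu
  set v := corootMap P y with hv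
  have hd := norm_nonneg (u - v)
  have h1 := norm_sub_norm_le u v
  have h2 := norm_sub_norm_le v u
  rw [norm_sub_rev] at h2
  by_cases hx : ‖u‖ ≤ t
  · have h3 : corootMap P (shrink P t x) = 0 := by
      rw [← norm_eq_zero, norm_shrink P ht, ← hu, max_eq_left (by linarith)]
    rw [h3, zero_sub, norm_neg, norm_shrink P ht, ← hv]
    exact max_le (by positivity) (by linarith)
  by_cases hy : ‖v‖ ≤ t
  · have h3 : corootMap P (shrink P t y) = 0 := by
      rw [← norm_eq_zero, norm_shrink P ht, ← hv, max_eq_left (by linarith)]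
    rw [h3, sub_zero, norm_shrink P ht, ← hu]
    exact max_le (by positivity) (by linarith)
  push Not at hx hy
  have hu0 : 0 < ‖u‖ := ht.trans_lt hx
  have hv0 : 0 < ‖v‖ := ht.trans_lt hy
  have hx' : t / ‖u‖ ≤ 1 := (div_le_one hu0).2 hx.le
  have hy' : t / ‖v‖ ≤ 1 := (div_le_one hv0).2 hy.le
  rw [shrink, shrink, map_smul, map_smul, ← hu, ← hv, max_eq_right (by linarith),
    max_eq_right (by linarith)]
  have h3 : (1 - t / ‖u‖) • u - (1 - t / ‖v‖) • v =
      (1 - t / ‖u‖) • (u - v) + (t / ‖v‖ - t / ‖u‖) • v := by module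
  rw [h3]
  refine (norm_add_le _ _).trans ?_
  rw [norm_smul, norm_smul, Real.norm_of_nonneg (by linarith), Real.norm_eq_abs]
  have h4 : |t / ‖v‖ - t / ‖u‖| * ‖v‖ = t / ‖u‖ * |‖u‖ - ‖v‖| := by
    rw [← abs_of_pos hv0, ← abs_mul, abs_of_pos hv0, ← abs_of_nonneg (by positivity : 0 ≤ t / ‖u‖),
      ← abs_mul, abs_of_nonneg (by positivity : 0 ≤ t / ‖u‖)]
    congr 1
    field_simp
  rw [h4]
  have h5 : |‖u‖ - ‖v‖| ≤ ‖u - v‖ := abs_norm_sub_norm_le u v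
  have h6 : t / ‖u‖ * |‖u‖ - ‖v‖| ≤ 1 * ‖u - v‖ := by gcongr
  have h7 : (1 - t / ‖u‖) * ‖u - v‖ ≤ 1 * ‖u - v‖ := by
    gcongr
    have : 0 ≤ t / ‖u‖ := by positivity
    linarith
  linarith

/-- The set that carries the homotopy between the `k`-th and the `k + 1`-st retraction. -/
def shrinkCarrier (k : ℕ) (K : Set E) : Set E :=
  integralHull P (shrink P k '' K ∪ shrink P (k + 1 : ℕ) '' K)

lemma shrinkCarrier_mono (k : ℕ) {K K' : Set E} (h : K ⊆ K') :
    shrinkCarrier P k K ⊆ shrinkCarrier P k K' :=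
  integralHull_mono P (Set.union_subset_union (Set.image_mono h) (Set.image_mono h))

lemma shrinkCarrier_subset (k : ℕ) (K : Set E) :
    shrinkCarrier P k K ⊆ integralHull P (K ∪ {0}) := by
  have h : shrink P k '' K ∪ shrink P (k + 1 : ℕ) '' K ⊆ integralHull P (K ∪ {0}) := by
    rintro _ (⟨x, hx, rfl⟩ | ⟨x, hx, rfl⟩) <;>
    exact shrink_mem_integralHull P (by positivity) hx
  intro x hx i m hm
  exact hx i m fun y hy => h hy i m hm

/-- Here `4 = 3 + 1`: the Lipschitz constant times the diameter bound `1` of a cell, plus one step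
of the retraction. -/
lemma norm_sub_le_of_mem_shrink {σ : Set E} (hσ : σ ∈ polysimplices P) (k : ℕ) {x y : E}
    (hx : x ∈ σ) (hy : y ∈ shrink P k '' σ ∪ shrink P (k + 1 : ℕ) '' σ) :
    ‖corootMap P y - corootMap P (shrink P k x)‖ ≤ 4 := by
  have hk : (0 : ℝ) ≤ k := Nat.cast_nonneg k
  rcases hy with ⟨z, hz, rfl⟩ | ⟨z, hz, rfl⟩
  · have h1 := norm_shrink_sub_le P hk z x
    have h2 := norm_corootMap_sub_le P hσ hz hx
    linarith
  · have h1 := norm_shrink_sub_le P hk z x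
    have h2 := norm_corootMap_sub_le P hσ hz hx
    have h3 := norm_shrink_sub_shrink_le P hk (t := (k + 1 : ℕ)) (by push_cast; linarith) z
    have h4 := norm_sub_le_norm_sub_add_norm_sub (corootMap P (shrink P (k + 1 : ℕ) z))
      (corootMap P (shrink P k z)) (corootMap P (shrink P k x))
    rw [norm_sub_rev] at h3
    push_cast at h3 h4 ⊢
    linarith

/-- Values within `4` of a number in `[m, m + 1)` lie in `[m - 4, m + 5]`, of length `9`; as the
ends are integers, passing to the integral hull does not leave this interval. -/
lemma shrinkCarrier_bounds {σ : Set E} (hσ : σ ∈ polysimplices P) (k : ℕ) {x : E} (hx : x ∈ σ) :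
    ∀ y ∈ shrinkCarrier P k σ, ∀ i, ((⌊P.coroot' i (shrink P k x)⌋ - 4 : ℤ) : ℝ) ≤ P.coroot' i y ∧
      P.coroot' i y ≤ (⌊P.coroot' i (shrink P k x)⌋ - 4 : ℤ) + (9 : ℕ) := by
  intro y hy i
  have key : ∀ z ∈ shrink P k '' σ ∪ shrink P (k + 1 : ℕ) '' σ,
      |P.coroot' i z - P.coroot' i (shrink P k x)| ≤ 4 := by
    intro z hz
    rw [← map_sub]
    refine (abs_coroot'_le P _ i).trans ?_
    rw [map_sub]
    exact norm_sub_le_of_mem_shrink P hσ k hx hz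
  have h1 := Int.floor_le (P.coroot' i (shrink P k x))
  have h2 := Int.lt_floor_add_one (P.coroot' i (shrink P k x))
  constructor
  · refine hy i _ fun z hz => ?_
    have := abs_le.1 (key z hz)
    push_cast
    linarith
  · have := integralHull_upper P hy (i := i) (m := ⌊P.coroot' i (shrink P k x)⌋ - 4 + 9)
      fun z hz => by
        have := abs_le.1 (key z hz)
        push_cast
        linarith
    push_cast at this ⊢
    exact this

lemma inBox_shrinkCarrier {σ : Set E} (hσ : σ ∈ polysimplices P) (k : ℕ) :
    InBox P 9 (shrinkCarrier P k σ) := by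
  obtain ⟨x, rfl⟩ := id hσ
  exact ⟨_, shrinkCarrier_bounds P hσ k (Chart.self_mem_closedFacet P x)⟩

/-- Localises the `k`-th homotopy near a sphere whose radius decreases with `k`; hence few
homotopies reach a given cell. -/
lemma norm_sub_le_of_mem_shrinkCarrier {σ : Set E} (hσ : σ ∈ polysimplices P) (k : ℕ) {x y : E}
    (hx : x ∈ σ) (hy : y ∈ shrinkCarrier P k σ) :
    |‖corootMap P y‖ - max 0 (‖corootMap P x‖ - k)| ≤ 9 := by
  rw [← norm_shrink P (Nat.cast_nonneg k)]
  refine (abs_norm_sub_norm_le _ _).trans ?_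
  rw [pi_norm_le_iff_of_nonneg (by norm_num)]
  intro i
  have h := shrinkCarrier_bounds P hσ k hx y hy i
  have h1 := Int.floor_le (P.coroot' i (shrink P k x))
  have h2 := Int.lt_floor_add_one (P.coroot' i (shrink P k x))
  push_cast at h
  rw [Pi.sub_apply, corootMap_apply, corootMap_apply, Real.norm_eq_abs, abs_le]
  constructor <;> linarith

lemma integralHull_singleton_zero [P.IsRootSystem] : integralHull P {0} = {0} := by
  refine Set.Subset.antisymm (fun x hx => ?_) (subset_integralHull P _)
  refine ext_of_coroot' P fun i => ?_
  rw [map_zero]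
  refine le_antisymm ?_ ?_
  · have := integralHull_upper P hx (i := i) (m := 0) (by simp)
    simpa using this
  · have := hx i 0 (by simp)
    simpa using this

lemma integralHull_shrink_subset [P.IsRootSystem] {K : Set E} {k : ℕ}
    (h : ∀ x ∈ K, ‖corootMap P x‖ ≤ k) : integralHull P (shrink P k '' K) ⊆ {0} := by
  rw [← integralHull_singleton_zero P]
  apply integralHull_mono
  rintro _ ⟨x, hx, rfl⟩
  exact shrink_eq_zero P (Nat.cast_nonneg k) (h x hx)

/-- From this step on the homotopy has no room, so the sum over `k` is finite on each cell. -/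
lemma shrinkCarrier_subset_zero [P.IsRootSystem] {K : Set E} {k : ℕ}
    (h : ∀ x ∈ K, ‖corootMap P x‖ ≤ k) : shrinkCarrier P k K ⊆ {0} := by
  rw [← integralHull_singleton_zero P]
  apply integralHull_mono
  rintro _ (⟨x, hx, rfl⟩ | ⟨x, hx, rfl⟩)
  · exact shrink_eq_zero P (Nat.cast_nonneg k) (h x hx)
  · exact shrink_eq_zero P (Nat.cast_nonneg _) ((h x hx).trans (by push_cast; linarith))

variable {P} {b : P.Base} (o : AlcoveOrientation b)
variable [P.IsCrystallographic] [P.IsRootSystem] [P.IsReduced]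

lemma InBox.isAcyclic_integralHull {L : ℕ} {K : Set E} (h : InBox P L K) (hK : K.Nonempty) :
    IsAcyclic o (AlcoveComplex.integralHull P K) := by
  obtain ⟨m, hm⟩ := h.exists_integralHull_eq hK
  rw [hm]
  exact isAcyclic_polyhedron o (hm ▸ hK.mono (subset_integralHull P K))

lemma chainsOn_zero {K : Set E} (hK : K ⊆ {0}) {n : ℕ} {x : Chain P (n + 1)}
    (hx : x ∈ chainsOn P K (n + 1)) : x = 0 := by
  ext σ
  by_contra h
  have h1 := (mem_chainsOn.1 hx σ h).trans hK
  have h2 := σ.2.2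
  rw [setDim, vectorSpan_of_subsingleton ℝ (Set.subsingleton_singleton.anti h1),
    finrank_bot] at h2
  exact absurd h2 (by omega)

end Retractions

/-! ### Acyclic carriers -/

section Carriers

variable {P : RootPairing ι ℝ E N} {b : P.Base} (o : AlcoveOrientation b)

/-- An acyclic carrier with values of bounded size. -/
structure IsCarrier (L : ℕ) (car : Set E → Set E) : Prop where
  mono : ∀ {K K' : Set E}, K ⊆ K' → car K ⊆ car K'
  acyclic : ∀ σ ∈ polysimplices P, IsAcyclic o (car σ)
  inBox : ∀ σ ∈ polysimplices P, InBox P L (car σ)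

/-- The linear maps `g n` are carried by `car` and have coefficients bounded by `A n`. -/
structure IsCarried (car : Set E → Set E) (A : ℕ → ℝ) (d : ℕ)
    (g : ∀ n, Chain P n →ₗ[ℂ] Chain P (n + d)) : Prop where
  mem : ∀ n σ, g n (Finsupp.single σ 1) ∈ chainsOn P (car σ.1) (n + d)
  bound : ∀ n σ τ, ‖g n (Finsupp.single σ 1) τ‖ ≤ A n

/-- The maps `g n` form an augmentation preserving chain map. -/
structure IsChainMap (g : ∀ n, Chain P n →ₗ[ℂ] Chain P n) : Prop where
  augmentation : ∀ x, augmentation P (g 0 x) = augmentation P x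
  boundary : ∀ n x, boundary o n (g (n + 1) x) = g n (boundary o n x)

lemma map_mem_chainsOn {car : Set E → Set E} {n m : ℕ} {g : Chain P n →ₗ[ℂ] Chain P m}
    (hmono : ∀ {K K' : Set E}, K ⊆ K' → car K ⊆ car K')
    (h : ∀ σ, g (Finsupp.single σ 1) ∈ chainsOn P (car σ.1) m) {K : Set E} {x : Chain P n}
    (hx : x ∈ chainsOn P K n) : g x ∈ chainsOn P (car K) m :=
  map_mem_of_mem_supported (fun σ hσ => chainsOn_mono (hmono hσ) m (h σ)) hx

variable [Finite ι] [P.IsCrystallographic] [P.IsRootSystem] [P.IsReduced]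

lemma norm_map_boundary_single_apply_le {n m : ℕ} (g : Chain P n →ₗ[ℂ] Chain P m) {A : ℝ}
    (hA : 0 ≤ A) (hg : ∀ σ τ, ‖g (Finsupp.single σ 1) τ‖ ≤ A) (σ : Cell P (n + 1)) (τ : Cell P m) :
    ‖g (boundary o n (Finsupp.single σ 1)) τ‖ ≤ Fintype.card (VertexIndex b) * A :=
  norm_map_boundary_single_le b o (Finsupp.lapply τ ∘ₗ g) hA σ fun ρ _ => hg ρ τ

variable (b) in
-- Each vertex goes to some vertex of its carrier, and then `g (∂σ)` is filled inside `car σ`,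
-- degree by degree. A boundary has at most `D` terms and a filling costs a factor `C`, so the bound
-- grows by `C * D` in each degree and depends on `L` only, not on the carrier.
lemma exists_carried_chainMap (L : ℕ) : ∃ A : ℕ → ℝ, (∀ n, 0 ≤ A n) ∧
    ∀ car : Set E → Set E, IsCarrier o L car →
      ∃ g : ∀ n, Chain P n →ₗ[ℂ] Chain P n, IsChainMap o g ∧ IsCarried car A 0 g := by
  obtain ⟨C, hC0, hC⟩ := exists_uniform_filling b o L
  choose! fill hmem hbd hle using hC
  let D : ℝ := Fintype.card (VertexIndex b)
  let A : ℕ → ℝ := fun n => Nat.rec 1 (fun _ a => C * (D * a)) n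
  have hA : ∀ n, 0 ≤ A n := fun n => by
    induction n with
    | zero => exact zero_le_one
    | succ n ih =>
      change 0 ≤ C * (D * A n)
      positivity
  refine ⟨A, hA, fun car hcar => ?_⟩
  have : Nonempty (Cell P 0) := (isAcyclic_closedFacet o (0 : E)).1.nonempty
  choose! vert hvert using fun σ hσ => (hcar.acyclic σ hσ).1
  let g : ∀ n, Chain P n →ₗ[ℂ] Chain P n := fun n => Nat.rec
    (Finsupp.linearCombination ℂ fun σ : Cell P 0 => Finsupp.single (vert σ.1) (1 : ℂ))
    (fun n gn => Finsupp.linearCombination ℂ fun σ : Cell P (n + 1) =>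
      fill (car σ.1) n (gn (boundary o n (Finsupp.single σ 1)))) n
  have hg0 : ∀ σ, g 0 (Finsupp.single σ 1) = Finsupp.single (vert σ.1) 1 := fun σ => by
    change Finsupp.linearCombination ℂ _ _ = _
    rw [Finsupp.linearCombination_single, one_smul]
  have hgs : ∀ n σ, g (n + 1) (Finsupp.single σ 1) =
      fill (car σ.1) n (g n (boundary o n (Finsupp.single σ 1))) := fun n σ => by
    change Finsupp.linearCombination ℂ _ _ = _
    rw [Finsupp.linearCombination_single, one_smul]
  have haug : ∀ x, augmentation P (g 0 x) = augmentation P x := fun x => by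
    suffices h : augmentation P ∘ₗ g 0 = augmentation P from LinearMap.congr_fun h x
    ext1 σ
    ext1
    simp only [LinearMap.comp_apply, Finsupp.lsingle_apply]
    rw [hg0, augmentation_single, augmentation_single]
  have main : ∀ n, (∀ σ, g n (Finsupp.single σ 1) ∈ chainsOn P (car σ.1) n) ∧
      (∀ x ∈ cycles o n, g n x ∈ cycles o n) ∧ ∀ σ τ, ‖g n (Finsupp.single σ 1) τ‖ ≤ A n := by
    intro n
    induction n with
    | zero =>
      refine ⟨fun σ => ?_, fun x hx => ?_, fun σ τ => ?_⟩
      · rw [hg0]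
        exact single_mem_chainsOn (hvert σ.1 σ.2.1) 1
      · exact (haug x).trans hx
      · classical
        rw [hg0, Finsupp.single_apply]
        split_ifs
        · exact norm_one.le
        · exact norm_zero.trans_le zero_le_one
    | succ n ih =>
      obtain ⟨ih1, ih2, ih3⟩ := ih
      have h1 : ∀ σ : Cell P (n + 1),
          g n (boundary o n (Finsupp.single σ 1)) ∈ chainsOn P (car σ.1) n := fun σ =>
        map_mem_chainsOn hcar.mono ih1 (boundary_mem_chainsOn o (single_mem_chainsOn subset_rfl 1))
      have h2 : ∀ σ : Cell P (n + 1), g n (boundary o n (Finsupp.single σ 1)) ∈ cycles o n :=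
        fun σ => ih2 _ (boundary_mem_cycles o n _)
      have h3 : ∀ x, boundary o n (g (n + 1) x) = g n (boundary o n x) := fun x => by
        suffices h : boundary o n ∘ₗ g (n + 1) = g n ∘ₗ boundary o n from LinearMap.congr_fun h x
        ext1 σ
        ext1
        simp only [LinearMap.comp_apply, Finsupp.lsingle_apply]
        rw [hgs]
        exact hbd _ (hcar.inBox _ σ.2.1) (hcar.acyclic _ σ.2.1) n _ (h1 σ) (h2 σ)
      refine ⟨fun σ => ?_, fun x hx => ?_, fun σ τ => ?_⟩
      · rw [hgs]
        exact hmem _ (hcar.inBox _ σ.2.1) (hcar.acyclic _ σ.2.1) n _ (h1 σ) (h2 σ)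
      · change boundary o n (g (n + 1) x) = 0
        rw [h3, show boundary o n x = 0 from hx, map_zero]
      · rw [hgs]
        exact hle _ (hcar.inBox _ σ.2.1) (hcar.acyclic _ σ.2.1) n _ (h1 σ) (h2 σ) _
          (by have := hA n; positivity)
          (norm_map_boundary_single_apply_le o (g n) (hA n) ih3 σ) τ
  refine ⟨g, ⟨haug, fun n x => ?_⟩, fun n => (main n).1, fun n => (main n).2.2⟩
  suffices h : boundary o n ∘ₗ g (n + 1) = g n ∘ₗ boundary o n from LinearMap.congr_fun h x
  ext1 σ
  ext1
  simp only [LinearMap.comp_apply, Finsupp.lsingle_apply]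
  rw [hgs]
  exact hbd _ (hcar.inBox _ σ.2.1) (hcar.acyclic _ σ.2.1) n _
    (map_mem_chainsOn hcar.mono (main n).1
      (boundary_mem_chainsOn o (single_mem_chainsOn subset_rfl 1)))
    ((main n).2.1 _ (boundary_mem_cycles o n _))

variable (b) in
-- The same induction, filling `(f - g) σ - h (∂σ)`, which is a cycle in `car σ`; the bound `A` is
-- uniform in the carrier and in `f` and `g`.
lemma exists_carried_homotopy (L : ℕ) {B : ℕ → ℝ} (hB : ∀ n, 0 ≤ B n) :
    ∃ A : ℕ → ℝ, (∀ n, 0 ≤ A n) ∧ ∀ car : Set E → Set E, IsCarrier o L car →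
      ∀ f g : ∀ n, Chain P n →ₗ[ℂ] Chain P n, IsChainMap o f → IsChainMap o g →
        IsCarried car B 0 (fun n => f n - g n) →
        ∃ h : ∀ n, Chain P n →ₗ[ℂ] Chain P (n + 1), IsCarried car A 1 h ∧
          (∀ x, boundary o 0 (h 0 x) = f 0 x - g 0 x) ∧
          ∀ n x, boundary o (n + 1) (h (n + 1) x) + h n (boundary o n x) =
            f (n + 1) x - g (n + 1) x := by
  obtain ⟨C, hC0, hC⟩ := exists_uniform_filling b o L
  choose! fill hmem hbd hle using hC
  let D : ℝ := Fintype.card (VertexIndex b)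
  let A : ℕ → ℝ := fun n => Nat.rec (C * B 0) (fun n a => C * (B (n + 1) + D * a)) n
  have hA : ∀ n, 0 ≤ A n := fun n => by
    induction n with
    | zero => exact mul_nonneg hC0 (hB 0)
    | succ n ih =>
      change 0 ≤ C * (B (n + 1) + D * A n)
      have := hB (n + 1)
      positivity
  refine ⟨A, hA, fun car hcar f g hf hg hfg => ?_⟩
  let h : ∀ n, Chain P n →ₗ[ℂ] Chain P (n + 1) := fun n => Nat.rec
    (Finsupp.linearCombination ℂ fun σ : Cell P 0 =>
      fill (car σ.1) 0 ((f 0 - g 0) (Finsupp.single σ 1)))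
    (fun n hn => Finsupp.linearCombination ℂ fun σ : Cell P (n + 1) =>
      fill (car σ.1) (n + 1) ((f (n + 1) - g (n + 1)) (Finsupp.single σ 1) -
        hn (boundary o n (Finsupp.single σ 1)))) n
  have hh0 : ∀ σ, h 0 (Finsupp.single σ 1) =
      fill (car σ.1) 0 ((f 0 - g 0) (Finsupp.single σ 1)) := fun σ => by
    change Finsupp.linearCombination ℂ _ _ = _
    rw [Finsupp.linearCombination_single, one_smul]
  have hhs : ∀ n σ, h (n + 1) (Finsupp.single σ 1) = fill (car σ.1) (n + 1)
      ((f (n + 1) - g (n + 1)) (Finsupp.single σ 1) - h n (boundary o n (Finsupp.single σ 1))) :=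
    fun n σ => by
      change Finsupp.linearCombination ℂ _ _ = _
      rw [Finsupp.linearCombination_single, one_smul]
  have hcyc0 : ∀ x, (f 0 - g 0) x ∈ cycles o 0 := fun x => by
    change augmentation P _ = 0
    rw [LinearMap.sub_apply, map_sub, hf.augmentation, hg.augmentation, sub_self]
  have hbd0 : ∀ x, boundary o 0 (h 0 x) = (f 0 - g 0) x := fun x => by
    suffices e : boundary o 0 ∘ₗ h 0 = f 0 - g 0 from LinearMap.congr_fun e x
    ext1 σ
    ext1
    simp only [LinearMap.comp_apply, Finsupp.lsingle_apply]
    rw [hh0]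
    exact hbd _ (hcar.inBox _ σ.2.1) (hcar.acyclic _ σ.2.1) 0 _ (hfg.mem 0 σ) (hcyc0 _)
  have main : ∀ n, (∀ σ, h n (Finsupp.single σ 1) ∈ chainsOn P (car σ.1) (n + 1)) ∧
      (∀ x ∈ cycles o n, boundary o n (h n x) = (f n - g n) x) ∧
      ∀ σ τ, ‖h n (Finsupp.single σ 1) τ‖ ≤ A n := by
    intro n
    induction n with
    | zero =>
      refine ⟨fun σ => ?_, fun x _ => hbd0 x, fun σ τ => ?_⟩
      · rw [hh0]
        exact hmem _ (hcar.inBox _ σ.2.1) (hcar.acyclic _ σ.2.1) 0 _ (hfg.mem 0 σ) (hcyc0 _)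
      · rw [hh0]
        exact hle _ (hcar.inBox _ σ.2.1) (hcar.acyclic _ σ.2.1) 0 _ (hfg.mem 0 σ) (hcyc0 _) _
          (hB 0) (hfg.bound 0 σ) τ
    | succ n ih =>
      obtain ⟨ih1, ih2, ih3⟩ := ih
      have h1 : ∀ σ : Cell P (n + 1), (f (n + 1) - g (n + 1)) (Finsupp.single σ 1) -
          h n (boundary o n (Finsupp.single σ 1)) ∈ chainsOn P (car σ.1) (n + 1) := fun σ =>
        sub_mem (hfg.mem (n + 1) σ) (map_mem_chainsOn hcar.mono ih1
          (boundary_mem_chainsOn o (single_mem_chainsOn subset_rfl 1)))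
      have h2 : ∀ σ : Cell P (n + 1), (f (n + 1) - g (n + 1)) (Finsupp.single σ 1) -
          h n (boundary o n (Finsupp.single σ 1)) ∈ cycles o (n + 1) := fun σ => by
        change boundary o n _ = 0
        rw [map_sub, ih2 _ (boundary_mem_cycles o n _), LinearMap.sub_apply, LinearMap.sub_apply,
          map_sub, hf.boundary, hg.boundary, sub_self]
      have h3 : ∀ x, boundary o (n + 1) (h (n + 1) x) =
          (f (n + 1) - g (n + 1)) x - h n (boundary o n x) := fun x => by
        suffices e : boundary o (n + 1) ∘ₗ h (n + 1) =
          (f (n + 1) - g (n + 1)) - h n ∘ₗ boundary o n from LinearMap.congr_fun e x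
        ext1 σ
        ext1
        simp only [LinearMap.comp_apply, Finsupp.lsingle_apply]
        rw [hhs]
        exact hbd _ (hcar.inBox _ σ.2.1) (hcar.acyclic _ σ.2.1) (n + 1) _ (h1 σ) (h2 σ)
      refine ⟨fun σ => ?_, fun x hx => ?_, fun σ τ => ?_⟩
      · rw [hhs]
        exact hmem _ (hcar.inBox _ σ.2.1) (hcar.acyclic _ σ.2.1) (n + 1) _ (h1 σ) (h2 σ)
      · rw [h3, show boundary o n x = 0 from hx, map_zero, sub_zero]
      · rw [hhs]
        refine hle _ (hcar.inBox _ σ.2.1) (hcar.acyclic _ σ.2.1) (n + 1) _ (h1 σ) (h2 σ)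
          (B (n + 1) + D * A n) (by have := hA n; have := hB (n + 1); positivity)
          (fun ρ => ?_) τ
        rw [Finsupp.sub_apply]
        exact (norm_sub_le _ _).trans (add_le_add (hfg.bound (n + 1) σ ρ)
          (norm_map_boundary_single_apply_le o (h n) (hA n) ih3 σ ρ))
  refine ⟨h, ⟨fun n => (main n).1, fun n => (main n).2.2⟩, hbd0, fun n x => ?_⟩
  suffices e : boundary o (n + 1) ∘ₗ h (n + 1) + h n ∘ₗ boundary o n =
    f (n + 1) - g (n + 1) from LinearMap.congr_fun e x
  ext1 σ
  ext1
  simp only [LinearMap.comp_apply, LinearMap.add_apply, Finsupp.lsingle_apply]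
  rw [← eq_sub_iff_add_eq, hhs]
  refine hbd _ (hcar.inBox _ σ.2.1) (hcar.acyclic _ σ.2.1) (n + 1) _
    (sub_mem (hfg.mem (n + 1) σ) (map_mem_chainsOn hcar.mono (main n).1
      (boundary_mem_chainsOn o (single_mem_chainsOn subset_rfl 1)))) ?_
  change boundary o n _ = 0
  rw [map_sub, (main n).2.1 _ (boundary_mem_cycles o n _), LinearMap.sub_apply,
    LinearMap.sub_apply, map_sub, hf.boundary, hg.boundary, sub_self]

end Carriers

/-! ### The contraction -/

section Contraction

variable [Fintype ι] {P : RootPairing ι ℝ E N} [P.IsCrystallographic] [P.IsRootSystem]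
  [P.IsReduced] {b : P.Base} (o : AlcoveOrientation b)

lemma isCarrier_shrinkCarrier (k : ℕ) : IsCarrier o 9 (shrinkCarrier P k) where
  mono h := shrinkCarrier_mono P k h
  acyclic := by
    rintro _ ⟨x, rfl⟩
    exact ((inBox_shrinkCarrier P (Set.mem_range_self x) k).mono
      (subset_integralHull P _)).isAcyclic_integralHull o
        ⟨_, Or.inl ⟨x, Chart.self_mem_closedFacet P x, rfl⟩⟩
  inBox σ hσ := inBox_shrinkCarrier P hσ k

lemma isCarrier_integralHull_shrink (k : ℕ) :
    IsCarrier o 9 (fun K => integralHull P (shrink P k '' K)) where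
  mono h := integralHull_mono P (Set.image_mono h)
  acyclic := by
    rintro _ ⟨x, rfl⟩
    exact ((inBox_shrinkCarrier P (Set.mem_range_self x) k).mono
      (Set.subset_union_left.trans (subset_integralHull P _))).isAcyclic_integralHull o
        ⟨_, ⟨x, Chart.self_mem_closedFacet P x, rfl⟩⟩
  inBox σ hσ := (inBox_shrinkCarrier P hσ k).mono
    (integralHull_mono P Set.subset_union_left)

/-- Chain maps carried by the successive radial retractions, starting from the identity. -/
lemma exists_shrink_chainMaps : ∃ A : ℕ → ℝ, (∀ n, 0 ≤ A n) ∧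
    ∃ g : ℕ → ∀ n, Chain P n →ₗ[ℂ] Chain P n, (∀ k, IsChainMap o (g k)) ∧
      (∀ k : ℕ, IsCarried (fun K => integralHull P (shrink P k '' K)) A 0 (g k)) ∧
      ∀ n, g 0 n = LinearMap.id := by
  classical
  obtain ⟨A, hA, h⟩ := exists_carried_chainMap b o 9
  choose g hg1 hg2 using fun k => h _ (isCarrier_integralHull_shrink o k)
  -- For `k = 0` the identity is itself carried by the hulls, so it may replace the constructed map;
  -- its coefficients account for the `1`.
  refine ⟨fun n => max (A n) 1, fun n => (hA n).trans (le_max_left _ _),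
    fun k => if k = 0 then fun n => LinearMap.id else g k, fun k => ?_, fun k => ?_, fun n => rfl⟩
  · beta_reduce
    by_cases hk : k = 0
    · rw [if_pos hk]
      exact ⟨fun x => rfl, fun n x => rfl⟩
    · rw [if_neg hk]
      exact hg1 k
  · beta_reduce
    by_cases hk : k = 0
    · rw [if_pos hk]
      subst hk
      refine ⟨fun n σ => single_mem_chainsOn ?_ 1, fun n σ τ => ?_⟩
      · refine Set.Subset.trans ?_ (subset_integralHull P _)
        rintro x hx
        exact ⟨x, hx, by rw [Nat.cast_zero, shrink_zero]⟩
      · refine le_trans ?_ (le_max_right _ _)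
        rw [LinearMap.id_apply, Finsupp.single_apply]
        split_ifs
        · exact norm_one.le
        · exact norm_zero.trans_le zero_le_one
    · rw [if_neg hk]
      exact ⟨(hg2 k).mem, fun n σ τ => ((hg2 k).bound n σ τ).trans (le_max_left _ _)⟩

/-- The homotopies between the successive chain maps. -/
lemma exists_shrink_homotopies : ∃ A : ℕ → ℝ, (∀ n, 0 ≤ A n) ∧
    ∃ (g : ℕ → ∀ n, Chain P n →ₗ[ℂ] Chain P n) (h : ℕ → ∀ n, Chain P n →ₗ[ℂ] Chain P (n + 1)),
      (∀ k x, augmentation P (g k 0 x) = augmentation P x) ∧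
      (∀ (k : ℕ) n σ, g k n (Finsupp.single σ 1) ∈
        chainsOn P (integralHull P (shrink P k '' σ.1)) n) ∧
      (∀ n, g 0 n = LinearMap.id) ∧
      (∀ k : ℕ, IsCarried (shrinkCarrier P k) A 1 (h k)) ∧
      (∀ k x, boundary o 0 (h k 0 x) = g k 0 x - g (k + 1) 0 x) ∧
      ∀ k n x, boundary o (n + 1) (h k (n + 1) x) + h k n (boundary o n x) =
        g k (n + 1) x - g (k + 1) (n + 1) x := by
  obtain ⟨B, hB, g, hg, hgc, hg0⟩ := exists_shrink_chainMaps o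
  obtain ⟨A, hA, h⟩ := exists_carried_homotopy b o 9 (B := fun n => B n + B n)
    fun n => add_nonneg (hB n) (hB n)
  choose h hh1 hh2 hh3 using fun k => h _ (isCarrier_shrinkCarrier o k) (g k) (g (k + 1)) (hg k)
    (hg (k + 1)) ⟨fun n σ => sub_mem
      (chainsOn_mono (integralHull_mono P Set.subset_union_left) _ ((hgc k).mem n σ))
      (chainsOn_mono (integralHull_mono P Set.subset_union_right) _ ((hgc (k + 1)).mem n σ)),
      fun n σ τ => (norm_sub_le _ _).trans
        (add_le_add ((hgc k).bound n σ τ) ((hgc (k + 1)).bound n σ τ))⟩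
  exact ⟨A, hA, g, h, fun k => (hg k).augmentation, fun k => (hgc k).mem, hg0, hh1, hh2, hh3⟩

lemma card_le_of_abs_sub_le {F : Finset ℕ} {c : ℝ} (h : ∀ k ∈ F, |(k : ℝ) - c| ≤ 10) :
    F.card ≤ 21 := by
  rw [← Finset.card_map (Nat.castEmbedding (R := ℤ))]
  have hsub : F.map (Nat.castEmbedding (R := ℤ)) ⊆ Finset.Icc ⌈c - 10⌉ ⌊c + 10⌋ := by
    intro z hz
    obtain ⟨k, hk, rfl⟩ := Finset.mem_map.1 hz
    have := abs_le.1 (h k hk)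
    rw [Finset.mem_Icc, Int.ceil_le, Int.le_floor, Nat.castEmbedding_apply, Int.cast_natCast]
    constructor <;> linarith
  refine (Finset.card_le_card hsub).trans ?_
  rw [Int.card_Icc]
  have h1 := Int.floor_le (c + 10)
  have h2 := Int.le_ceil (c - 10)
  have : (⌊c + 10⌋ : ℝ) ≤ ((⌈c - 10⌉ + 20 : ℤ) : ℝ) := by
    push_cast
    linarith
  have : ⌊c + 10⌋ ≤ ⌈c - 10⌉ + 20 := by exact_mod_cast this
  omega

variable (P) in
/-- The origin, as a vertex. -/
def originCell : Cell P 0 := ⟨{0}, ⟨0, Set.Subset.antisymm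
    (fun x hx => ext_of_coroot' P fun i => by
      have h1 := hx (i, 0) (by simp [affineRoot])
      have h2 := hx (opp P i, 0) (by simp [affineRoot])
      simp only [affineRoot, Int.cast_zero, add_zero, coroot'_opp] at h1 h2
      rw [map_zero]
      linarith)
    (Set.singleton_subset_iff.2 (Chart.self_mem_closedFacet P 0))⟩, by
  rw [setDim, vectorSpan_singleton, finrank_bot]⟩

lemma eq_single_originCell {x : Chain P 0} (hx : x ∈ chainsOn P {0} 0) :
    x = Finsupp.single (originCell P) (augmentation P x) := by
  have h : x = Finsupp.single (originCell P) (x (originCell P)) := by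
    ext σ
    by_cases hσ : σ = originCell P
    · rw [hσ, Finsupp.single_eq_same]
    · rw [Finsupp.single_eq_of_ne hσ]
      by_contra h
      obtain ⟨y, hy⟩ := exists_eq_singleton σ
      have h1 := mem_chainsOn.1 hx σ h
      rw [hy, Set.singleton_subset_singleton] at h1
      exact hσ (Subtype.ext (by rw [hy, h1]; rfl))
  conv_rhs => rw [h, augmentation, Finsupp.linearCombination_single, smul_eq_mul, mul_one]
  exact h

lemma exists_norm_bound {σ : Set E} (hσ : σ ∈ polysimplices P) :
    ∃ K : ℕ, ∀ x ∈ σ, ‖corootMap P x‖ ≤ K := by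
  obtain ⟨x, rfl⟩ := id hσ
  refine ⟨⌈‖corootMap P x‖ + 1⌉₊, fun y hy => le_trans ?_ (Nat.le_ceil _)⟩
  have h1 := norm_corootMap_sub_le P hσ hy (Chart.self_mem_closedFacet P x)
  have h2 := norm_sub_norm_le (corootMap P y) (corootMap P x)
  linarith

/-- Only finitely many degrees occur, so degreewise bounds combine to a single one. -/
lemma card_le_of_cell (b : P.Base) {n : ℕ} (σ : Cell P n) : n ≤ Fintype.card (VertexIndex b) := by
  obtain ⟨C, -, J, hJ, h⟩ := exists_standard_face b σ.2.1
  have h1 := C.setDim_face hJ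
  rw [← h, σ.2.2] at h1
  have := Finset.card_le_univ J
  omega

/-- A contraction with controlled support and bounded coefficients, not yet equivariant. -/
lemma exists_contraction : ∃ γ : ∀ n : ℕ, Chain P n →ₗ[ℂ] Chain P (n + 1),
    IsContraction o (Finsupp.lsingle (originCell P)) γ ∧
    (∀ n σ, γ n (Finsupp.single σ 1) ∈ chainsOn P (integralHull P (σ.1 ∪ {0})) (n + 1)) ∧
    ∃ M : ℝ, ∀ n σ τ, ‖γ n (Finsupp.single σ 1) τ‖ < M := by
  classical
  obtain ⟨A, hA, g, h, hg1, hg2, hg0, hc, hbd0, hbd⟩ := exists_shrink_homotopies o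
  have hzero : ∀ n (σ : Cell P n) k, (∀ x ∈ σ.1, ‖corootMap P x‖ ≤ (k : ℕ)) →
      h k n (Finsupp.single σ 1) = 0 := fun n σ k hk =>
    chainsOn_zero (shrinkCarrier_subset_zero P hk) ((hc k).mem n σ)
  let γ : ∀ n : ℕ, Chain P n →ₗ[ℂ] Chain P (n + 1) := fun n =>
    Finsupp.linearCombination ℂ fun σ => ∑ᶠ k, h k n (Finsupp.single σ 1)
  have hγ : ∀ n (σ : Cell P n) (K : ℕ), (∀ x ∈ σ.1, ‖corootMap P x‖ ≤ K) →
      γ n (Finsupp.single σ 1) = ∑ k ∈ Finset.range K, h k n (Finsupp.single σ 1) := by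
    intro n σ K hK
    change Finsupp.linearCombination ℂ _ _ = _
    rw [Finsupp.linearCombination_single, one_smul]
    refine finsum_eq_sum_of_support_subset _ fun k hk => ?_
    by_contra hkK
    simp only [Finset.coe_range, Set.mem_Iio, not_lt] at hkK
    exact hk (hzero n σ k fun x hx => (hK x hx).trans (by exact_mod_cast hkK))
  have hγ' : ∀ n (S : Set E) (K : ℕ), (∀ x ∈ S, ‖corootMap P x‖ ≤ K) → ∀ z ∈ chainsOn P S n,
      γ n z = ∑ k ∈ Finset.range K, h k n z := by
    intro n S K hK z hz
    have := map_mem_of_mem_supported (f := γ n - ∑ k ∈ Finset.range K, h k n) (T := ⊥)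
      (fun σ (hσ : σ.1 ⊆ S) => by
        rw [Submodule.mem_bot, LinearMap.sub_apply, LinearMap.sum_apply, sub_eq_zero]
        exact hγ n σ K fun x hx => hK x (hσ hx)) hz
    rw [Submodule.mem_bot, LinearMap.sub_apply, LinearMap.sum_apply, sub_eq_zero] at this
    exact this
  -- At most 21 homotopies contribute to a coefficient, the sum of the `A n` dominates each of them,
  -- and the final `1` makes the inequality strict.
  refine ⟨γ, ⟨?_, ?_, fun n => ?_⟩, fun n σ => ?_, 21 * (∑ n ∈ Finset.range
    (Fintype.card (VertexIndex b) + 1), A n) + 1, fun n σ τ => ?_⟩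
  · ext
    simp only [LinearMap.comp_apply, Finsupp.lsingle_apply]
    rw [augmentation_single]
    rfl
  · ext1 σ
    ext1
    simp only [LinearMap.comp_apply, LinearMap.add_apply, Finsupp.lsingle_apply,
      LinearMap.id_apply]
    obtain ⟨K, hK⟩ := exists_norm_bound σ.2.1
    rw [hγ 0 σ K hK, map_sum]
    simp only [hbd0]
    -- The sum telescopes to `g 0 σ - g K σ`. The second term is supported at the origin and has the
    -- augmentation of `σ`.
    rw [Finset.sum_range_sub', hg0, LinearMap.id_apply,
      eq_single_originCell (chainsOn_mono (integralHull_shrink_subset P hK) 0 (hg2 K 0 σ)), hg1]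
    abel
  · ext1 σ
    ext1
    simp only [LinearMap.comp_apply, LinearMap.add_apply, Finsupp.lsingle_apply,
      LinearMap.id_apply]
    obtain ⟨K, hK⟩ := exists_norm_bound σ.2.1
    rw [hγ' n σ.1 K hK _ (boundary_mem_chainsOn o (single_mem_chainsOn subset_rfl 1)),
      hγ (n + 1) σ K hK, map_sum, ← Finset.sum_add_distrib]
    simp only [add_comm (h _ n _), hbd]
    -- In positive degree `g K σ` vanishes, as there are no cells of positive dimension in `{0}`.
    rw [Finset.sum_range_sub', hg0, LinearMap.id_apply,
      chainsOn_zero (integralHull_shrink_subset P hK) (hg2 K (n + 1) σ), sub_zero]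
  · obtain ⟨K, hK⟩ := exists_norm_bound σ.2.1
    rw [hγ n σ K hK]
    exact Submodule.sum_mem _ fun k _ =>
      chainsOn_mono (shrinkCarrier_subset P k _) _ ((hc k).mem n σ)
  · obtain ⟨K, hK⟩ := exists_norm_bound σ.2.1
    obtain ⟨x, hx⟩ := σ.2.1
    have hxσ : x ∈ σ.1 := hx ▸ Chart.self_mem_closedFacet P x
    obtain ⟨y, hy⟩ := τ.2.1
    have hyτ : y ∈ τ.1 := hy ▸ Chart.self_mem_closedFacet P y
    rw [hγ n σ K hK, Finsupp.finsetSum_apply, ← Finset.sum_filter_ne_zero]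
    -- If `k ≤ ‖x‖`, the localisation places `k` within `9` of `‖x‖ - ‖y‖`. Otherwise `‖y‖ ≤ 9` and
    -- `k < ‖x‖ + 1`, since later homotopies vanish; this gives the distance `10`.
    have hcard : ((Finset.range K).filter fun k => h k n (Finsupp.single σ 1) τ ≠ 0).card ≤ 21 := by
      refine card_le_of_abs_sub_le (c := ‖corootMap P x‖ - ‖corootMap P y‖) fun k hk => ?_
      have hne := (Finset.mem_filter.1 hk).2
      have h1 := norm_sub_le_of_mem_shrinkCarrier P σ.2.1 k hxσ
        (mem_chainsOn.1 ((hc k).mem n σ) τ hne hyτ)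
      have h2 : (k : ℝ) < ‖corootMap P x‖ + 1 := by
        by_contra! hle
        refine hne ?_
        rw [hzero n σ k fun z hz => ?_, Finsupp.zero_apply]
        have h3 := norm_corootMap_sub_le P σ.2.1 hz hxσ
        have h4 := norm_sub_norm_le (corootMap P z) (corootMap P x)
        linarith
      rw [abs_le] at h1 ⊢
      rcases max_cases 0 (‖corootMap P x‖ - k) with ⟨h4, h5⟩ | ⟨h4, h5⟩ <;> rw [h4] at h1 <;>
        constructor <;> linarith
    have hAn : A n ≤ ∑ n ∈ Finset.range (Fintype.card (VertexIndex b) + 1), A n :=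
      Finset.single_le_sum (f := A) (fun i _ => hA i)
        (Finset.mem_range.2 (Nat.lt_succ_of_le (card_le_of_cell b σ)))
    refine lt_of_le_of_lt ((norm_sum_le _ _).trans (Finset.sum_le_card_nsmul _ _ (A n)
      fun k _ => (hc k).bound n σ τ)) ?_
    rw [nsmul_eq_mul]
    have h5 : ((((Finset.range K).filter fun k => h k n (Finsupp.single σ 1) τ ≠ 0).card : ℕ) : ℝ)
        * A n ≤ 21 * A n := mul_le_mul_of_nonneg_right (by exact_mod_cast hcard) (hA n)
    linarith

end Contraction

/-! ### Averaging over the finite Weyl group -/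

section Averaging

variable {P : RootPairing ι ℝ E N}

lemma cellMap_mul (w v : P.weylGroup) {n : ℕ} (σ : Cell P n) :
    cellMap P (w * v) n σ = cellMap P w n (cellMap P v n σ) := by
  apply Subtype.ext
  change (fun y : E => (w * v) • y) '' σ.1 = (fun y : E => w • y) '' ((fun y : E => v • y) '' σ.1)
  rw [Set.image_image]
  simp only [mul_smul]

lemma cellMap_one {n : ℕ} (σ : Cell P n) : cellMap P 1 n σ = σ := by
  apply Subtype.ext
  change (fun y : E => (1 : P.weylGroup) • y) '' σ.1 = σ.1
  simp

lemma chainMap_mul (w v : P.weylGroup) {n : ℕ} (x : Chain P n) :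
    chainMap P (w * v) n x = chainMap P w n (chainMap P v n x) := by
  suffices h : chainMap P (w * v) n = chainMap P w n ∘ₗ chainMap P v n from LinearMap.congr_fun h x
  ext1 σ
  ext1
  simp only [LinearMap.comp_apply, Finsupp.lsingle_apply, chainMap_single, cellMap_mul]

lemma chainMap_one {n : ℕ} (x : Chain P n) : chainMap P 1 n x = x := by
  suffices h : chainMap P 1 n = LinearMap.id from LinearMap.congr_fun h x
  ext1 σ
  ext1
  simp only [LinearMap.comp_apply, Finsupp.lsingle_apply, chainMap_single, cellMap_one,
    LinearMap.id_apply]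

lemma chainMap_chainMap_inv (w : P.weylGroup) {n : ℕ} (x : Chain P n) :
    chainMap P w n (chainMap P w⁻¹ n x) = x := by
  rw [← chainMap_mul, mul_inv_cancel, chainMap_one]

lemma chainMap_apply (w : P.weylGroup) {n : ℕ} (x : Chain P n) (τ : Cell P n) :
    chainMap P w n x τ = x (cellMap P w⁻¹ n τ) := by
  have h : τ = cellMap P w n (cellMap P w⁻¹ n τ) := by
    rw [← cellMap_mul, mul_inv_cancel, cellMap_one]
  conv_lhs => rw [h]
  refine Finsupp.mapDomain_apply (fun σ ρ hσρ => ?_) x _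
  have := congrArg (cellMap P w⁻¹ n) hσρ
  rwa [← cellMap_mul, ← cellMap_mul, inv_mul_cancel, cellMap_one, cellMap_one] at this

lemma chainMap_mem_chainsOn (w : P.weylGroup) {n : ℕ} {K : Set E} {x : Chain P n}
    (hx : x ∈ chainsOn P K n) : chainMap P w n x ∈ chainsOn P ((fun y : E => w • y) '' K) n := by
  refine map_mem_of_mem_supported (fun σ hσ => ?_) hx
  rw [chainMap_single]
  exact single_mem_chainsOn (Set.image_mono hσ) 1

lemma image_integralHull_subset (w : P.weylGroup) (K : Set E) :
    (fun y : E => w • y) '' integralHull P K ⊆ integralHull P ((fun y : E => w • y) '' K) := by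
  rintro _ ⟨x, hx, rfl⟩ i m hm
  obtain ⟨j, -, hj⟩ := exists_index_smul P w i
  rw [hj]
  refine hx j m fun y hy => ?_
  rw [← hj]
  exact hm _ ⟨y, hy, rfl⟩

variable [Finite ι] [Fintype P.weylGroup] [P.IsCrystallographic] [P.IsRootSystem] [P.IsReduced]
  {b : P.Base} (o : AlcoveOrientation b)

/-- The average of the conjugates of a linear map under the finite Weyl group. -/
def average {n m : ℕ} (f : Chain P n →ₗ[ℂ] Chain P m) : Chain P n →ₗ[ℂ] Chain P m :=
  (Fintype.card P.weylGroup : ℂ)⁻¹ •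
    ∑ w : P.weylGroup, chainMap P w m ∘ₗ f ∘ₗ chainMap P w⁻¹ n

lemma average_apply {n m : ℕ} (f : Chain P n →ₗ[ℂ] Chain P m)
    (x : Chain P n) : average f x = (Fintype.card P.weylGroup : ℂ)⁻¹ •
      ∑ w : P.weylGroup, chainMap P w m (f (chainMap P w⁻¹ n x)) := by
  rw [average, LinearMap.smul_apply, LinearMap.sum_apply]
  rfl

lemma chainMap_average (w : P.weylGroup) {n m : ℕ} (f : Chain P n →ₗ[ℂ] Chain P m) :
    chainMap P w m ∘ₗ average f = average f ∘ₗ chainMap P w n := by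
  refine LinearMap.ext fun x => ?_
  rw [LinearMap.comp_apply, LinearMap.comp_apply, average_apply, average_apply, map_smul, map_sum]
  congr 1
  refine Fintype.sum_equiv (Equiv.mulLeft w) _ _ fun v => ?_
  rw [Equiv.coe_mulLeft, mul_inv_rev, ← chainMap_mul, ← chainMap_mul, mul_assoc, inv_mul_cancel,
    mul_one]

/-- The hull of `w⁻¹ σ ∪ {0}` is mapped by `w` into that of `σ ∪ {0}`, because `w` fixes the origin.
-/
lemma average_mem {n m : ℕ} {f : Chain P n →ₗ[ℂ] Chain P m}
    (hf : ∀ σ, f (Finsupp.single σ 1) ∈ chainsOn P (integralHull P (σ.1 ∪ {0})) m) (σ : Cell P n) :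
    average f (Finsupp.single σ 1) ∈ chainsOn P (integralHull P (σ.1 ∪ {0})) m := by
  rw [average_apply]
  refine Submodule.smul_mem _ _ (Submodule.sum_mem _ fun w _ => ?_)
  rw [chainMap_single]
  have h1 := chainMap_mem_chainsOn w (hf (cellMap P w⁻¹ n σ))
  refine chainsOn_mono ((image_integralHull_subset w _).trans (integralHull_mono P ?_)) m h1
  rintro _ ⟨_, ⟨y, hy, rfl⟩ | rfl, rfl⟩
  · refine Or.inl ?_
    change w • w⁻¹ • y ∈ σ.1
    rwa [smul_inv_smul]
  · exact Or.inr (smul_zero w)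

lemma norm_average_lt {n m : ℕ} {f : Chain P n →ₗ[ℂ] Chain P m} {M : ℝ}
    (hf : ∀ σ τ, ‖f (Finsupp.single σ 1) τ‖ < M) (σ : Cell P n) (τ : Cell P m) :
    ‖average f (Finsupp.single σ 1) τ‖ < M := by
  have hc : (0 : ℝ) < Fintype.card P.weylGroup := by exact_mod_cast Fintype.card_pos
  rw [average_apply, Finsupp.smul_apply, Finsupp.finsetSum_apply, norm_smul, norm_inv,
    Complex.norm_natCast, inv_mul_lt_iff₀ hc]
  refine (norm_sum_le _ _).trans_lt ((Finset.sum_lt_sum_of_nonempty Finset.univ_nonempty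
    fun w _ => ?_).trans_eq (by rw [Finset.sum_const, Finset.card_univ, nsmul_eq_mul]))
  rw [chainMap_single, chainMap_apply]
  exact hf _ _

lemma cellMap_originCell (w : P.weylGroup) : cellMap P w 0 (originCell P) = originCell P := by
  apply Subtype.ext
  change (fun y : E => w • y) '' {0} = {0}
  rw [Set.image_singleton, smul_zero]

/-- Boundary and augmentation are equivariant and the origin is fixed, so each conjugate of `γ` is a
contraction with the same `γ₀`. The conditions are affine in `γ`, so they pass to the average. -/
lemma IsContraction.average {γ : ∀ n : ℕ, Chain P n →ₗ[ℂ] Chain P (n + 1)}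
    (h : IsContraction o (Finsupp.lsingle (originCell P)) γ) :
    IsContraction o (Finsupp.lsingle (originCell P)) fun n => AlcoveComplex.average (γ n) := by
  have hc : (Fintype.card P.weylGroup : ℂ) ≠ 0 := by exact_mod_cast Fintype.card_ne_zero
  refine ⟨h.degree_neg_one, LinearMap.ext fun x => ?_, fun n => LinearMap.ext fun x => ?_⟩
  · have h1 : ∀ w : P.weylGroup, chainMap P w 0 (boundary o 0 (γ 0 (chainMap P w⁻¹ 0 x))) =
        x - Finsupp.single (originCell P) (augmentation P x) := fun w => by
      have h2 := LinearMap.congr_fun h.degree_zero (chainMap P w⁻¹ 0 x)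
      simp only [LinearMap.add_apply, LinearMap.comp_apply, LinearMap.id_apply,
        Finsupp.lsingle_apply] at h2
      rw [augmentation_chainMap] at h2
      rw [eq_sub_of_add_eq' h2, map_sub, chainMap_chainMap_inv, chainMap_single,
        cellMap_originCell]
    simp only [LinearMap.add_apply, LinearMap.comp_apply, LinearMap.id_apply,
      Finsupp.lsingle_apply]
    rw [average_apply, map_smul, map_sum]
    simp only [← chainMap_boundary, h1]
    rw [Finset.sum_const, Finset.card_univ, ← Nat.cast_smul_eq_nsmul ℂ, smul_smul,
      inv_mul_cancel₀ hc, one_smul]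
    abel
  · have h1 : ∀ w : P.weylGroup, chainMap P w (n + 1) (γ n (chainMap P w⁻¹ n (boundary o n x))) +
        chainMap P w (n + 1) (boundary o (n + 1) (γ (n + 1) (chainMap P w⁻¹ (n + 1) x))) = x :=
      fun w => by
        have h2 := LinearMap.congr_fun (h.degree_succ n) (chainMap P w⁻¹ (n + 1) x)
        simp only [LinearMap.add_apply, LinearMap.comp_apply, LinearMap.id_apply] at h2
        rw [chainMap_boundary, ← map_add, h2, chainMap_chainMap_inv]
    simp only [LinearMap.add_apply, LinearMap.comp_apply, LinearMap.id_apply]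
    rw [average_apply, average_apply, map_smul, map_sum, ← smul_add, ← Finset.sum_add_distrib]
    simp only [← chainMap_boundary, h1]
    rw [Finset.sum_const, Finset.card_univ, ← Nat.cast_smul_eq_nsmul ℂ, smul_smul,
      inv_mul_cancel₀ hc, one_smul]

/-- The integral hull of a polysimplex and the origin lies in the approximation `A(σ)` of the
convex hull. -/
lemma integralHull_subset_hull {σ : Set E} (hσ : σ ∈ polysimplices P) :
    integralHull P (σ ∪ {0}) ⊆ hull b σ := by
  obtain ⟨z, rfl⟩ := hσ
  obtain ⟨p, hp⟩ := exists_mem_alcove b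
  have hpa : p ∈ alcove b := mem_alcove_of_pos hp
  -- Boundedness is essential: `sInf` and `sSup` of unbounded sets of integers have default values.
  have hbdd : ∀ i, ∃ B : ℤ, ∀ y ∈ closedFacet P z ∪ alcove b,
      (-B : ℝ) ≤ P.coroot' i y ∧ P.coroot' i y ≤ B := by
    intro i
    obtain ⟨m, hm⟩ := exists_int_bounds P z i
    obtain ⟨m', hm'⟩ := exists_int_bounds P p i
    refine ⟨|m| + |m'| + 1, ?_⟩
    have h1 : |(m : ℝ)| = ((|m| : ℤ) : ℝ) := by push_cast; rfl
    have h2 : |(m' : ℝ)| = ((|m'| : ℤ) : ℝ) := by push_cast; rfl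
    have h3 := neg_abs_le (m : ℝ)
    have h4 := neg_abs_le (m' : ℝ)
    have h5 := le_abs_self (m : ℝ)
    have h6 := le_abs_self (m' : ℝ)
    have h7 := abs_nonneg (m : ℝ)
    have h8 := abs_nonneg (m' : ℝ)
    push_cast
    rintro y (hy | hy)
    · have := hm y hy
      constructor <;> linarith
    · have hy' : y ∈ closedFacet P p := by
        rw [closedFacet_eq_closedAlcove hp]
        exact ⟨fun i hi => (hy.1 i hi).le, fun i hi => (hy.2 i hi).le⟩
      have := hm' y hy'
      constructor <;> linarith
  intro x hx i
  obtain ⟨B, hB⟩ := hbdd i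
  have hlow : BddBelow ((fun y => ⌊P.coroot' i y⌋) '' (closedFacet P z ∪ alcove b)) := by
    refine ⟨-B, ?_⟩
    rintro _ ⟨y, hy, rfl⟩
    exact Int.le_floor.2 (by push_cast; exact (hB y hy).1)
  have hup : BddAbove ((fun y => ⌈P.coroot' i y⌉) '' (closedFacet P z ∪ alcove b)) := by
    refine ⟨B, ?_⟩
    rintro _ ⟨y, hy, rfl⟩
    exact Int.ceil_le.2 (hB y hy).2
  -- The coroots of the alcove point `p` lie in `(-1, 1)`, so their floors are at most `0` and their
  -- ceilings at least `0`. This puts the origin in the hull.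
  have hp1 := abs_lt.1 (abs_coroot'_lt_one hp i)
  constructor
  · refine hx i _ ?_
    rintro y (hy | rfl)
    · refine le_trans ?_ (Int.floor_le (P.coroot' i y))
      exact_mod_cast csInf_le hlow ⟨y, Or.inl hy, rfl⟩
    · rw [map_zero]
      have h1 := csInf_le hlow ⟨p, Or.inr hpa, rfl⟩
      have h2 : ⌊P.coroot' i p⌋ < 1 := Int.floor_lt.2 (by push_cast; exact hp1.2)
      exact_mod_cast (by dsimp only at h1; omega : sInf ((fun y => ⌊P.coroot' i y⌋) ''
        (closedFacet P z ∪ alcove b)) ≤ 0)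
  · refine integralHull_upper P hx ?_
    rintro y (hy | rfl)
    · refine le_trans (Int.le_ceil (P.coroot' i y)) ?_
      exact_mod_cast le_csSup hup ⟨y, Or.inl hy, rfl⟩
    · rw [map_zero]
      have h1 := le_csSup hup ⟨p, Or.inr hpa, rfl⟩
      have h2 : -1 < ⌈P.coroot' i p⌉ := Int.lt_ceil.2 (by push_cast; exact hp1.1)
      exact_mod_cast (by dsimp only at h1; omega : 0 ≤ sSup ((fun y => ⌈P.coroot' i y⌉) ''
        (closedFacet P z ∪ alcove b)))

end Averaging

end AlcoveComplex

end


open AlcoveComplex in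
theorem mainTheorem9 {ι E N : Type*} [Finite ι]
    [AddCommGroup E] [Module ℝ E] [AddCommGroup N] [Module ℝ N]
    (P : RootPairing ι ℝ E N) [P.IsRootSystem] [P.IsCrystallographic] [P.IsReduced]
    (b : P.Base) (o : AlcoveOrientation b) :
    ∃ (γ₀ : ℂ →ₗ[ℂ] Chain P 0) (γ : ∀ n : ℕ, Chain P n →ₗ[ℂ] Chain P (n + 1)),
      IsContraction o γ₀ γ ∧
      ((∀ w : P.weylGroup, chainMap P w 0 ∘ₗ γ₀ = γ₀) ∧
        ∀ (w : P.weylGroup) (n : ℕ),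
          chainMap P w (n + 1) ∘ₗ γ n = γ n ∘ₗ chainMap P w n) ∧
      (∀ (n : ℕ) (σ : Cell P n), chainSupport (γ n (Finsupp.single σ 1)) ⊆ hull b σ.1) ∧
      ∃ M : ℝ, ∀ (n : ℕ) (σ : Cell P n) (τ : Cell P (n + 1)),
        ‖γ n (Finsupp.single σ 1) τ‖ < M := by
  have := Fintype.ofFinite ι
  have := Fintype.ofFinite P.weylGroup
  obtain ⟨γ, hγ, hsupp, M, hM⟩ := exists_contraction o
  refine ⟨Finsupp.lsingle (originCell P), fun n => average (γ n), hγ.average, ⟨fun w => ?_,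
    fun w n => chainMap_average w _⟩, fun n σ => ?_, M, fun n => norm_average_lt (hM n)⟩
  · ext1
    rw [LinearMap.comp_apply, Finsupp.lsingle_apply, chainMap_single, cellMap_originCell]
  · exact chainSupport_subset_iff.2
      (chainsOn_mono (integralHull_subset_hull σ.2.1) _ (average_mem (hsupp n) σ))
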